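/- Let $m\ge 1$ and let $(\overline M,\bar g)$ be a globally hyperbolic spacetime of dimension $m+1$ with a splitting time function $\tau$. That is, $\overline M=\mathbb R\times S$ with $S$ a connected smooth $m$-manifold (without boundary), $\tau$ is the projection to $\mathbb R$ and $\pi$ the projection to $S$, all level sets of $\tau$ are Cauchy hypersurfaces, and $\bar g=\bar\alpha^2(-d\tau^2+\bar\sigma)$, where $\bar\alpha>0$ is a smooth function and $\bar\sigma$ is a smooth non-negative symmetric $2$-tensor whose kernel at each point is the line tangent to the factor $\mathbb R$ (so $\bar\nabla\tau$ generates the kernel). The time orientation is the one for which $\tau$ increases to the future. Let $\Sigma\subset\overline M$ be a smooth, compact, connected, achronal spacelike hypersurface with boundary (spacelike up to the boundary), whose Cauchy development $D(\Sigma)$ is precompact in $\overline M$. Let $\varphi=\tau|_\Sigma$ and let $\mathring\Sigma$ be the interior of $\Sigma$. For a smooth $u:\Sigma\to\mathbb R$ put $F_u(x)=(u(x),\pi(x))$ and $\sigma_u=F_u^*\bar\sigma$, a Riemannian metric on $\Sigma$. Let $dV_{\sigma_u}$ be its volume measure, $\mathrm d_{\sigma_u}$ its distance and $B_s(x)$ its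 balls, and where $|du|_{\sigma_u}<1$ let $w_u=(1-|du|_{\sigma_u}^2)^{-1/2}$ be the tilt function, $N_u$ the future pointing unit normal of the graph $F_u$, and $H_u$ its mean curvature in the direction $N_u$, i.e. the trace with respect to $F_u^*\bar g$ of $\mathrm{II}(Y,Z)=-\bar g(\overline\nabla_{F_{u*}Y}F_{u*}Z,N_u)$. Let $X$ be a smooth vector field on $\overline M$. Then there is a constant $C_X>0$, depending only on $(\overline M,\bar g)$, $\tau$, $\Sigma$ and $X$, such that the following holds. Let $\rho\in C^\infty(\Sigma)$ and let $u\in C^\infty(\Sigma)$ satisfy $u=\varphi$ on $\partial\Sigma$, $|du|_{\sigma_u}\le 1$ on $\Sigma$, $|du|_{\sigma_u}<1$ in $\mathring\Sigma$, and $$H_u=\rho+\bar g(X,N_u)\qquad\text{in }\mathring\Sigma .$$ Then for all $x\in\Sigma$ and all $0<s<r<\mathrm d_{\sigma_u}(x,\partial\Sigma)$ the functions $w_u$ and $\rho$ are integrable on $B_r(x)$ with respect to $dV_{\sigma_u}$ and, with $I(t)=\int_{B_t(x)}w_u\,dV_{\sigma_u}$, $$I(s)\le C_X\,s\left(\frac{I(r)}{r}+\int_{B_r(x)}|\rho|\,dV_{\sigma_u}+r^{m-1}\right).$$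 -/

import Mathlib

open Set Filter MeasureTheory
open scoped Manifold ContDiff Topology ENNReal Bundle

noncomputable section

/-! ### Riemannian metrics on manifolds with boundary: norm, distance, volume -/

namespace PMC

section Riemannian

variable {m : ℕ} {H : Type*} [TopologicalSpace H]
  (I : ModelWithCorners ℝ (EuclideanSpace ℝ (Fin m)) H)
  {M : Type*} [TopologicalSpace M] [ChartedSpace H M]

/-- The norm `|ℓ|_σ` of a covector with respect to a scalar product `σ`. -/
def covectorNorm {V : Type*} (σ : V → V → ℝ) (ℓ : V → ℝ) : ℝ :=
  sSup ((fun v => |ℓ v|) '' {v | σ v v ≤ 1})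

/-- The Riemannian distance of a metric `σ` on `M`: the infimum of the `σ`-lengths of the
`C^1` paths in `M` between two points. -/
def metricEDist (σ : ∀ x : M, TangentSpace I x → TangentSpace I x → ℝ) (x y : M) : ℝ≥0∞ :=
  letI : ∀ z : M, ENorm (TangentSpace I z) := fun z => ⟨fun v => ENNReal.ofReal √(σ z v v)⟩
  Manifold.riemannianEDist I x y

/-- The ball of centre `x` and radius `s` in the Riemannian distance of `σ`. -/
def metricBall (σ : ∀ x : M, TangentSpace I x → TangentSpace I x → ℝ) (x : M) (s : ℝ) : Set M :=
  {y | metricEDist I σ x y < ENNReal.ofReal s}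

/-- The distance of `x` from the boundary of `M` (it is `∞` if the boundary is empty). -/
def edistToBoundary (σ : ∀ x : M, TangentSpace I x → TangentSpace I x → ℝ) (x : M) : ℝ≥0∞ :=
  ⨅ y ∈ I.boundary M, metricEDist I σ x y

/-- The Gram matrix `σ_{ij}` of `σ` in the chart around `c`, at the point of coordinates `y`. -/
def chartGram (σ : ∀ x : M, TangentSpace I x → TangentSpace I x → ℝ) (c : M)
    (y : EuclideanSpace ℝ (Fin m)) : Matrix (Fin m) (Fin m) ℝ :=
  Matrix.of fun i j =>
    let D := mfderivWithin 𝓘(ℝ, EuclideanSpace ℝ (Fin m)) I (extChartAt I c).symm (range I) y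
    σ ((extChartAt I c).symm y)
      (D (EuclideanSpace.single i (1 : ℝ))) (D (EuclideanSpace.single j (1 : ℝ)))

/-- The Riemannian volume on the domain of the chart around `c`: the density
`√(det σ_{ij}) dy` in coordinates. -/
def chartVolume [MeasurableSpace M]
    (σ : ∀ x : M, TangentSpace I x → TangentSpace I x → ℝ) (c : M) : Measure M :=
  Measure.map (extChartAt I c).symm
    ((volume.restrict (extChartAt I c).target).withDensity
      fun y => ENNReal.ofReal √((chartGram I σ c y).det))

/-- The Riemannian volume measure `dV_σ`. By the change of variables formula the measures
`chartVolume I σ c` agree on the overlaps of the charts, so that (countably many charts covering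
`M`) their supremum is the measure which restricts to each of them. -/
def riemannianVolume [MeasurableSpace M]
    (σ : ∀ x : M, TangentSpace I x → TangentSpace I x → ℝ) : Measure M :=
  ⨆ c : M, chartVolume I σ c

end Riemannian

/-! ### Spacetimes split by a time function -/

/-- The model with corners of `ℝ × S`, where `S` is an `m`-dimensional manifold. -/
abbrev stModel (m : ℕ) : ModelWithCorners ℝ (ℝ × EuclideanSpace ℝ (Fin m))
    (ModelProd ℝ (EuclideanSpace ℝ (Fin m))) :=
  (𝓘(ℝ, ℝ)).prod (𝓡 m)

section Spacetime

variable {m : ℕ} {S : Type*} [TopologicalSpace S] [ChartedSpace (EuclideanSpace ℝ (Fin m)) S]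

/-- The differential at `p` of the time function `τ (t, x) = t` on `ℝ × S`. -/
def dtau (p : ℝ × S) (v : TangentSpace (stModel m) p) : ℝ :=
  mfderiv (stModel m) 𝓘(ℝ, ℝ) (Prod.fst : ℝ × S → ℝ) p v

/-- The differential at `p` of the projection `π (t, x) = x` of `ℝ × S` onto `S`. -/
def dpi (p : ℝ × S) (v : TangentSpace (stModel m) p) : TangentSpace (𝓡 m) p.2 :=
  mfderiv (stModel m) (𝓡 m) (Prod.snd : ℝ × S → S) p v

variable (m S) in
/-- The data of a metric `α² (-dτ² + σ)` on `ℝ × S`: a smooth positive lapse function `α` and a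
smooth symmetric 2-tensor `σ` on `ℝ × S`, non-negative, whose kernel at each point is
the line tangent to `ℝ` (the line of the gradient of `τ`). -/
structure SplitMetric [IsManifold (𝓡 m) ∞ S] where
  lapse : ℝ × S → ℝ
  lapse_smooth : ContMDiff (stModel m) 𝓘(ℝ, ℝ) ∞ lapse
  lapse_pos : ∀ p, 0 < lapse p
  sig : ∀ p : ℝ × S, TangentSpace (stModel m) p →L[ℝ] TangentSpace (stModel m) p →L[ℝ] ℝ
  sig_smooth : ContMDiff (stModel m)
    ((stModel m).prod
      𝓘(ℝ, (ℝ × EuclideanSpace ℝ (Fin m)) →L[ℝ] (ℝ × EuclideanSpace ℝ (Fin m)) →L[ℝ] ℝ)) ∞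
    (fun p => Bundle.TotalSpace.mk'
      ((ℝ × EuclideanSpace ℝ (Fin m)) →L[ℝ] (ℝ × EuclideanSpace ℝ (Fin m)) →L[ℝ] ℝ)
      (E := fun p : ℝ × S =>
        TangentSpace (stModel m) p →L[ℝ] TangentSpace (stModel m) p →L[ℝ] ℝ) p (sig p))
  sig_symm : ∀ p v w, sig p v w = sig p w v
  sig_ker : ∀ p v w, dpi p v = 0 → sig p v w = 0
  sig_pos : ∀ p v, dpi p v ≠ 0 → 0 < sig p v v

namespace SplitMetric

variable [IsManifold (𝓡 m) ∞ S] (𝓜 : SplitMetric m S)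

/-- The Lorentzian metric `α² (-dτ² + σ)`. -/
def gbar (p : ℝ × S) (v w : TangentSpace (stModel m) p) : ℝ :=
  𝓜.lapse p ^ 2 * (-(dtau p v * dtau p w) + 𝓜.sig p v w)

/-- Future pointing timelike vectors. The time orientation is the one for which `τ` increases to
the future. -/
def FutureTimelike (p : ℝ × S) (v : TangentSpace (stModel m) p) : Prop :=
  𝓜.gbar p v v < 0 ∧ 0 < dtau p v

/-- Past pointing causal (timelike or null) vectors. -/
def PastCausal (p : ℝ × S) (v : TangentSpace (stModel m) p) : Prop :=
  𝓜.gbar p v v ≤ 0 ∧ dtau p v < 0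

end SplitMetric

/-- `γ` is a piecewise `C^1` curve on the interval `J` whose velocity (one-sided velocities at the
break points, which form a locally finite set `P`) satisfies the condition `Q`. -/
def IsPiecewiseC1 (Q : ∀ p : ℝ × S, TangentSpace (stModel m) p → Prop) (γ : ℝ → ℝ × S)
    (J : Set ℝ) : Prop :=
  ContinuousOn γ J ∧ ∃ P : Set ℝ, (∀ a b : ℝ, (P ∩ Icc a b).Finite) ∧
    ∀ a b : ℝ, a < b → Icc a b ⊆ J → Disjoint (Ioo a b) P →
      ContMDiffOn 𝓘(ℝ, ℝ) (stModel m) 1 γ (Icc a b) ∧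
      ∀ t ∈ Icc a b, Q (γ t) (mfderivWithin 𝓘(ℝ, ℝ) (stModel m) γ (Icc a b) t (1 : ℝ))

namespace SplitMetric

variable [IsManifold (𝓡 m) ∞ S] (𝓜 : SplitMetric m S)

/-- Inextendible (future pointing) timelike curves, parametrized over `ℝ`: they have no limit
point at either end. -/
def InextendibleTimelike (γ : ℝ → ℝ × S) : Prop :=
  IsPiecewiseC1 𝓜.FutureTimelike γ univ ∧
    (¬ ∃ q, Tendsto γ atTop (𝓝 q)) ∧ (¬ ∃ q, Tendsto γ atBot (𝓝 q))

/-- Inextendible past pointing causal curves starting at `p`, parametrized over `[0, ∞)`. -/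
def PastInextendibleCausalFrom (p : ℝ × S) (γ : ℝ → ℝ × S) : Prop :=
  IsPiecewiseC1 𝓜.PastCausal γ (Ici 0) ∧ γ 0 = p ∧ ¬ ∃ q, Tendsto γ atTop (𝓝 q)

/-- Inextendible future pointing causal curves starting at `p`, parametrized over `[0, ∞)`
(causal: the opposite vector is past pointing and causal). -/
def FutureInextendibleCausalFrom (p : ℝ × S) (γ : ℝ → ℝ × S) : Prop :=
  IsPiecewiseC1 (fun q v => 𝓜.PastCausal q (-v)) γ (Ici 0) ∧ γ 0 = p ∧
    ¬ ∃ q, Tendsto γ atTop (𝓝 q)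

/-- A Cauchy hypersurface is met exactly once by every inextendible timelike curve. -/
def IsCauchyHypersurface (A : Set (ℝ × S)) : Prop :=
  ∀ γ, 𝓜.InextendibleTimelike γ → ∃! t : ℝ, γ t ∈ A

/-- The time function `τ (t, x) = t` is a splitting time function: all its level sets are Cauchy
hypersurfaces. In particular the spacetime is globally hyperbolic. -/
def IsSplitting : Prop :=
  ∀ t : ℝ, 𝓜.IsCauchyHypersurface {p | p.1 = t}

/-- A set is achronal if every inextendible timelike curve meets it at most once. -/
def IsAchronal (A : Set (ℝ × S)) : Prop :=
  ∀ γ, 𝓜.InextendibleTimelike γ → ∀ s t : ℝ, γ s ∈ A → γ t ∈ A → s = t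

/-- The Cauchy development `D(A) = D⁺(A) ∪ D⁻(A)`. -/
def cauchyDevelopment (A : Set (ℝ × S)) : Set (ℝ × S) :=
  {p | ∀ γ, 𝓜.PastInextendibleCausalFrom p γ → ∃ t, 0 ≤ t ∧ γ t ∈ A} ∪
  {p | ∀ γ, 𝓜.FutureInextendibleCausalFrom p γ → ∃ t, 0 ≤ t ∧ γ t ∈ A}

end SplitMetric

/-! ### Spacelike hypersurfaces, height functions and mean curvature -/

section Hypersurface

variable [NeZero m] {N : Type*} [TopologicalSpace N] [ChartedSpace (EuclideanHalfSpace m) N]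

/-- The differential at `x` of a real function on the hypersurface. -/
def dFun (u : N → ℝ) (x : N) (v : TangentSpace (𝓡∂ m) x) : ℝ :=
  mfderiv (𝓡∂ m) 𝓘(ℝ, ℝ) u x v

/-- The graph map `F_u (x) = (u (x), π (x))`, for a hypersurface parametrized by `ι`. -/
def graphMap (ι : N → ℝ × S) (u : N → ℝ) (x : N) : ℝ × S := (u x, (ι x).2)

/-- The differential of a map into the spacetime. -/
def dMap (F : N → ℝ × S) (x : N) (v : TangentSpace (𝓡∂ m) x) : TangentSpace (stModel m) (F x) :=
  mfderiv (𝓡∂ m) (stModel m) F x v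

namespace SplitMetric

variable [IsManifold (𝓡 m) ∞ S] (𝓜 : SplitMetric m S)

/-- The image of `ι` is a smooth compact spacelike hypersurface with boundary: `N` is a compact
connected manifold with (possibly empty) boundary, `ι` is a smooth injective map,
the induced metric is positive definite up to the boundary (in particular `ι` is an
immersion, and an embedding by compactness), and the image is achronal. -/
structure IsCompactSpacelike (ι : N → ℝ × S) : Prop where
  compact : CompactSpace N
  connected : ConnectedSpace N
  smooth : ContMDiff (𝓡∂ m) (stModel m) ∞ ι
  injective : Function.Injective ι
  spacelike : ∀ (x : N) (v : TangentSpace (𝓡∂ m) x), v ≠ 0 →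
    0 < 𝓜.gbar (ι x) (dMap ι x v) (dMap ι x v)
  achronal : 𝓜.IsAchronal (range ι)

/-- The metric `σ_u = F_u^* σ`. -/
def sigU (ι : N → ℝ × S) (u : N → ℝ) (x : N) (v w : TangentSpace (𝓡∂ m) x) : ℝ :=
  𝓜.sig (graphMap ι u x) (dMap (graphMap ι u) x v) (dMap (graphMap ι u) x w)

/-- The function `|du|_{σ_u}`. -/
def gradNorm (ι : N → ℝ × S) (u : N → ℝ) (x : N) : ℝ :=
  covectorNorm (𝓜.sigU ι u x) (dFun u x)

/-- The tilt function `w_u = (1 - |du|²_{σ_u})^{-1/2}`. -/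
def tilt (ι : N → ℝ × S) (u : N → ℝ) (x : N) : ℝ :=
  1 / √(1 - 𝓜.gradNorm ι u x ^ 2)

/-- The smooth elements of `𝒴_τ(Σ)`: the smooth functions `u` on the hypersurface (up to the
boundary) with `|du|_{σ_u} ≤ 1`, which agree with the height `φ = τ ∘ ι` of the hypersurface on
its boundary. -/
structure IsSmoothHeight (ι : N → ℝ × S) (u : N → ℝ) : Prop where
  smooth : ContMDiff (𝓡∂ m) 𝓘(ℝ, ℝ) ∞ u
  gradNorm_le : ∀ x, 𝓜.gradNorm ι u x ≤ 1
  boundary : ∀ x ∈ (𝓡∂ m).boundary N, u x = (ι x).1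

/-- `n` is the future pointing unit normal at `F x` of the spacelike hypersurface
parametrized by `F`. -/
structure IsFutureUnitNormal (F : N → ℝ × S) (x : N) (n : TangentSpace (stModel m) (F x)) :
    Prop where
  normal : ∀ v, 𝓜.gbar (F x) n (dMap F x v) = 0
  unit : 𝓜.gbar (F x) n n = -1
  future : 0 < dtau (F x) n

/-- The components `g(a, b)` of the Lorentzian metric in the chart around `p`, at the point of
coordinates `z`. -/
def chartMetric (p : ℝ × S) (z a b : ℝ × EuclideanSpace ℝ (Fin m)) : ℝ :=
  let e := extChartAt (stModel m) p
  let D := mfderiv 𝓘(ℝ, ℝ × EuclideanSpace ℝ (Fin m)) (stModel m) e.symm z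
  𝓜.gbar (e.symm z) (D a) (D b)

/-- The Christoffel symbols of the first kind in the chart around `p`: the value of
`g(Γ(a, b), c) = (∂_a g(b, c) + ∂_b g(a, c) - ∂_c g(a, b)) / 2` at the point of coordinates `z`. -/
def christoffel (p : ℝ × S) (z a b c : ℝ × EuclideanSpace ℝ (Fin m)) : ℝ :=
  (fderiv ℝ (fun y => 𝓜.chartMetric p y b c) z a
    + fderiv ℝ (fun y => 𝓜.chartMetric p y a c) z b
    - fderiv ℝ (fun y => 𝓜.chartMetric p y a b) z c) / 2

/-- The matrix `II(∂_i, ∂_j) = - g(∇_{∂_i F} ∂_j F, n)` of the second fundamental form of `F` in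
the direction `n`, at an interior point `x`, with respect to the coordinates of the chart
around `x`; here `∇_{∂_i F} ∂_j F = ∂_i ∂_j F + Γ(∂_i F, ∂_j F)` is the Levi-Civita connection
of the spacetime in the chart around `F x`. -/
def secondFF (F : N → ℝ × S) (x : N) (n : TangentSpace (stModel m) (F x)) :
    Matrix (Fin m) (Fin m) ℝ :=
  let f := writtenInExtChartAt (𝓡∂ m) (stModel m) x F
  let y := extChartAt (𝓡∂ m) x x
  let z := extChartAt (stModel m) (F x) (F x)
  let n' : ℝ × EuclideanSpace ℝ (Fin m) :=
    mfderiv (stModel m) 𝓘(ℝ, ℝ × EuclideanSpace ℝ (Fin m)) (extChartAt (stModel m) (F x)) (F x) n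
  let e : Fin m → EuclideanSpace ℝ (Fin m) := fun i => EuclideanSpace.single i 1
  Matrix.of fun i j =>
    -(𝓜.chartMetric (F x) z (fderiv ℝ (fun y' => fderiv ℝ f y' (e j)) y (e i)) n'
      + 𝓜.christoffel (F x) z (fderiv ℝ f y (e i)) (fderiv ℝ f y (e j)) n')

/-- The matrix `g_{ij}` of the induced metric `F^* g` at an interior point `x`, with respect to
the coordinates of the chart around `x`. -/
def inducedGram (F : N → ℝ × S) (x : N) : Matrix (Fin m) (Fin m) ℝ :=
  let f := writtenInExtChartAt (𝓡∂ m) (stModel m) x F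
  let y := extChartAt (𝓡∂ m) x x
  let z := extChartAt (stModel m) (F x) (F x)
  let e : Fin m → EuclideanSpace ℝ (Fin m) := fun i => EuclideanSpace.single i 1
  Matrix.of fun i j => 𝓜.chartMetric (F x) z (fderiv ℝ f y (e i)) (fderiv ℝ f y (e j))

/-- The mean curvature of `F` in the direction `n` at the interior point `x`: the trace
`g^{ij} II_{ij}` of the second fundamental form. -/
def meanCurvature (F : N → ℝ × S) (x : N) (n : TangentSpace (stModel m) (F x)) : ℝ :=
  ((𝓜.inducedGram F x)⁻¹ * 𝓜.secondFF F x n).trace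

/-- `u` is a smooth classical solution of the prescribed mean curvature problem
`H_u = ρ + g(X, N_u)`, `u ∈ 𝒴_τ(Σ)`: a smooth height function, spacelike in the interior, such
that the equation holds at each interior point. -/
structure IsSmoothSolution (ι : N → ℝ × S) (X : ∀ p : ℝ × S, TangentSpace (stModel m) p)
    (ρ : N → ℝ) (u : N → ℝ) : Prop extends 𝓜.IsSmoothHeight ι u where
  spacelike : ∀ x ∈ (𝓡∂ m).interior N, 𝓜.gradNorm ι u x < 1
  equation : ∀ x ∈ (𝓡∂ m).interior N,
    ∃ n : TangentSpace (stModel m) (graphMap ι u x),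
      𝓜.IsFutureUnitNormal (graphMap ι u) x n ∧
      𝓜.meanCurvature (graphMap ι u) x n = ρ x + 𝓜.gbar (graphMap ι u x) (X _) n

end SplitMetric

end Hypersurface

end Spacetime

end PMC

end

/-! The graph of `u` carries a natural vector density: the tangential part of `-∂_t` times the area
density of the induced metric. The projection contributes `w²` and the area density `1/w`, so this
flux is `α^m √det σ_u · w · ∇u` (`flux_eq`), linear in the tilt. Its divergence is given by the
first variation formula in terms of `∂_t ḡ` and of the mean curvature (`first_variation`). Inserting
`H = ρ + ḡ(X, N)` and using that `N` has size `w` in coordinates, the divergence is at most a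
constant times `√det σ_u (w + |ρ|)` (`abs_div_flux_le`): the quadratic terms in `w` lose one power
to the area density.

This divergence is tested against a truncation of `u - u(x)` at height `T`, times a cutoff function
(`local_energy`). The good term is the integral of `w |du|²`; every other term carries the factor
`T`. Since `|du| ≤ 1`, the height is Lipschitz, so on a coordinate ball of radius `t` the truncation
may be made at height `L t`, which produces the factor `s` of the theorem. Finally `w = w |du|² +
1/w` with `1/w ≤ 1`, so the energy controls `∫ w` up to a volume of order `t^m`
(`GoodChart.local_estimate`).

The constants must not depend on `u`. In coordinates `σ_u` depends on `u` only through the value of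
the height (`SplitMetric.sigU_nD`), so bounds follow by compactness once the heights are bounded.
The height bound comes from causality: a causal curve that starts on the graph and runs towards `Σ`
cannot leave the region between `Σ` and the graph without meeting `Σ`, and it cannot stay in this
compact region forever, because it would converge (`CausalCurve.exists_tendsto`). So the graph lies
in the precompact set `D(Σ)` (`SplitMetric.exists_height_bound`). There are then charts with uniform
bounds (`exists_uniform_goodChart`) in which metric balls lie between coordinate balls, and a
uniform bound `D` for the distance to the boundary (`exists_edistToBoundary_le`). The boundary is
nonempty, since otherwise all constants would be admissible heights.

On metric balls (`GoodChart.ball_estimate`), small `s` is covered by the local estimate, and for `s`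
comparable with `r` the monotonicity of the integral suffices. The remaining lemmas connect the
definitions of curvature, distance and volume with fixed charts: `SplitMetric.meanCurvature_eq`,
`mem_ball_of_metricEDist_lt`, `riemannianVolume_restrict`. -/

noncomputable section

namespace PMC

/-! ### Hypersurfaces in coordinates -/

section Calculus

set_option synthInstance.maxHeartbeats 200000

variable {E : Type*} [NormedAddCommGroup E] [NormedSpace ℝ E]
  {W : Type*} [NormedAddCommGroup W] [NormedSpace ℝ W]
  {W' : Type*} [NormedAddCommGroup W'] [NormedSpace ℝ W']

/-- The Christoffel symbols of the first kind of the metric `B`. -/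
def christ (B : W → W →L[ℝ] W →L[ℝ] ℝ) (z a b c : W) : ℝ :=
  (fderiv ℝ B z a b c + fderiv ℝ B z b a c - fderiv ℝ B z c a b) / 2

/-- The second fundamental form of `f` in the direction `n`. -/
def sff (B : W → W →L[ℝ] W →L[ℝ] ℝ) (f : E → W) (y : E) (n : W) (v w : E) : ℝ :=
  -(B (f y) (fderiv ℝ (fderiv ℝ f) y v w) n
    + christ B (f y) (fderiv ℝ f y v) (fderiv ℝ f y w) n)

/-- The first fundamental form of `f`. -/
def fff (B : W → W →L[ℝ] W →L[ℝ] ℝ) (f : E → W) (y : E) (v w : E) : ℝ :=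
  B (f y) (fderiv ℝ f y v) (fderiv ℝ f y w)

/-- Leibniz rule applied to `Dg(h) ∘ Dh`, an identity valid near `y` because being `C²` at a point
gives differentiability nearby. -/
theorem fderiv_fderiv_comp {g : W → W'} {h : E → W} {y : E} (hg : ContDiffAt ℝ 2 g (h y))
    (hh : ContDiffAt ℝ 2 h y) (v w : E) :
    fderiv ℝ (fderiv ℝ (fun x => g (h x))) y v w =
      fderiv ℝ (fderiv ℝ g) (h y) (fderiv ℝ h y v) (fderiv ℝ h y w)
        + fderiv ℝ g (h y) (fderiv ℝ (fderiv ℝ h) y v w) := by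
  have e1 : fderiv ℝ (fun x => g (h x)) =ᶠ[𝓝 y]
      fun x => (fderiv ℝ g (h x)).comp (fderiv ℝ h x) := by
    have h1 : ∀ᶠ x in 𝓝 y, ContDiffAt ℝ 2 h x := hh.eventually (by simp)
    have h2 : ∀ᶠ x in 𝓝 y, ContDiffAt ℝ 2 g (h x) :=
      hh.continuousAt.eventually (hg.eventually (by simp))
    filter_upwards [h1, h2] with x h1 h2
    exact fderiv_comp x (h2.differentiableAt (by simp)) (h1.differentiableAt (by simp))
  rw [e1.fderiv_eq]
  have d1 : DifferentiableAt ℝ (fderiv ℝ g) (h y) :=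
    (hg.fderiv_right (m := 1) (by norm_num)).differentiableAt (by simp)
  have d2 : DifferentiableAt ℝ (fderiv ℝ h) y :=
    (hh.fderiv_right (m := 1) (by norm_num)).differentiableAt (by simp)
  have d3 : HasFDerivAt (fun x => fderiv ℝ g (h x))
      ((fderiv ℝ (fderiv ℝ g) (h y)).comp (fderiv ℝ h y)) y :=
    d1.hasFDerivAt.comp y (hh.differentiableAt (by simp)).hasFDerivAt
  rw [(d3.clm_comp d2.hasFDerivAt).fderiv]
  simp [add_comm]

/-- Differentiating the pulled-back metric produces six terms with `D²Θ` in the Christoffel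
combination. By the symmetry of `D²Θ` and of `B'` four of them cancel and the other two are equal,
which leaves the usual inhomogeneous term. -/
theorem christ_comp {B' : W' → W' →L[ℝ] W' →L[ℝ] ℝ} {B : W → W →L[ℝ] W →L[ℝ] ℝ} {Θ : W → W'}
    {z : W} (hB' : DifferentiableAt ℝ B' (Θ z)) (hBd : DifferentiableAt ℝ B z)
    (hΘ : ContDiffAt ℝ 2 Θ z)
    (hB : ∀ᶠ x in 𝓝 z, ∀ a b, B x a b = B' (Θ x) (fderiv ℝ Θ x a) (fderiv ℝ Θ x b))
    (hsymm : ∀ a b, B' (Θ z) a b = B' (Θ z) b a) (a b c : W) :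
    christ B z a b c = christ B' (Θ z) (fderiv ℝ Θ z a) (fderiv ℝ Θ z b) (fderiv ℝ Θ z c)
      + B' (Θ z) (fderiv ℝ (fderiv ℝ Θ) z a b) (fderiv ℝ Θ z c) := by
  have dΘ : HasFDerivAt Θ (fderiv ℝ Θ z) z := (hΘ.differentiableAt (by simp)).hasFDerivAt
  have d2 : HasFDerivAt (fderiv ℝ Θ) (fderiv ℝ (fderiv ℝ Θ) z) z :=
    ((hΘ.fderiv_right (m := 1) (by norm_num)).differentiableAt (by simp)).hasFDerivAt
  have sym : IsSymmSndFDerivAt ℝ Θ z := hΘ.isSymmSndFDerivAt (by simp)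
  have key : ∀ v a b, fderiv ℝ B z v a b =
      fderiv ℝ B' (Θ z) (fderiv ℝ Θ z v) (fderiv ℝ Θ z a) (fderiv ℝ Θ z b)
      + B' (Θ z) (fderiv ℝ (fderiv ℝ Θ) z v a) (fderiv ℝ Θ z b)
      + B' (Θ z) (fderiv ℝ Θ z a) (fderiv ℝ (fderiv ℝ Θ) z v b) := by
    intro v a b
    have e1 : HasFDerivAt (fun x => B x a b) _ z :=
      (hBd.hasFDerivAt.clm_apply (hasFDerivAt_const a z)).clm_apply (hasFDerivAt_const b z)
    have e2 : HasFDerivAt (fun x => B' (Θ x) (fderiv ℝ Θ x a) (fderiv ℝ Θ x b)) _ z :=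
      (((hB'.hasFDerivAt.comp z dΘ).clm_apply (d2.clm_apply (hasFDerivAt_const a z)))).clm_apply
        (d2.clm_apply (hasFDerivAt_const b z))
    have e3 := e1.unique (e2.congr_of_eventuallyEq (hB.mono fun x hx => hx a b))
    have e4 := congrArg (fun L => L v) e3
    simp at e4
    rw [e4]
    ring
  simp only [christ, key]
  rw [sym.eq b a, sym.eq c a, sym.eq c b, hsymm (fderiv ℝ Θ z b) (fderiv ℝ (fderiv ℝ Θ) z a c)]
  ring

/-- Invariance of the second fundamental form under a change of coordinates in the target. -/
theorem sff_target {B' : W' → W' →L[ℝ] W' →L[ℝ] ℝ} {B : W → W →L[ℝ] W →L[ℝ] ℝ} {Θ : W → W'}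
    {f : E → W} {y : E} (hB' : DifferentiableAt ℝ B' (Θ (f y)))
    (hBd : DifferentiableAt ℝ B (f y)) (hΘ : ContDiffAt ℝ 2 Θ (f y))
    (hf : ContDiffAt ℝ 2 f y)
    (hB : ∀ᶠ x in 𝓝 (f y), ∀ a b, B x a b = B' (Θ x) (fderiv ℝ Θ x a) (fderiv ℝ Θ x b))
    (hsymm : ∀ a b, B' (Θ (f y)) a b = B' (Θ (f y)) b a) (n : W) (v w : E) :
    sff B' (fun x => Θ (f x)) y (fderiv ℝ Θ (f y) n) v w = sff B f y n v w := by
  have e1 : fderiv ℝ (fun x => Θ (f x)) y = (fderiv ℝ Θ (f y)).comp (fderiv ℝ f y) :=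
    fderiv_comp y (hΘ.differentiableAt (by simp)) (hf.differentiableAt (by simp))
  simp only [sff, fderiv_fderiv_comp hΘ hf, e1, ContinuousLinearMap.comp_apply]
  -- The term `D²Θ(∂_v f, ∂_w f)` from the second order chain rule is exactly the inhomogeneous term
  -- in the transformation of the Christoffel symbols.
  rw [christ_comp hB' hBd hΘ hB hsymm, hB.self_of_nhds]
  simp
  ring

theorem fff_target {B' : W' → W' →L[ℝ] W' →L[ℝ] ℝ} {B : W → W →L[ℝ] W →L[ℝ] ℝ} {Θ : W → W'}
    {f : E → W} {y : E} (hΘ : DifferentiableAt ℝ Θ (f y)) (hf : DifferentiableAt ℝ f y)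
    (hB : ∀ a b, B (f y) a b = B' (Θ (f y)) (fderiv ℝ Θ (f y) a) (fderiv ℝ Θ (f y) b))
    (v w : E) :
    fff B' (fun x => Θ (f x)) y v w = fff B f y v w := by
  have e1 : fderiv ℝ (fun x => Θ (f x)) y = (fderiv ℝ Θ (f y)).comp (fderiv ℝ f y) :=
    fderiv_comp y hΘ hf
  simp [fff, e1, hB]

variable {E₂ : Type*} [NormedAddCommGroup E₂] [NormedSpace ℝ E₂]

/-- The second fundamental form in the direction of a normal vector is tensorial under a change
of the parametrization. -/
theorem sff_source {B : W → W →L[ℝ] W →L[ℝ] ℝ} {f : E → W} {ψ : E₂ → E} {y : E₂}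
    (hf : ContDiffAt ℝ 2 f (ψ y)) (hψ : ContDiffAt ℝ 2 ψ y) {n : W}
    (hn : ∀ v, B (f (ψ y)) (fderiv ℝ f (ψ y) v) n = 0) (v w : E₂) :
    sff B (fun x => f (ψ x)) y n v w
      = sff B f (ψ y) n (fderiv ℝ ψ y v) (fderiv ℝ ψ y w) := by
  have e1 : fderiv ℝ (fun x => f (ψ x)) y = (fderiv ℝ f (ψ y)).comp (fderiv ℝ ψ y) :=
    fderiv_comp y (hf.differentiableAt (by simp)) (hψ.differentiableAt (by simp))
  simp only [sff, fderiv_fderiv_comp hf hψ, e1, ContinuousLinearMap.comp_apply]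
  -- The second derivative of `ψ` enters only through `Df(D²ψ)`, a tangent vector, which is
  -- orthogonal to `n`.
  simp [hn]

end Calculus

/-! ### The first variation formula -/

section FirstVariation

set_option synthInstance.maxHeartbeats 200000

variable {m : ℕ} {E : Type*} [NormedAddCommGroup E] [NormedSpace ℝ E]

open Matrix in
/-- Jacobi's formula. -/
theorem hasFDerivAt_det {G : E → Matrix (Fin m) (Fin m) ℝ}
    {G' : Fin m → Fin m → E →L[ℝ] ℝ} {y : E}
    (hG : ∀ i j, HasFDerivAt (fun x => G x i j) (G' i j) y) :
    HasFDerivAt (fun x => (G x).det) (∑ i, ∑ j, (G y).adjugate j i • G' i j) y := by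
  -- The determinant is regarded as a continuous alternating map of the rows: its derivative is the
  -- sum of the determinants in which one row is replaced by its derivative.
  let D : (Fin m → ℝ) [⋀^Fin m]→L[ℝ] ℝ :=
    { (Matrix.detRowAlternating : (Fin m → ℝ) [⋀^Fin m]→ₗ[ℝ] ℝ) with
      cont := by
        change Continuous fun A : Matrix (Fin m) (Fin m) ℝ => A.det
        exact continuous_id.matrix_det }
  have hD : ∀ A : Fin m → Fin m → ℝ, D A = Matrix.det (Matrix.of A) := fun A => rfl
  have h1 : HasFDerivAt (fun x => (fun i j => G x i j : Fin m → Fin m → ℝ))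
      (ContinuousLinearMap.pi fun i => ContinuousLinearMap.pi fun j => G' i j) y :=
    hasFDerivAt_pi.2 fun i => hasFDerivAt_pi.2 fun j => hG i j
  have h2 := (ContinuousAlternatingMap.hasFDerivAt D (fun i j => G y i j)).comp y h1
  refine h2.congr_fderiv ?_
  ext v
  simp only [ContinuousLinearMap.comp_apply, ContinuousMultilinearMap.linearDeriv_apply]
  simp only [_root_.sum_apply, _root_.smul_apply, smul_eq_mul]
  refine Finset.sum_congr rfl fun i _ => ?_
  have : (D.1 (Function.update (fun i j => G y i j) i (fun j => G' i j v)) : ℝ)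
      = ((G y).updateRow i (fun j => G' i j v)).det := rfl
  refine Eq.trans this ?_
  -- A determinant with one row replaced is a Cramer determinant, hence a row of adjugate entries
  -- paired with the new row.
  rw [← Matrix.cramer_transpose_apply, Matrix.cramer_eq_adjugate_mulVec,
    ← Matrix.adjugate_transpose]
  simp [Matrix.mulVec, dotProduct]


theorem contDiffAt_det {k : ℕ∞ω} {G : E → Matrix (Fin m) (Fin m) ℝ} {y : E}
    (hG : ∀ i j, ContDiffAt ℝ k (fun x => G x i j) y) :
    ContDiffAt ℝ k (fun x => (G x).det) y := by
  simp only [Matrix.det_apply']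
  exact ContDiffAt.sum fun σ _ => contDiffAt_const.mul (contDiffAt_prod fun i _ => hG _ _)

theorem contDiffAt_inv_apply {k : ℕ∞ω} {G : E → Matrix (Fin m) (Fin m) ℝ} {y : E}
    (hG : ∀ i j, ContDiffAt ℝ k (fun x => G x i j) y) (h0 : (G y).det ≠ 0) (i j : Fin m) :
    ContDiffAt ℝ k (fun x => (G x)⁻¹ i j) y := by
  have h1 : ContDiffAt ℝ k (fun x => (G x).adjugate i j) y := by
    simp only [Matrix.adjugate_apply]
    refine contDiffAt_det fun a b => ?_
    by_cases h : a = j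
    · subst h; simpa using contDiffAt_const
    · simpa [Matrix.updateRow_ne h] using hG a b
  simp only [Matrix.inv_def, Matrix.smul_apply, smul_eq_mul, Ring.inverse_eq_inv']
  exact ((contDiffAt_det hG).inv h0).mul h1

variable {W : Type*} [NormedAddCommGroup W] [NormedSpace ℝ W]

/-- The coordinate space. -/
abbrev Eu (m : ℕ) := EuclideanSpace ℝ (Fin m)

/-- The standard basis vectors. -/
abbrev eb (i : Fin m) : Eu m := EuclideanSpace.single i 1

/-- The Gram matrix of the first fundamental form. -/
def gramF (B : W → W →L[ℝ] W →L[ℝ] ℝ) (f : Eu m → W) (y : Eu m) : Matrix (Fin m) (Fin m) ℝ :=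
  Matrix.of fun i j => fff B f y (eb i) (eb j)

/-- The components of `g(Z, ∂_l f)`. -/
def coTan (B : W → W →L[ℝ] W →L[ℝ] ℝ) (f : Eu m → W) (Z : W) (y : Eu m) (l : Fin m) : ℝ :=
  B (f y) Z (fderiv ℝ f y (eb l))

/-- The components of the tangential part of the vector `Z`. -/
def tanPart (B : W → W →L[ℝ] W →L[ℝ] ℝ) (f : Eu m → W) (Z : W) (y : Eu m) : Fin m → ℝ :=
  (gramF B f y)⁻¹.mulVec (coTan B f Z y)

/-- The mean curvature in coordinates. -/
def mcurv (B : W → W →L[ℝ] W →L[ℝ] ℝ) (f : Eu m → W) (y : Eu m) (n : W) : ℝ :=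
  ((gramF B f y)⁻¹ * Matrix.of fun i j => sff B f y n (eb i) (eb j)).trace

theorem contDiffAt_gramF {B : W → W →L[ℝ] W →L[ℝ] ℝ} {f : Eu m → W} {y : Eu m}
    (hB : ContDiffAt ℝ 1 B (f y)) (hf : ContDiffAt ℝ 2 f y) (i j : Fin m) :
    ContDiffAt ℝ 1 (fun x => gramF B f x i j) y := by
  have h1 : ContDiffAt ℝ 1 (fderiv ℝ f) y := hf.fderiv_right (by norm_num)
  have h2 : ContDiffAt ℝ 1 (fun x => B (f x)) y := hB.comp y (hf.of_le (by norm_num))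
  exact (h2.clm_apply (h1.clm_apply contDiffAt_const)).clm_apply (h1.clm_apply contDiffAt_const)

theorem contDiffAt_coTan {B : W → W →L[ℝ] W →L[ℝ] ℝ} {f : Eu m → W} {y : Eu m}
    (hB : ContDiffAt ℝ 1 B (f y)) (hf : ContDiffAt ℝ 2 f y) (Z : W) (l : Fin m) :
    ContDiffAt ℝ 1 (fun x => coTan B f Z x l) y := by
  have h1 : ContDiffAt ℝ 1 (fderiv ℝ f) y := hf.fderiv_right (by norm_num)
  have h2 : ContDiffAt ℝ 1 (fun x => B (f x)) y := hB.comp y (hf.of_le (by norm_num))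
  exact (h2.clm_apply contDiffAt_const).clm_apply (h1.clm_apply contDiffAt_const)

theorem contDiffAt_tanPart {B : W → W →L[ℝ] W →L[ℝ] ℝ} {f : Eu m → W} {y : Eu m}
    (hB : ContDiffAt ℝ 1 B (f y)) (hf : ContDiffAt ℝ 2 f y) (h0 : (gramF B f y).det ≠ 0)
    (Z : W) (l : Fin m) :
    ContDiffAt ℝ 1 (fun x => tanPart B f Z x l) y := by
  simp only [tanPart, Matrix.mulVec, dotProduct]
  exact ContDiffAt.sum fun j _ => (contDiffAt_inv_apply (contDiffAt_gramF hB hf) h0 l j).mul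
    (contDiffAt_coTan hB hf Z j)

theorem contDiffAt_sqrt_det_gramF {B : W → W →L[ℝ] W →L[ℝ] ℝ} {f : Eu m → W} {y : Eu m}
    (hB : ContDiffAt ℝ 1 B (f y)) (hf : ContDiffAt ℝ 2 f y) (h0 : (gramF B f y).det ≠ 0) :
    ContDiffAt ℝ 1 (fun x => √(gramF B f x).det) y :=
  (contDiffAt_det (contDiffAt_gramF hB hf)).sqrt h0

set_option maxHeartbeats 1000000 in
open Matrix in
/-- The divergence of the tangential part of a constant vector field `Z`. -/
theorem first_variation {B : W → W →L[ℝ] W →L[ℝ] ℝ} {f : Eu m → W} {y : Eu m} {Z n : W}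
    (hB : ContDiffAt ℝ 1 B (f y)) (hf : ContDiffAt ℝ 2 f y) (h0 : 0 < (gramF B f y).det)
    (hsymm : ∀ᶠ x in 𝓝 (f y), ∀ a b, B x a b = B x b a)
    (hZ : Z = ∑ k, tanPart B f Z y k • fderiv ℝ f y (eb k) - B (f y) Z n • n) :
    ∑ k, fderiv ℝ (fun x => √(gramF B f x).det * tanPart B f Z x k) y (eb k) =
      √(gramF B f y).det * (1 / 2 * ∑ k, ∑ l, (gramF B f y)⁻¹ k l *
        fderiv ℝ B (f y) Z (fderiv ℝ f y (eb k)) (fderiv ℝ f y (eb l))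
        + B (f y) Z n * mcurv B f y n) := by
  set G := gramF B f with hG
  set z := tanPart B f Z with hz
  set b := coTan B f Z with hb
  have sB : ∀ a c, B (f y) a c = B (f y) c a := hsymm.self_of_nhds
  have dB : DifferentiableAt ℝ B (f y) := hB.differentiableAt (by simp)
  have df : DifferentiableAt ℝ f y := hf.differentiableAt (by simp)
  have d2f : DifferentiableAt ℝ (fderiv ℝ f) y :=
    (hf.fderiv_right (m := 1) (by norm_num)).differentiableAt (by simp)
  have sf : ∀ v w, fderiv ℝ (fderiv ℝ f) y v w = fderiv ℝ (fderiv ℝ f) y w v :=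
    fun v w => (hf.isSymmSndFDerivAt (by simp)).eq v w
  have sDB : ∀ v a c, fderiv ℝ B (f y) v a c = fderiv ℝ B (f y) v c a := by
    intro v a c
    have e1 : HasFDerivAt (fun x => B x a c) _ (f y) :=
      (dB.hasFDerivAt.clm_apply (hasFDerivAt_const a _)).clm_apply (hasFDerivAt_const c _)
    have e2 : HasFDerivAt (fun x => B x c a) _ (f y) :=
      (dB.hasFDerivAt.clm_apply (hasFDerivAt_const c _)).clm_apply (hasFDerivAt_const a _)
    have e3 := e1.unique (e2.congr_of_eventuallyEq (hsymm.mono fun x hx => hx a c))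
    have e4 := congrArg (fun L => L v) e3
    simpa using e4
  have dz : ∀ k, DifferentiableAt ℝ (fun x => z x k) y := fun k =>
    (contDiffAt_tanPart hB hf h0.ne' Z k).differentiableAt (by simp)
  have dG : ∀ i j, DifferentiableAt ℝ (fun x => G x i j) y := fun i j =>
    (contDiffAt_gramF hB hf i j).differentiableAt (by simp)
  have dBf : HasFDerivAt (fun x => B (f x)) ((fderiv ℝ B (f y)).comp (fderiv ℝ f y)) y :=
    HasFDerivAt.comp (g := B) y dB.hasFDerivAt df.hasFDerivAt
  -- derivatives of the Gram matrix and of the components of `Z`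
  have DG : ∀ i j v, fderiv ℝ (fun x => G x i j) y v =
      fderiv ℝ B (f y) (fderiv ℝ f y v) (fderiv ℝ f y (eb i)) (fderiv ℝ f y (eb j))
      + B (f y) (fderiv ℝ (fderiv ℝ f) y v (eb i)) (fderiv ℝ f y (eb j))
      + B (f y) (fderiv ℝ f y (eb i)) (fderiv ℝ (fderiv ℝ f) y v (eb j)) := by
    intro i j v
    have e : HasFDerivAt (fun x => G x i j) _ y :=
      (dBf.clm_apply (d2f.hasFDerivAt.clm_apply (hasFDerivAt_const (eb i) y))).clm_apply
        (d2f.hasFDerivAt.clm_apply (hasFDerivAt_const (eb j) y))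
    rw [e.fderiv]
    simp
    ring
  have Db : ∀ j v, fderiv ℝ (fun x => b x j) y v =
      fderiv ℝ B (f y) (fderiv ℝ f y v) Z (fderiv ℝ f y (eb j))
      + B (f y) Z (fderiv ℝ (fderiv ℝ f) y v (eb j)) := by
    intro j v
    have e : HasFDerivAt (fun x => b x j) _ y :=
      (dBf.clm_apply (hasFDerivAt_const Z y)).clm_apply
        (d2f.hasFDerivAt.clm_apply (hasFDerivAt_const (eb j) y))
    rw [e.fderiv]
    simp
    ring
  have Gs : (G y).IsSymm := by
    ext i j; exact sB _ _
  have Gi : ∀ i j, (G y)⁻¹ i j = (G y)⁻¹ j i := by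
    intro i j
    have : (G y)⁻¹ᵀ = (G y)⁻¹ := by rw [Matrix.transpose_nonsing_inv, Gs.eq]
    exact (congrFun (congrFun this i) j).symm ▸ rfl
  have hu : IsUnit (G y).det := h0.ne'.isUnit
  -- differentiate `G z = b`
  have Gz : ∀ᶠ x in 𝓝 y, ∀ j, ∑ l, G x j l * z x l = b x j := by
    have : ∀ᶠ x in 𝓝 y, (G x).det ≠ 0 :=
      (contDiffAt_det (contDiffAt_gramF hB hf)).continuousAt.eventually_ne h0.ne'
    filter_upwards [this] with x hx j
    have : (G x).mulVec (z x) = b x := by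
      simp only [hz, tanPart]
      rw [Matrix.mulVec_mulVec, Matrix.mul_nonsing_inv _ hx.isUnit, Matrix.one_mulVec]
    exact congrFun this j
  have D1 : ∀ j v, ∑ l, (G y j l * fderiv ℝ (fun x => z x l) y v
      + fderiv ℝ (fun x => G x j l) y v * z y l) = fderiv ℝ (fun x => b x j) y v := by
    intro j v
    have e1 : (fun x => ∑ l, G x j l * z x l) =ᶠ[𝓝 y] fun x => b x j := Gz.mono fun x hx => hx j
    rw [← e1.fderiv_eq]
    have e2 : HasFDerivAt (fun x => ∑ l, G x j l * z x l) _ y :=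
      HasFDerivAt.fun_sum fun l _ => (dG j l).hasFDerivAt.mul (dz l).hasFDerivAt
    rw [e2.fderiv]
    simp [mul_comm]
  set r := √(G y).det with hr
  have hrpos : 0 < r := Real.sqrt_pos.2 h0
  have hrr : r * r = (G y).det := Real.mul_self_sqrt h0.le
  have adj : ∀ i j, (G y).adjugate i j = r * r * (G y)⁻¹ i j := by
    intro i j
    rw [hrr, Matrix.inv_def, Matrix.smul_apply, Ring.inverse_eq_inv', smul_eq_mul,
      mul_inv_cancel_left₀ h0.ne']
  have Dr : ∀ v, fderiv ℝ (fun x => √(G x).det) y v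
      = r / 2 * ∑ i, ∑ j, (G y)⁻¹ i j * fderiv ℝ (fun x => G x i j) y v := by
    intro v
    have e := (hasFDerivAt_det fun i j => (dG i j).hasFDerivAt).sqrt h0.ne'
    rw [e.fderiv]
    simp only [_root_.smul_apply, _root_.sum_apply, smul_eq_mul, adj, ← hr]
    simp_rw [Gi _, mul_assoc, ← Finset.mul_sum]
    rw [show ∀ t : ℝ, 1 / (2 * r) * (r * (r * t)) = r / 2 * t from fun t => by field_simp]
  -- A contraction with the symmetric matrix `G⁻¹` does not see the order of the two indices.
  have swap : ∀ X : Fin m → Fin m → ℝ,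
      ∑ i, ∑ j, (G y)⁻¹ i j * X i j = ∑ i, ∑ j, (G y)⁻¹ i j * X j i := by
    intro X
    rw [Finset.sum_comm]
    exact Finset.sum_congr rfl fun i _ => Finset.sum_congr rfl fun j _ => by rw [Gi j i]
  set β := B (f y) Z n with hβ
  -- From here on the tangential combination of the `∂_k f` is replaced by `Z + β n`.
  have hP : ∑ k, z y k • fderiv ℝ f y (eb k) = Z + β • n := by
    rw [eq_sub_iff_add_eq] at hZ; exact hZ.symm
  -- `Q` collects the second derivatives of `f` along the tangential part; it occurs in the
  -- derivatives of both `z` and the area density and drops out of their sum.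
  set Q : Fin m → W := fun i => ∑ k, z y k • fderiv ℝ (fderiv ℝ f) y (eb k) (eb i) with hQ
  have Dz : ∑ k, fderiv ℝ (fun x => z x k) y (eb k) = ∑ k, ∑ j, (G y)⁻¹ k j *
      (-β * fderiv ℝ B (f y) (fderiv ℝ f y (eb k)) (fderiv ℝ f y (eb j)) n
        - β * B (f y) (fderiv ℝ (fderiv ℝ f) y (eb k) (eb j)) n
        - B (f y) (fderiv ℝ f y (eb j)) (Q k)) := by
    refine Finset.sum_congr rfl fun k _ => ?_
    -- The differentiated system reads `G ∂z = ∂b - (∂G) z`. After the substitution of `Z + β n` all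
    -- the terms containing `Z` cancel on the right, so only `β n` and `Q` remain.
    have e1 : ∀ j, -β * fderiv ℝ B (f y) (fderiv ℝ f y (eb k)) (fderiv ℝ f y (eb j)) n
        - β * B (f y) (fderiv ℝ (fderiv ℝ f) y (eb k) (eb j)) n
        - B (f y) (fderiv ℝ f y (eb j)) (Q k)
        = ∑ l, G y j l * fderiv ℝ (fun x => z x l) y (eb k) := by
      intro j
      have e2 := D1 j (eb k)
      rw [Finset.sum_add_distrib, ← eq_sub_iff_add_eq, Db] at e2
      rw [e2]
      have e3 : ∑ l, fderiv ℝ (fun x => G x j l) y (eb k) * z y l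
          = fderiv ℝ B (f y) (fderiv ℝ f y (eb k)) (fderiv ℝ f y (eb j)) (Z + β • n)
          + B (f y) (fderiv ℝ (fderiv ℝ f) y (eb k) (eb j)) (Z + β • n)
          + B (f y) (fderiv ℝ f y (eb j)) (Q k) := by
        rw [← hP, hQ]
        simp only [map_sum, map_smul, smul_eq_mul, ← Finset.sum_add_distrib, DG]
        refine Finset.sum_congr rfl fun l _ => ?_
        rw [sf (eb l) (eb k)]
        ring
      rw [e3]
      simp only [map_add, map_smul, smul_eq_mul]
      rw [sDB _ Z, sB Z]
      ring
    simp_rw [e1, Finset.mul_sum]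
    rw [Finset.sum_comm]
    have e4 : ∀ l, ∑ j, (G y)⁻¹ k j * (G y j l * fderiv ℝ (fun x => z x l) y (eb k))
        = (if k = l then 1 else 0) * fderiv ℝ (fun x => z x l) y (eb k) := by
      intro l
      have := congrFun (congrFun (Matrix.nonsing_inv_mul (G y) hu) k) l
      rw [Matrix.mul_apply, Matrix.one_apply] at this
      rw [← this, Finset.sum_mul]
      exact Finset.sum_congr rfl fun j _ => by ring
    simp_rw [e4]
    simp
  have Dzr : ∑ k, fderiv ℝ (fun x => √(G x).det) y (eb k) * z y k
      = r / 2 * ∑ i, ∑ j, (G y)⁻¹ i j *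
        (fderiv ℝ B (f y) (Z + β • n) (fderiv ℝ f y (eb i)) (fderiv ℝ f y (eb j))
        + B (f y) (Q i) (fderiv ℝ f y (eb j)) + B (f y) (fderiv ℝ f y (eb i)) (Q j)) := by
    simp_rw [Dr, mul_assoc, ← Finset.mul_sum]
    congr 1
    simp_rw [Finset.sum_mul]
    rw [Finset.sum_comm]
    refine Finset.sum_congr rfl fun i _ => ?_
    rw [Finset.sum_comm]
    refine Finset.sum_congr rfl fun j _ => ?_
    simp_rw [mul_assoc, ← Finset.mul_sum]
    congr 1
    rw [← hP, hQ]
    simp only [map_sum, map_smul, _root_.sum_apply, _root_.smul_apply, smul_eq_mul,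
      ← Finset.sum_add_distrib, DG]
    exact Finset.sum_congr rfl fun k _ => by ring
  have H : mcurv B f y n = ∑ i, ∑ j, (G y)⁻¹ i j * sff B f y n (eb i) (eb j) := by
    rw [swap]
    simp [mcurv, Matrix.trace, Matrix.mul_apply, hG]
  have prod : ∀ k, fderiv ℝ (fun x => √(G x).det * z x k) y (eb k)
      = fderiv ℝ (fun x => √(G x).det) y (eb k) * z y k
        + r * fderiv ℝ (fun x => z x k) y (eb k) := by
    intro k
    have e : HasFDerivAt (fun x => √(G x).det * z x k) _ y :=
      ((contDiffAt_sqrt_det_gramF hB hf h0.ne').differentiableAt (by simp)).hasFDerivAt.mul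
        (dz k).hasFDerivAt
    rw [e.fderiv]
    simp [hr, hG]
    ring
  have s1 := swap fun i j => B (f y) (fderiv ℝ f y (eb i)) (Q j)
  have s2 := swap fun i j => fderiv ℝ B (f y) (fderiv ℝ f y (eb i)) (fderiv ℝ f y (eb j)) n
  have K1 : ∑ k, fderiv ℝ (fun x => z x k) y (eb k) =
      -β * (∑ i, ∑ j, (G y)⁻¹ i j *
        fderiv ℝ B (f y) (fderiv ℝ f y (eb i)) (fderiv ℝ f y (eb j)) n)
      - β * (∑ i, ∑ j, (G y)⁻¹ i j * B (f y) (fderiv ℝ (fderiv ℝ f) y (eb i) (eb j)) n)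
      - ∑ i, ∑ j, (G y)⁻¹ i j * B (f y) (fderiv ℝ f y (eb i)) (Q j) := by
    rw [Dz, s1]
    simp only [Finset.mul_sum, ← Finset.sum_sub_distrib]
    exact Finset.sum_congr rfl fun i _ => Finset.sum_congr rfl fun j _ => by ring
  have K2 : ∑ k, fderiv ℝ (fun x => √(G x).det) y (eb k) * z y k = r / 2 *
      ((∑ i, ∑ j, (G y)⁻¹ i j *
        fderiv ℝ B (f y) Z (fderiv ℝ f y (eb i)) (fderiv ℝ f y (eb j)))
      + β * (∑ i, ∑ j, (G y)⁻¹ i j *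
        fderiv ℝ B (f y) n (fderiv ℝ f y (eb i)) (fderiv ℝ f y (eb j)))
      + (∑ i, ∑ j, (G y)⁻¹ i j * B (f y) (fderiv ℝ f y (eb j)) (Q i))
      + ∑ i, ∑ j, (G y)⁻¹ i j * B (f y) (fderiv ℝ f y (eb i)) (Q j)) := by
    rw [Dzr]
    congr 1
    simp only [Finset.mul_sum, ← Finset.sum_add_distrib]
    refine Finset.sum_congr rfl fun i _ => Finset.sum_congr rfl fun j _ => ?_
    rw [sB (Q i), map_add, map_smul, _root_.add_apply, _root_.add_apply, _root_.smul_apply,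
      _root_.smul_apply, smul_eq_mul]
    ring
  have K3 : mcurv B f y n = -((∑ i, ∑ j, (G y)⁻¹ i j *
        B (f y) (fderiv ℝ (fderiv ℝ f) y (eb i) (eb j)) n)
      + ((∑ i, ∑ j, (G y)⁻¹ i j *
        fderiv ℝ B (f y) (fderiv ℝ f y (eb i)) (fderiv ℝ f y (eb j)) n)
      + (∑ i, ∑ j, (G y)⁻¹ i j *
        fderiv ℝ B (f y) (fderiv ℝ f y (eb j)) (fderiv ℝ f y (eb i)) n)
      - ∑ i, ∑ j, (G y)⁻¹ i j *
        fderiv ℝ B (f y) n (fderiv ℝ f y (eb i)) (fderiv ℝ f y (eb j))) / 2) := by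
    rw [H]
    simp only [sub_div, add_div, Finset.sum_div, ← Finset.sum_sub_distrib,
      ← Finset.sum_add_distrib, ← Finset.sum_neg_distrib]
    refine Finset.sum_congr rfl fun i _ => Finset.sum_congr rfl fun j _ => ?_
    simp only [sff, christ]
    ring
  simp_rw [prod, Finset.sum_add_distrib, ← Finset.mul_sum]
  -- The two `Q` terms of the area density cancel the one of `∂z`; the terms with the factor `β` add
  -- up to the mean curvature, and the derivative of `B` along `Z` is what is left.
  rw [K1, K2, K3, ← s2, ← s1]
  ring

end FirstVariation

/-! ### Change of the parametrization -/

section Source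

set_option synthInstance.maxHeartbeats 200000

variable {m : ℕ} {W : Type*} [NormedAddCommGroup W] [NormedSpace ℝ W]

theorem sum_smul_eb (v : Eu m) : ∑ k, v k • eb k = v := by
  ext i
  simp [eb, Finset.sum_apply, Pi.single_apply]

/-- The matrix of a linear endomorphism. -/
def linMat (A : Eu m →L[ℝ] Eu m) : Matrix (Fin m) (Fin m) ℝ := Matrix.of fun k i => A (eb i) k

/-- Serves three transformations: those of the first and the second fundamental form under a
reparametrization, and that of the Gram matrix behind the volume density. -/
theorem bilin_linMat (b : Eu m → Eu m → ℝ) (L : Eu m →ₗ[ℝ] Eu m →ₗ[ℝ] ℝ) (hL : ∀ v w, b v w = L v w)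
    (A : Eu m →L[ℝ] Eu m) :
    (Matrix.of fun i j => b (A (eb i)) (A (eb j))) =
      (linMat A).transpose * (Matrix.of fun i j => b (eb i) (eb j)) * linMat A := by
  ext i j
  rw [Matrix.of_apply, hL]
  nth_rewrite 1 [← sum_smul_eb (A (eb i))]
  nth_rewrite 1 [← sum_smul_eb (A (eb j))]
  simp only [map_sum, map_smul, LinearMap.sum_apply, LinearMap.smul_apply, smul_eq_mul,
    Matrix.mul_apply, Matrix.transpose_apply, Matrix.of_apply, linMat, hL, Finset.sum_mul,
    Finset.mul_sum]
  exact Finset.sum_congr rfl fun k _ => Finset.sum_congr rfl fun l _ => by ring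

theorem linMat_det_ne_zero {A : Eu m →L[ℝ] Eu m} (hA : Function.Injective A) :
    (linMat A).det ≠ 0 := by
  intro h
  obtain ⟨v, hv, h0⟩ := Matrix.exists_mulVec_eq_zero_iff.2 h
  apply hv
  have : A (WithLp.toLp 2 v) = 0 := by
    rw [← sum_smul_eb (WithLp.toLp 2 v)]
    ext k
    have := congrFun h0 k
    simp only [Matrix.mulVec, dotProduct, linMat, Matrix.of_apply, Pi.zero_apply] at this
    simpa [mul_comm] using this
  have := hA (this.trans (map_zero A).symm)
  ext i
  exact congrArg (fun w : Eu m => w i) this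

/-- Invariance of the mean curvature under a change of the parametrization. -/
theorem mcurv_source {B : W → W →L[ℝ] W →L[ℝ] ℝ} {f : Eu m → W} {ψ : Eu m → Eu m} {y : Eu m}
    (hf : ContDiffAt ℝ 2 f (ψ y)) (hψ : ContDiffAt ℝ 2 ψ y)
    (hψ' : Function.Injective (fderiv ℝ ψ y)) {n : W}
    (hn : ∀ v, B (f (ψ y)) (fderiv ℝ f (ψ y) v) n = 0) :
    mcurv B (fun x => f (ψ x)) y n = mcurv B f (ψ y) n := by
  have e1 : fderiv ℝ (fun x => f (ψ x)) y = (fderiv ℝ f (ψ y)).comp (fderiv ℝ ψ y) :=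
    fderiv_comp y (hf.differentiableAt (by simp)) (hψ.differentiableAt (by simp))
  have g : gramF B (fun x => f (ψ x)) y = (linMat (fderiv ℝ ψ y)).transpose
      * gramF B f (ψ y) * linMat (fderiv ℝ ψ y) := by
    have := bilin_linMat (fff B f (ψ y))
      (LinearMap.mk₂ ℝ (fff B f (ψ y)) (by intros; simp [fff]) (by intros; simp [fff])
        (by intros; simp [fff]) (by intros; simp [fff])) (fun _ _ => rfl) (fderiv ℝ ψ y)
    rw [gramF, gramF, ← this]
    ext i j
    simp [fff, e1]
  have s : (Matrix.of fun i j => sff B (fun x => f (ψ x)) y n (eb i) (eb j))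
      = (linMat (fderiv ℝ ψ y)).transpose
      * (Matrix.of fun i j => sff B f (ψ y) n (eb i) (eb j)) * linMat (fderiv ℝ ψ y) := by
    have := bilin_linMat (sff B f (ψ y) n)
      (LinearMap.mk₂ ℝ (sff B f (ψ y) n)
        (by intros; simp only [sff, christ, map_add, _root_.add_apply]; ring)
        (by intros; simp only [sff, christ, map_smul, _root_.smul_apply, smul_eq_mul]; ring)
        (by intros; simp only [sff, christ, map_add, _root_.add_apply]; ring)
        (by intros; simp only [sff, christ, map_smul, _root_.smul_apply, smul_eq_mul]; ring))
        (fun _ _ => rfl) (fderiv ℝ ψ y)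
    rw [← this]
    ext i j
    simp only [Matrix.of_apply]
    exact sff_source hf hψ hn _ _
  have hJ : IsUnit (linMat (fderiv ℝ ψ y)).det := (linMat_det_ne_zero hψ').isUnit
  have hJt : IsUnit (linMat (fderiv ℝ ψ y)).transpose.det := by rwa [Matrix.det_transpose]
  -- With `J` the matrix of `Dψ`, the product `(JᵀGJ)⁻¹ (JᵀSJ)` is conjugate by `J` to `G⁻¹S`, so
  -- the traces agree.
  rw [mcurv, g, s, mcurv, Matrix.mul_inv_rev, Matrix.mul_inv_rev, Matrix.mul_assoc,
    Matrix.mul_assoc, ← Matrix.mul_assoc _ _ (linMat (fderiv ℝ ψ y)),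
    Matrix.nonsing_inv_mul_cancel_left _ _ hJt,
    Matrix.trace_mul_comm, Matrix.mul_assoc, Matrix.mul_assoc, Matrix.mul_nonsing_inv _ hJ,
    Matrix.mul_one]

end Source

/-! ### Linear algebra of graphs -/

section GraphAlgebra

open Matrix

variable {m : ℕ} {σ : Matrix (Fin m) (Fin m) ℝ} {u : Fin m → ℝ} {l L α : ℝ}

theorem posDef_of_le (hs : σ.IsSymm) (hl : 0 < l) (h : ∀ v, l * (v ⬝ᵥ v) ≤ v ⬝ᵥ σ *ᵥ v) :
    σ.PosDef := by
  refine Matrix.PosDef.of_dotProduct_mulVec_pos (by simpa [Matrix.IsHermitian] using hs.eq) ?_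
  intro v hv
  have : 0 < v ⬝ᵥ v := by
    have := (dotProduct_star_self_pos_iff (v := v)).2 hv
    simpa using this
  have := mul_pos hl this
  simpa using this.trans_le (h v)

/-- The vector `σ⁻¹ u`. -/
def sharp (σ : Matrix (Fin m) (Fin m) ℝ) (u : Fin m → ℝ) : Fin m → ℝ := σ⁻¹ *ᵥ u

/-- The square of the norm of the covector `u`. -/
def sqn (σ : Matrix (Fin m) (Fin m) ℝ) (u : Fin m → ℝ) : ℝ := u ⬝ᵥ σ⁻¹ *ᵥ u

theorem mulVec_sharp (hσ : σ.PosDef) : σ *ᵥ sharp σ u = u := by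
  rw [sharp, Matrix.mulVec_mulVec, Matrix.mul_nonsing_inv _ hσ.det_pos.ne'.isUnit,
    Matrix.one_mulVec]

theorem sharp_mulVec (hσ : σ.PosDef) : sharp σ (σ *ᵥ u) = u := by
  rw [sharp, Matrix.mulVec_mulVec, Matrix.nonsing_inv_mul _ hσ.det_pos.ne'.isUnit,
    Matrix.one_mulVec]

theorem sqn_eq (hσ : σ.PosDef) : sharp σ u ⬝ᵥ σ *ᵥ sharp σ u = sqn σ u := by
  rw [mulVec_sharp hσ, dotProduct_comm, sqn, sharp]

theorem sqn_nonneg (hσ : σ.PosDef) : 0 ≤ sqn σ u := by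
  rw [← sqn_eq hσ]
  simpa using hσ.posSemidef.dotProduct_mulVec_nonneg (sharp σ u)

/-- Coercivity tested on `σ⁻¹u`, whose squared `σ`-length is the squared norm of the covector `u`.
-/
theorem dot_self_sharp_le (hσ : σ.PosDef) (hl : 0 < l)
    (h : ∀ v, l * (v ⬝ᵥ v) ≤ v ⬝ᵥ σ *ᵥ v) : sharp σ u ⬝ᵥ sharp σ u ≤ sqn σ u / l := by
  rw [le_div_iff₀ hl, mul_comm, ← sqn_eq hσ]
  exact h _

theorem apply_sq_le_dot (v : Fin m → ℝ) (i : Fin m) : v i ^ 2 ≤ v ⬝ᵥ v := by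
  rw [dotProduct, sq]
  exact Finset.single_le_sum (f := fun i => v i * v i) (fun j _ => mul_self_nonneg _)
    (Finset.mem_univ i)

/-- Let `v` be the `j`-th column of `σ⁻¹`. Coercivity gives `|v|² ≤ v_j / l`. The entry `v_j` itself
is then at most `1/l`, and the same inequality bounds every other entry by `1/l`. -/
theorem abs_inv_apply_le (hσ : σ.PosDef) (hl : 0 < l)
    (h : ∀ v, l * (v ⬝ᵥ v) ≤ v ⬝ᵥ σ *ᵥ v) (i j : Fin m) : |σ⁻¹ i j| ≤ 1 / l := by
  set v : Fin m → ℝ := Pi.single j 1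
  have h1 : sharp σ v ⬝ᵥ sharp σ v ≤ sqn σ v / l := dot_self_sharp_le hσ hl h
  have h2 : sqn σ v = sharp σ v j := by simp [sqn, sharp, v]
  have h3 : ∀ i, sharp σ v i = σ⁻¹ i j := by intro i; simp [sharp, v]
  rw [h2] at h1
  have h4 := (apply_sq_le_dot (sharp σ v) j).trans h1
  have h5 := (apply_sq_le_dot (sharp σ v) i).trans h1
  have h6 : sharp σ v j ≤ 1 / l := by
    rw [le_div_iff₀ hl] at h4 ⊢
    by_contra! hc
    have : 0 < sharp σ v j := by by_contra! hh; nlinarith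
    nlinarith
  rw [← h3]
  apply abs_le_of_sq_le_sq _ (by positivity)
  calc sharp σ v i ^ 2 ≤ sharp σ v j / l := h5
    _ ≤ (1 / l) / l := by gcongr
    _ = (1 / l) ^ 2 := by field_simp

/-- The induced metric of a graph. -/
def graphGram (α : ℝ) (σ : Matrix (Fin m) (Fin m) ℝ) (u : Fin m → ℝ) :
    Matrix (Fin m) (Fin m) ℝ := α ^ 2 • (σ - vecMulVec u u)

/-- Matrix determinant lemma: `σ - u uᵀ = σ (1 - σ⁻¹u uᵀ)` is a rank one perturbation. -/
theorem det_graphGram (hσ : σ.PosDef) :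
    (graphGram α σ u).det = (α ^ m) ^ 2 * (σ.det * (1 - sqn σ u)) := by
  have h1 : σ - vecMulVec u u = σ * (1 + replicateCol Unit (-sharp σ u) * replicateRow Unit u) := by
    rw [Matrix.mul_add, Matrix.mul_one, ← Matrix.mul_assoc, ← Matrix.replicateCol_mulVec,
      Matrix.mulVec_neg, mulVec_sharp hσ, ← Matrix.vecMulVec_eq, Matrix.neg_vecMulVec,
      sub_eq_add_neg]
  rw [graphGram, Matrix.det_smul, h1, Matrix.det_mul, Matrix.det_one_add_mul_comm]
  simp [sqn, sharp, ← pow_mul, mul_comm, ← sub_eq_add_neg]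

/-- The Sherman–Morrison formula. The factor `1 / (1 - |u|²)` is the square of the tilt. -/
theorem inv_graphGram (hσ : σ.PosDef) (hα : 0 < α) (hq : sqn σ u < 1) :
    (graphGram α σ u)⁻¹ = (α ^ 2)⁻¹ •
      (σ⁻¹ + (1 / (1 - sqn σ u)) • vecMulVec (sharp σ u) (sharp σ u)) := by
  have hq' : 1 - sqn σ u ≠ 0 := by linarith
  have hu := hσ.det_pos.ne'.isUnit
  apply Matrix.inv_eq_right_inv
  rw [graphGram, Matrix.smul_mul, Matrix.mul_smul, smul_smul, mul_inv_cancel₀ (by positivity),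
    one_smul, Matrix.sub_mul, Matrix.mul_add, Matrix.mul_add, Matrix.mul_nonsing_inv _ hu,
    Matrix.mul_smul, Matrix.mul_smul, Matrix.mul_vecMulVec, mulVec_sharp hσ,
    Matrix.vecMulVec_mul, Matrix.vecMulVec_mul_vecMulVec]
  have h1 : u ᵥ* σ⁻¹ = sharp σ u := by
    have : σ⁻¹ᵀ = σ⁻¹ := by
      rw [Matrix.transpose_nonsing_inv]
      have := hσ.isHermitian
      rw [Matrix.IsHermitian, Matrix.conjTranspose_eq_transpose_of_trivial] at this
      rw [this]
    rw [← this, Matrix.vecMul_transpose, sharp]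
  have h2 : u ⬝ᵥ sharp σ u = sqn σ u := rfl
  rw [h1, h2]
  ext i j
  simp [vecMulVec_apply]
  field_simp
  ring

/-- The covector `-α² u` is the restriction of `ḡ(∂_t, ·)` to the graph, so this computes the
tangential part of `∂_t`. -/
theorem inv_graphGram_mulVec (hσ : σ.PosDef) (hα : 0 < α) (hq : sqn σ u < 1) :
    (graphGram α σ u)⁻¹ *ᵥ (-(α ^ 2) • u) = -(1 / (1 - sqn σ u)) • sharp σ u := by
  have hq' : 1 - sqn σ u ≠ 0 := by linarith
  rw [inv_graphGram hσ hα hq, Matrix.smul_mulVec, Matrix.mulVec_smul, Matrix.add_mulVec,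
    Matrix.smul_mulVec, Matrix.vecMulVec_mulVec]
  have h2 : sharp σ u ⬝ᵥ u = sqn σ u := dotProduct_comm _ _
  have h3 : σ⁻¹ *ᵥ u = sharp σ u := rfl
  rw [h2, h3]
  ext i
  simp
  field_simp
  ring

/-- Only the rank one term of the inverse degenerates as the graph becomes null, and it does so at
the rate `w²`. -/
theorem abs_inv_graphGram_le (hσ : σ.PosDef) (hα : 0 < α) (hq : sqn σ u < 1) (hl : 0 < l)
    (h : ∀ v, l * (v ⬝ᵥ v) ≤ v ⬝ᵥ σ *ᵥ v) (i j : Fin m) :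
    |(graphGram α σ u)⁻¹ i j| ≤ (α ^ 2)⁻¹ * (2 / l) * (1 / (1 - sqn σ u)) := by
  have hq0 := sqn_nonneg (u := u) hσ
  have hw : 1 ≤ 1 / (1 - sqn σ u) := by rw [le_div_iff₀] <;> linarith
  have h1 := abs_inv_apply_le hσ hl h i j
  have h2 : ∀ k, sharp σ u k ^ 2 ≤ 1 / l := fun k =>
    (apply_sq_le_dot _ k).trans ((dot_self_sharp_le hσ hl h).trans (by gcongr))
  have h3 : |sharp σ u i * sharp σ u j| ≤ 1 / l := by
    rw [abs_le]; constructor <;> nlinarith [sq_nonneg (sharp σ u i + sharp σ u j),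
      sq_nonneg (sharp σ u i - sharp σ u j), h2 i, h2 j]
  rw [inv_graphGram hσ hα hq]
  simp only [Matrix.smul_apply, Matrix.add_apply, vecMulVec_apply, smul_eq_mul, abs_mul]
  rw [abs_of_pos (show 0 < (α ^ 2)⁻¹ by positivity), mul_assoc]
  gcongr
  calc |σ⁻¹ i j + 1 / (1 - sqn σ u) * (sharp σ u i * sharp σ u j)|
      ≤ 1 / l + 1 / (1 - sqn σ u) * (1 / l) := by
        refine (abs_add_le _ _).trans ?_
        rw [abs_mul, abs_of_pos (by linarith : 0 < 1 / (1 - sqn σ u))]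
        gcongr
    _ ≤ 2 / l * (1 / (1 - sqn σ u)) := by
        have : 0 < 1 / l := by positivity
        rw [show 2 / l = 1 / l + 1 / l by ring]
        nlinarith


/-- The squared Euclidean length of `σ⁻¹u` is at most `1/l = L`, and `L ≤ L²`. -/
theorem abs_sharp_le (hσ : σ.PosDef) (hq : sqn σ u < 1) (hl : 0 < l) (hL : 1 ≤ L) (hlL : l = 1 / L)
    (h : ∀ v, l * (v ⬝ᵥ v) ≤ v ⬝ᵥ σ *ᵥ v) (i : Fin m) : |sharp σ u i| ≤ L := by
  have h1 : sharp σ u i ^ 2 ≤ 1 / l :=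
    (apply_sq_le_dot _ i).trans ((dot_self_sharp_le hσ hl h).trans (by gcongr))
  rw [hlL, one_div_one_div] at h1
  exact abs_le_of_sq_le_sq (by nlinarith) (by linarith)

end GraphAlgebra

/-! ### The flux of a graph and its divergence -/

section Graph

open Matrix

set_option synthInstance.maxHeartbeats 200000

variable {m : ℕ}

/-- The differential of the height of the graph in coordinates. -/
def slope (f : Eu m → ℝ × Eu m) (y : Eu m) (k : Fin m) : ℝ := (fderiv ℝ f y (eb k)).1

/-- The spatial part of the induced metric. -/
def spatialGram (s : Eu m →L[ℝ] Eu m →L[ℝ] ℝ) (f : Eu m → ℝ × Eu m) (y : Eu m) : Matrix (Fin m) (Fin m) ℝ :=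
  Matrix.of fun i j => s (fderiv ℝ f y (eb i)).2 (fderiv ℝ f y (eb j)).2

/-- The flux: the density of the tangential part of `-∂_t`. -/
def flux (B : ℝ × Eu m → (ℝ × Eu m) →L[ℝ] (ℝ × Eu m) →L[ℝ] ℝ) (f : Eu m → ℝ × Eu m) (y : Eu m) (k : Fin m) : ℝ :=
  -(√(gramF B f y).det * tanPart B f (1, 0) y k)

variable {B : ℝ × Eu m → (ℝ × Eu m) →L[ℝ] (ℝ × Eu m) →L[ℝ] ℝ} {f : Eu m → ℝ × Eu m} {y : Eu m} {α l L : ℝ}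
  {s : Eu m →L[ℝ] Eu m →L[ℝ] ℝ} {n : ℝ × Eu m}

theorem gramF_eq_graphGram (hBf : ∀ a b, B (f y) a b = α ^ 2 * (-(a.1 * b.1) + s a.2 b.2)) :
    gramF B f y = graphGram α (spatialGram s f y) (slope f y) := by
  ext i j
  simp [gramF, fff, hBf, graphGram, spatialGram, slope, vecMulVec_apply]
  left
  ring

theorem coTan_eq (hBf : ∀ a b, B (f y) a b = α ^ 2 * (-(a.1 * b.1) + s a.2 b.2)) :
    coTan B f (1, 0) y = -(α ^ 2) • slope f y := by
  ext i
  simp [coTan, hBf, slope]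

theorem tanPart_eq (hBf : ∀ a b, B (f y) a b = α ^ 2 * (-(a.1 * b.1) + s a.2 b.2))
    (hσ : (spatialGram s f y).PosDef) (hα : 0 < α)
    (hq : sqn (spatialGram s f y) (slope f y) < 1) :
    tanPart B f (1, 0) y = -(1 / (1 - sqn (spatialGram s f y) (slope f y))) •
      sharp (spatialGram s f y) (slope f y) := by
  rw [tanPart, gramF_eq_graphGram hBf, coTan_eq hBf, inv_graphGram_mulVec hσ hα hq]

theorem det_gramF_pos (hBf : ∀ a b, B (f y) a b = α ^ 2 * (-(a.1 * b.1) + s a.2 b.2))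
    (hσ : (spatialGram s f y).PosDef) (hα : 0 < α)
    (hq : sqn (spatialGram s f y) (slope f y) < 1) : 0 < (gramF B f y).det := by
  rw [gramF_eq_graphGram hBf, det_graphGram hσ]
  have := hσ.det_pos
  have : 0 < 1 - sqn (spatialGram s f y) (slope f y) := by linarith
  positivity

theorem sqrt_det_gramF (hBf : ∀ a b, B (f y) a b = α ^ 2 * (-(a.1 * b.1) + s a.2 b.2))
    (hσ : (spatialGram s f y).PosDef) (hα : 0 < α) :
    √(gramF B f y).det = α ^ m * (√(spatialGram s f y).det *
      √(1 - sqn (spatialGram s f y) (slope f y))) := by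
  rw [gramF_eq_graphGram hBf, det_graphGram hσ, Real.sqrt_mul (by positivity),
    Real.sqrt_sq (by positivity), Real.sqrt_mul hσ.det_pos.le]

/-- The area density brings a factor `1/w` and the tangential part of `∂_t` a factor `w²`. The
resulting single power of `w` is why the flux is bounded by the tilt, and why its pairing with `du`
is a multiple of `w |du|²`. -/
theorem flux_eq (hBf : ∀ a b, B (f y) a b = α ^ 2 * (-(a.1 * b.1) + s a.2 b.2))
    (hσ : (spatialGram s f y).PosDef) (hα : 0 < α)
    (hq : sqn (spatialGram s f y) (slope f y) < 1) (k : Fin m) :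
    flux B f y k = α ^ m * √(spatialGram s f y).det *
      (1 / √(1 - sqn (spatialGram s f y) (slope f y))) *
      sharp (spatialGram s f y) (slope f y) k := by
  have hq' : 0 < 1 - sqn (spatialGram s f y) (slope f y) := by linarith
  rw [flux, sqrt_det_gramF hBf hσ hα, tanPart_eq hBf hσ hα hq]
  set d := 1 - sqn (spatialGram s f y) (slope f y)
  have h1 : √d * √d = d := Real.mul_self_sqrt hq'.le
  have h2 : 0 < √d := Real.sqrt_pos.2 hq'
  have h3 : √d * (1 / d) = 1 / √d := by
    rw [← h1]; simp; field_simp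
  simp only [Pi.smul_apply, smul_eq_mul, neg_mul, mul_neg, neg_neg]
  rw [← h3]
  ring

/-- The future unit normal of a graph. -/
theorem normal_eq (hBf : ∀ a b, B (f y) a b = α ^ 2 * (-(a.1 * b.1) + s a.2 b.2))
    (ss : ∀ a b, s a b = s b a)
    (hσ : (spatialGram s f y).PosDef) (hα : 0 < α)
    (hq : sqn (spatialGram s f y) (slope f y) < 1)
    (hn : ∀ v, B (f y) n (fderiv ℝ f y v) = 0) (hnn : B (f y) n n = -1) (hn0 : 0 < n.1) :
    α * n.1 = 1 / √(1 - sqn (spatialGram s f y) (slope f y)) ∧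
    n.2 = n.1 • ∑ k, sharp (spatialGram s f y) (slope f y) k • (fderiv ℝ f y (eb k)).2 := by
  set σ := spatialGram s f y with hσd
  set u := slope f y with hu
  set A : Eu m →ₗ[ℝ] Eu m := ((ContinuousLinearMap.snd ℝ ℝ (Eu m)).comp (fderiv ℝ f y)).toLinearMap with hA
  have hAe : ∀ k, A (eb k) = (fderiv ℝ f y (eb k)).2 := fun k => rfl
  have Aexp : ∀ v : Eu m, A v = ∑ k, v k • A (eb k) := fun v => by
    conv_lhs => rw [← sum_smul_eb v]
    simp only [map_sum, map_smul]
  have sA : ∀ v j, s (A v) (A (eb j)) = (σ *ᵥ fun k => v k) j := by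
    intro v j
    rw [Aexp v, map_sum, _root_.sum_apply]
    simp only [map_smul, _root_.smul_apply, smul_eq_mul, Matrix.mulVec, dotProduct, hσd,
      spatialGram, Matrix.of_apply, ← hAe]
    exact Finset.sum_congr rfl fun k _ => by rw [ss, mul_comm]
  have sAA : ∀ v : Eu m, s (A v) (A v) = (fun k => v k) ⬝ᵥ σ *ᵥ fun k => v k := by
    intro v
    nth_rewrite 2 [Aexp v]
    simp only [map_sum, map_smul, smul_eq_mul, sA, dotProduct]
  have Ainj : Function.Injective A := by
    rw [← LinearMap.ker_eq_bot, LinearMap.ker_eq_bot']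
    intro v hv
    by_contra hne
    have h1 : (fun k => v k) ≠ 0 := by
      intro h; apply hne; ext k; exact congrFun h k
    have := hσ.dotProduct_mulVec_pos h1
    simp only [star_trivial] at this
    rw [← sAA, hv] at this
    simp at this
  -- The spatial part of `Df` is injective because `σ` is definite, hence onto by dimension. So the
  -- spatial part of `n` comes from a coordinate vector `c`, and orthogonality to the graph becomes
  -- `σ c = n.1 • u`.
  obtain ⟨c, hc⟩ := (LinearMap.injective_iff_surjective.1 Ainj) n.2
  have hcσ : σ *ᵥ (fun k => c k) = n.1 • u := by
    ext j
    have := hn (eb j)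
    rw [hBf] at this
    have h2 := (mul_eq_zero.1 this).resolve_left (by positivity)
    rw [← sA, hc, Pi.smul_apply, smul_eq_mul, hu, slope, hAe]
    linarith
  have hcp : (fun k => c k) = n.1 • sharp σ u := by
    rw [← sharp_mulVec (u := fun k => c k) hσ, hcσ, sharp, Matrix.mulVec_smul, ← sharp]
  have h2 : n.2 = n.1 • ∑ k, sharp σ u k • (fderiv ℝ f y (eb k)).2 := by
    rw [← hc, Aexp c, Finset.smul_sum]
    refine Finset.sum_congr rfl fun k _ => ?_
    rw [smul_smul, hAe]
    exact congrArg (fun t : ℝ => t • _) (congrFun hcp k)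
  refine ⟨?_, h2⟩
  have h3 : s n.2 n.2 = n.1 ^ 2 * sqn σ u := by
    rw [← hc, sAA, hcp, Matrix.mulVec_smul, smul_dotProduct, dotProduct_smul, sqn_eq hσ]
    simp only [smul_eq_mul]; ring
  rw [hBf, h3] at hnn
  have hq' : 0 < 1 - sqn σ u := by linarith
  have h4 : (α * n.1) ^ 2 = 1 / (1 - sqn σ u) := by
    rw [eq_div_iff hq'.ne']; linarith
  rw [← Real.sqrt_sq (show 0 ≤ α * n.1 by positivity), h4, Real.sqrt_div zero_le_one,
    Real.sqrt_one]

/-- The orthogonal splitting of `∂_t` along the graph, as required by `first_variation`; the minus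
sign reflects that `n` is timelike. The time component of the identity is `1 = w² - w² |u|²`, and
the spatial components cancel. -/
theorem decomposition (hBf : ∀ a b, B (f y) a b = α ^ 2 * (-(a.1 * b.1) + s a.2 b.2))
    (ss : ∀ a b, s a b = s b a)
    (hσ : (spatialGram s f y).PosDef) (hα : 0 < α)
    (hq : sqn (spatialGram s f y) (slope f y) < 1)
    (hn : ∀ v, B (f y) n (fderiv ℝ f y v) = 0) (hnn : B (f y) n n = -1) (hn0 : 0 < n.1) :
    ((1, 0) : ℝ × Eu m) = ∑ k, tanPart B f (1, 0) y k • fderiv ℝ f y (eb k)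
      - B (f y) (1, 0) n • n := by
  obtain ⟨h1, h2⟩ := normal_eq hBf ss hσ hα hq hn hnn hn0
  have hq' : 0 < 1 - sqn (spatialGram s f y) (slope f y) := by linarith
  have h3 : α ^ 2 * n.1 * n.1 = 1 / (1 - sqn (spatialGram s f y) (slope f y)) := by
    have : (α * n.1) ^ 2 = 1 / (1 - sqn (spatialGram s f y) (slope f y)) := by
      rw [h1, div_pow, Real.sq_sqrt hq'.le, one_pow]
    rw [← this]; ring
  have h4 : B (f y) (1, 0) n = -(α ^ 2 * n.1) := by rw [hBf]; simp
  rw [tanPart_eq hBf hσ hα hq, h4]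
  set q := sqn (spatialGram s f y) (slope f y) with hqd
  have h5 : ∑ k, sharp (spatialGram s f y) (slope f y) k * (fderiv ℝ f y (eb k)).1 = q := by
    rw [hqd, sqn, dotProduct_comm]
    rfl
  refine Prod.ext ?_ ?_
  · simp only [Prod.fst_sub, Prod.fst_sum, Prod.smul_fst, smul_eq_mul, Pi.smul_apply]
    simp_rw [mul_assoc, ← Finset.mul_sum, h5]
    rw [neg_mul, neg_mul, h3]
    field_simp
    ring
  · simp only [Prod.snd_sub, Prod.snd_sum, Prod.smul_snd, Pi.smul_apply]
    rw [h2, smul_smul, neg_mul, h3, neg_smul, sub_neg_eq_add, Finset.smul_sum,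
      ← Finset.sum_add_distrib]
    symm
    refine Finset.sum_eq_zero fun k _ => ?_
    rw [smul_smul, smul_eq_mul, ← add_smul]
    simp

/-- The divergence of the flux is controlled by the prescribed mean curvature and the tilt. -/
theorem abs_div_flux_le (hB : ContDiffAt ℝ 1 B (f y)) (hf : ContDiffAt ℝ 2 f y)
    (hsymm : ∀ᶠ x in 𝓝 (f y), ∀ a b, B x a b = B x b a)
    (hBf : ∀ a b, B (f y) a b = α ^ 2 * (-(a.1 * b.1) + s a.2 b.2))
    (ss : ∀ a b, s a b = s b a) (hL : 1 ≤ L)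
    (hl : ∀ v, 1 / L * (v ⬝ᵥ v) ≤ v ⬝ᵥ spatialGram s f y *ᵥ v)
    (hα1 : 1 / L ≤ α) (hα2 : α ≤ L)
    (hq : sqn (spatialGram s f y) (slope f y) < 1)
    (hn : ∀ v, B (f y) n (fderiv ℝ f y v) = 0) (hnn : B (f y) n n = -1) (hn0 : 0 < n.1)
    (hT : ∀ a b, |fderiv ℝ B (f y) (1, 0) a b| ≤ L * ‖a‖ * ‖b‖)
    (hfk : ∀ k, ‖fderiv ℝ f y (eb k)‖ ≤ L)
    {X : ℝ × Eu m} (hX : ∀ b, |B (f y) X b| ≤ L * ‖b‖) {ρ : ℝ}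
    (hH : mcurv B f y n = ρ + B (f y) X n) :
    |∑ k, fderiv ℝ (fun x => flux B f x k) y (eb k)| ≤
      α ^ m * √(spatialGram s f y).det *
        ((m ^ 2 * L ^ 6 + L ^ 3 * (1 + m * L ^ 2)) *
          (1 / √(1 - sqn (spatialGram s f y) (slope f y))) + L * |ρ|) := by
  have hL0 : 0 < L := by linarith
  have hα : 0 < α := lt_of_lt_of_le (by positivity) hα1
  have hσs : (spatialGram s f y).IsSymm := by ext i j; exact ss _ _
  have hσ : (spatialGram s f y).PosDef := posDef_of_le hσs (by positivity) hl
  obtain ⟨h1, h2⟩ := normal_eq hBf ss hσ hα hq hn hnn hn0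
  have hd0 := det_gramF_pos hBf hσ hα hq
  -- The field `∂_t` is constant in these coordinates, so only the time derivative of the metric and
  -- the mean curvature appear.
  have hfv := first_variation hB hf hd0 hsymm (decomposition hBf ss hσ hα hq hn hnn hn0)
  have hdiff : ∀ k, fderiv ℝ (fun x => flux B f x k) y (eb k) =
      -fderiv ℝ (fun x => √(gramF B f x).det * tanPart B f (1, 0) x k) y (eb k) := by
    intro k
    simp only [flux]
    rw [fderiv_fun_neg]
    rfl
  simp_rw [hdiff, Finset.sum_neg_distrib, abs_neg]
  have hinv := abs_inv_graphGram_le hσ hα hq (by positivity : 0 < 1 / L) hl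
  rw [hfv, sqrt_det_gramF hBf hσ hα, hH]
  have hp := abs_sharp_le hσ hq (by positivity : 0 < 1 / L) hL rfl hl
  rw [← gramF_eq_graphGram hBf] at hinv
  set q := sqn (spatialGram s f y) (slope f y) with hqd
  have hq' : 0 < 1 - q := by linarith
  have hq0 : 0 ≤ q := sqn_nonneg hσ
  set w := 1 / √(1 - q) with hw
  have hsq : 0 < √(1 - q) := Real.sqrt_pos.2 hq'
  have hw0 : 0 < w := by positivity
  have hsw : √(1 - q) = 1 / w := by rw [hw, one_div_one_div]
  have hww : 1 / (1 - q) = w ^ 2 := by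
    rw [hw, div_pow, Real.sq_sqrt hq'.le, one_pow]
  have hw1 : 1 ≤ w := by
    rw [hw, le_div_iff₀ hsq, one_mul]
    exact Real.sqrt_le_one.2 (by linarith)
  have hαi : (α ^ 2)⁻¹ ≤ L ^ 2 := by
    rw [inv_le_comm₀ (by positivity) (by positivity), ← inv_pow]
    gcongr
    simpa using hα1
  -- first term
  have T1 : |1 / 2 * ∑ k, ∑ l, (gramF B f y)⁻¹ k l *
      fderiv ℝ B (f y) (1, 0) (fderiv ℝ f y (eb k)) (fderiv ℝ f y (eb l))| ≤
      m ^ 2 * L ^ 6 * w ^ 2 := by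
    have : ∀ k l, |(gramF B f y)⁻¹ k l *
        fderiv ℝ B (f y) (1, 0) (fderiv ℝ f y (eb k)) (fderiv ℝ f y (eb l))|
        ≤ 2 * (L ^ 6 * w ^ 2) := by
      intro k l
      rw [abs_mul]
      have a1 := hinv k l
      have a2 := hT (fderiv ℝ f y (eb k)) (fderiv ℝ f y (eb l))
      rw [hww] at a1
      calc _ ≤ (L ^ 2 * (2 / (1 / L)) * w ^ 2) * (L * L * L) := by
            refine mul_le_mul (a1.trans ?_) (a2.trans ?_) (abs_nonneg _) (by positivity)
            · gcongr
            · gcongr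
              · exact hfk k
              · exact hfk l
        _ = 2 * (L ^ 6 * w ^ 2) := by field_simp
    rw [abs_mul, abs_of_pos (by norm_num : (0 : ℝ) < 1 / 2)]
    have h3 : |∑ k, ∑ l, (gramF B f y)⁻¹ k l *
        fderiv ℝ B (f y) (1, 0) (fderiv ℝ f y (eb k)) (fderiv ℝ f y (eb l))|
        ≤ ∑ k : Fin m, ∑ l : Fin m, 2 * (L ^ 6 * w ^ 2) :=
      (Finset.abs_sum_le_sum_abs _ _).trans (Finset.sum_le_sum fun k _ =>
        (Finset.abs_sum_le_sum_abs _ _).trans (Finset.sum_le_sum fun l _ => this k l))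
    simp only [Finset.sum_const, Finset.card_univ, Fintype.card_fin, nsmul_eq_mul] at h3
    calc _ ≤ 1 / 2 * (m * (m * (2 * (L ^ 6 * w ^ 2)))) := by gcongr
      _ = _ := by ring
  -- the normal
  have N0 : n.1 ≤ L * w := by
    have : n.1 = α⁻¹ * w := by rw [← h1]; field_simp
    rw [this]
    gcongr
    rw [inv_le_comm₀ hα hL0]; simpa using hα1
  have N1 : ‖n‖ ≤ L * w * (1 + m * L ^ 2) := by
    rw [Prod.norm_def]
    refine max_le ?_ ?_
    · rw [Real.norm_of_nonneg hn0.le]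
      nlinarith [mul_pos hL0 hw0, mul_nonneg (mul_pos hL0 hw0).le
        (mul_nonneg (Nat.cast_nonneg (α := ℝ) m) (sq_nonneg L))]
    · rw [h2, norm_smul, Real.norm_of_nonneg hn0.le]
      have : ‖∑ k, sharp (spatialGram s f y) (slope f y) k • (fderiv ℝ f y (eb k)).2‖
          ≤ m * L ^ 2 := by
        refine (norm_sum_le _ _).trans ?_
        have : ∀ k ∈ Finset.univ,
            ‖sharp (spatialGram s f y) (slope f y) k • (fderiv ℝ f y (eb k)).2‖ ≤ L ^ 2 := by
          intro k _
          rw [norm_smul, sq, Real.norm_eq_abs]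
          exact mul_le_mul (hp k) ((norm_snd_le _).trans (hfk k)) (norm_nonneg _) hL0.le
        refine (Finset.sum_le_sum this).trans ?_
        simp
      exact mul_le_mul N0 (by linarith) (norm_nonneg _) (by positivity)
  -- The product of `∂_t` with the unit normal is `-α w`.
  have T2 : |B (f y) (1, 0) n| ≤ L * w := by
    have : B (f y) (1, 0) n = -(α * (α * n.1)) := by rw [hBf]; simp; ring
    rw [this, abs_neg, h1, abs_of_pos (by positivity)]
    gcongr
  have T3 : |B (f y) X n| ≤ L * (L * w * (1 + m * L ^ 2)) :=
    (hX n).trans (by gcongr)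
  rw [abs_mul, abs_of_nonneg (by positivity), hsw]
  have T4 : |B (f y) (1, 0) n * (ρ + B (f y) X n)| ≤
      L * w * (|ρ| + L * (L * w * (1 + m * L ^ 2))) := by
    rw [abs_mul]
    exact mul_le_mul T2 ((abs_add_le _ _).trans (by gcongr)) (abs_nonneg _) (by positivity)
  -- The bracket is of order `w² + w |ρ|`; the factor `1/w` of the area density turns this into `w +
  -- |ρ|`.
  calc _ ≤ α ^ m * (√(spatialGram s f y).det * (1 / w)) *
        (m ^ 2 * L ^ 6 * w ^ 2 + L * w * (|ρ| + L * (L * w * (1 + m * L ^ 2)))) := by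
        gcongr
        exact (abs_add_le _ _).trans (add_le_add T1 T4)
    _ = _ := by field_simp; ring

end Graph

/-! ### Cutoff functions -/

section Cutoff

/-- At the kink the function is `O(t²)`, so both it and its derivative vanish there. Squaring the
positive part is what makes the cutoff of class `C^1`. -/
theorem hasDerivAt_max_sq (x : ℝ) :
    HasDerivAt (fun t : ℝ => (max t 0) ^ 2) (2 * max x 0) x := by
  rcases lt_trichotomy x 0 with h | h | h
  · rw [max_eq_right h.le, mul_zero]
    refine (hasDerivAt_const x (0 : ℝ)).congr_of_eventuallyEq ?_
    filter_upwards [Iio_mem_nhds h] with t ht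
    simp [max_eq_right (mem_Iio.1 ht).le]
  · subst h
    have h1 : (fun t : ℝ => (max t 0) ^ 2) =O[𝓝 (0 : ℝ)] fun t => ‖t - 0‖ ^ 2 := by
      refine Asymptotics.IsBigO.of_bound 1 (Filter.Eventually.of_forall fun t => ?_)
      simp only [sub_zero, norm_pow, Real.norm_eq_abs, sq_abs, one_mul]
      rcases le_total t 0 with h | h
      · simp [max_eq_right h]; positivity
      · simp [max_eq_left h]
    have h2 := (h1.hasFDerivAt (by norm_num)).hasDerivAt
    simpa using h2
  · rw [max_eq_left h.le]
    have := (hasDerivAt_pow 2 x)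
    simp only [Nat.cast_ofNat, Nat.add_one_sub_one, pow_one] at this
    refine this.congr_of_eventuallyEq ?_
    filter_upwards [Ioi_mem_nhds h] with t ht
    simp [max_eq_left (mem_Ioi.1 ht).le]

theorem contDiff_max_sq : ContDiff ℝ 1 fun t : ℝ => (max t 0) ^ 2 := by
  rw [contDiff_one_iff_deriv]
  refine ⟨fun x => (hasDerivAt_max_sq x).differentiableAt, ?_⟩
  rw [show deriv (fun t : ℝ => (max t 0) ^ 2) = fun x => 2 * max x 0 from
    funext fun x => (hasDerivAt_max_sq x).deriv]
  fun_prop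

variable {E : Type*} [NormedAddCommGroup E]

/-- A `C^1` cutoff function on the ball of centre `c` and radius `R`. -/
def cutoff (c : E) (R : ℝ) (y : E) : ℝ := (max (1 - ‖y - c‖ ^ 2 / R ^ 2) 0) ^ 2

theorem cutoff_nonneg (c : E) (R : ℝ) (y : E) : 0 ≤ cutoff c R y := sq_nonneg _

theorem cutoff_le_one (c : E) (R : ℝ) (y : E) : cutoff c R y ≤ 1 := by
  refine pow_le_one₀ (le_max_right _ _) (max_le ?_ zero_le_one)
  have : 0 ≤ ‖y - c‖ ^ 2 / R ^ 2 := by positivity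
  linarith

theorem cutoff_self (c : E) (R : ℝ) : cutoff c R c = 1 := by simp [cutoff]

theorem cutoff_eq_zero {c : E} {R : ℝ} (hR : 0 < R) {y : E} (h : R ≤ ‖y - c‖) :
    cutoff c R y = 0 := by
  have : 1 ≤ ‖y - c‖ ^ 2 / R ^ 2 := by
    rw [one_le_div (by positivity)]; gcongr
  rw [cutoff, max_eq_right (by linarith)]
  simp

/-- The value is `(1 - 1/4)²`, attained at distance `R / 2`. -/
theorem le_cutoff {c : E} {R : ℝ} (hR : 0 < R) {y : E} (h : ‖y - c‖ ≤ R / 2) :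
    9 / 16 ≤ cutoff c R y := by
  have h1 : ‖y - c‖ ^ 2 / R ^ 2 ≤ 1 / 4 := by
    rw [div_le_iff₀ (by positivity)]
    calc ‖y - c‖ ^ 2 ≤ (R / 2) ^ 2 := by gcongr
      _ = _ := by ring
  rw [cutoff, max_eq_left (by linarith)]
  nlinarith

variable [InnerProductSpace ℝ E]

theorem contDiff_cutoff (c : E) (R : ℝ) : ContDiff ℝ 1 (cutoff c R) := by
  refine contDiff_max_sq.comp ?_
  exact contDiff_const.sub (((contDiff_id.sub contDiff_const).norm_sq ℝ).div_const _)

/-- Chain rule: the outer derivative is at most `2` and the inner one at most `2 ‖y - c‖ / R² ≤ 2 /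
R` inside the ball; outside it the positive part vanishes. -/
theorem norm_fderiv_cutoff_le {c : E} {R : ℝ} (hR : 0 < R) (y : E) :
    ‖fderiv ℝ (cutoff c R) y‖ ≤ 4 / R := by
  have h1 : HasFDerivAt (fun y : E => 1 - ‖y - c‖ ^ 2 / R ^ 2)
      (-((R ^ 2)⁻¹ • (2 • (innerSL ℝ (y - c)).comp (ContinuousLinearMap.id ℝ E)))) y := by
    have := (((hasFDerivAt_id y).sub_const c).norm_sq).mul_const ((R ^ 2)⁻¹)
    simpa [div_eq_mul_inv] using! this.const_sub 1
  have h2 := (hasDerivAt_max_sq (1 - ‖y - c‖ ^ 2 / R ^ 2)).comp_hasFDerivAt y h1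
  have h3 : HasFDerivAt (cutoff c R) _ y := h2
  rw [h3.fderiv]
  by_cases h : R ≤ ‖y - c‖
  · have : 1 ≤ ‖y - c‖ ^ 2 / R ^ 2 := by
      rw [one_le_div (by positivity)]; gcongr
    rw [max_eq_right (by linarith)]
    simp
    positivity
  · push Not at h
    rw [norm_smul, norm_neg, norm_smul]
    have e1 : ‖(2 • (innerSL ℝ (y - c)).comp (ContinuousLinearMap.id ℝ E))‖ ≤ 2 * R := by
      refine (norm_nsmul_le).trans ?_
      have : ‖innerSL ℝ (y - c)‖ = ‖y - c‖ := innerSL_apply_norm ℝ _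
      simp only [ContinuousLinearMap.comp_id, this, Nat.cast_ofNat]
      gcongr
    have e2 : ‖2 * max (1 - ‖y - c‖ ^ 2 / R ^ 2) 0‖ ≤ 2 := by
      rw [Real.norm_of_nonneg (by positivity)]
      have : max (1 - ‖y - c‖ ^ 2 / R ^ 2) 0 ≤ 1 := by
        refine max_le ?_ zero_le_one
        have : 0 ≤ ‖y - c‖ ^ 2 / R ^ 2 := by positivity
        linarith
      linarith
    rw [Real.norm_of_nonneg (by positivity : 0 ≤ (R ^ 2)⁻¹)]
    calc _ ≤ 2 * ((R ^ 2)⁻¹ * (2 * R)) := by gcongr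
      _ = 4 / R := by field_simp; ring

end Cutoff

/-! ### The energy estimate in coordinates -/

section Energy

variable {m : ℕ}

theorem integrable_of_support {g : Eu m → ℝ} {c : Eu m} {R : ℝ}
    (hg : ContinuousOn g (Metric.closedBall c R)) (h0 : ∀ y, y ∉ Metric.closedBall c R → g y = 0) :
    Integrable g := by
  have : IntegrableOn g (Metric.closedBall c R) :=
    hg.integrableOn_compact (isCompact_closedBall c R)
  rwa [integrableOn_iff_integrable_of_support_subset] at this
  intro y hy
  by_contra h
  exact hy (h0 y h)

/-- The bounded increasing function `T arctan (t / T)`. -/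
def squash (T t : ℝ) : ℝ := T * Real.arctan (t / T)

theorem hasDerivAt_squash {T : ℝ} (hT : 0 < T) (t : ℝ) :
    HasDerivAt (squash T) (1 / (1 + (t / T) ^ 2)) t := by
  have := ((Real.hasDerivAt_arctan (t / T)).comp t ((hasDerivAt_id t).div_const T)).const_mul T
  refine HasDerivAt.congr_deriv this ?_
  rw [mul_comm, mul_assoc, one_div_mul_cancel hT.ne', mul_one]

theorem contDiff_squash (T : ℝ) : ContDiff ℝ 1 (squash T) :=
  contDiff_const.mul (Real.contDiff_arctan.comp (contDiff_id.div_const T))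

theorem abs_squash_le {T : ℝ} (hT : 0 < T) (t : ℝ) : |squash T t| ≤ 2 * T := by
  rw [squash, abs_mul, abs_of_pos hT, mul_comm]
  gcongr
  have h1 := Real.arctan_lt_pi_div_two (t / T)
  have h2 := Real.neg_pi_div_two_lt_arctan (t / T)
  have h3 := Real.pi_le_four
  rw [abs_le]; constructor <;> linarith

/-- The local energy estimate for a flux `V` along the gradient of `v`. -/
theorem local_energy {c : Eu m} {R T K : ℝ} (hR : 0 < R) (hT : 0 < T) (hK : 0 ≤ K)
    {v : Eu m → ℝ} {V : Eu m → Fin m → ℝ} {Wt Rt A : Eu m → ℝ}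
    (hWt : ContinuousOn Wt (Metric.closedBall c R))
    (hRt : ContinuousOn Rt (Metric.closedBall c R))
    (hv : ∀ y ∈ Metric.closedBall c R, ContDiffAt ℝ 1 v y)
    (hV : ∀ y ∈ Metric.closedBall c R, ∀ k, ContDiffAt ℝ 1 (fun x => V x k) y)
    (hA : ∀ y ∈ Metric.closedBall c R, A y = ∑ k, fderiv ℝ v y (eb k) * V y k)
    (hA0 : ∀ y ∈ Metric.closedBall c R, 0 ≤ A y)
    (h2 : ∀ y ∈ Metric.closedBall c R, ∀ ℓ : Eu m →L[ℝ] ℝ,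
      |∑ k, ℓ (eb k) * V y k| ≤ K * ‖ℓ‖ * Wt y)
    (h3 : ∀ y ∈ Metric.closedBall c R,
      |∑ k, fderiv ℝ (fun x => V x k) y (eb k)| ≤ K * (Wt y + Rt y))
    (hW0 : ∀ y ∈ Metric.closedBall c R, 0 ≤ Wt y)
    (hR0 : ∀ y ∈ Metric.closedBall c R, 0 ≤ Rt y)
    {t : ℝ} (htR : t ≤ R / 2) (hbd : ∀ y ∈ Metric.closedBall c t, |v y - v c| ≤ T) :
    ∫ y in Metric.closedBall c t, A y ≤
      32 * T * K * ((1 + 1 / R) * (∫ y in Metric.closedBall c R, Wt y)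
        + ∫ y in Metric.closedBall c R, Rt y) := by
  set D := Metric.closedBall c R with hD
  -- The truncated height satisfies `|φ| ≤ 2T` on the whole large ball, although `|v - v c| ≤ T` is
  -- known only on the small one. This bound is the source of the factor `T`; where `|v - v c| ≤ T`
  -- the truncation still has slope at least `1/2`.
  set φ : Eu m → ℝ := fun y => squash T (v y - v c) with hφ
  set η := cutoff c R with hη
  set ψ : Eu m → ℝ := fun y => φ y * η y with hψ
  have cη : ContDiff ℝ 1 η := contDiff_cutoff c R
  have cφ : ∀ y ∈ D, ContDiffAt ℝ 1 φ y := fun y hy =>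
    (contDiff_squash T).contDiffAt.comp y ((hv y hy).sub contDiffAt_const)
  have cψ : ∀ y ∈ D, ContDiffAt ℝ 1 ψ y := fun y hy => (cφ y hy).mul cη.contDiffAt
  have ηz : ∀ y, y ∉ D → η y = 0 := by
    intro y hy
    rw [hD, Metric.mem_closedBall, dist_eq_norm, not_le] at hy
    exact cutoff_eq_zero hR hy.le
  have ψz : ∀ y, y ∉ D → ψ y = 0 := fun y hy => by simp [hψ, ηz y hy]
  -- The flux is differentiable only at the points of `D`, so integration by parts requires the
  -- closed support of the test function to lie in `D`.
  have tsψ : tsupport ψ ⊆ D := by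
    refine closure_minimal (fun y hy => ?_) Metric.isClosed_closedBall
    by_contra h
    exact hy (ψz y h)
  have fz : ∀ y, y ∉ D → fderiv ℝ ψ y = 0 := by
    intro y hy
    have : ψ =ᶠ[𝓝 y] fun _ => 0 := by
      filter_upwards [Metric.isClosed_closedBall.isOpen_compl.mem_nhds hy] with x hx
      exact ψz x hx
    rw [this.fderiv_eq]; simp
  have Dφ : ∀ y ∈ D, ∀ w, fderiv ℝ φ y w = 1 / (1 + ((v y - v c) / T) ^ 2) * fderiv ℝ v y w := by
    intro y hy w
    have := (hasDerivAt_squash hT (v y - v c)).comp_hasFDerivAt y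
      (((hv y hy).differentiableAt (by simp)).hasFDerivAt.sub_const (v c))
    have h : HasFDerivAt φ _ y := this
    rw [h.fderiv]
    simp
  have Dψ : ∀ y ∈ D, ∀ w, fderiv ℝ ψ y w
      = 1 / (1 + ((v y - v c) / T) ^ 2) * η y * fderiv ℝ v y w + φ y * fderiv ℝ η y w := by
    intro y hy w
    have : HasFDerivAt ψ _ y := ((cφ y hy).differentiableAt (by simp)).hasFDerivAt.mul
      (cη.differentiable (by simp) y).hasFDerivAt
    rw [this.fderiv]
    simp only [_root_.add_apply, _root_.smul_apply, smul_eq_mul, Dφ y hy]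
    ring
  have conV : ∀ k, ContinuousOn (fun y => V y k) D := fun k y hy =>
    (hV y hy k).continuousAt.continuousWithinAt
  have condV : ∀ k, ContinuousOn (fun y => fderiv ℝ (fun x => V x k) y (eb k)) D := fun k y hy =>
    (((hV y hy k).fderiv_right (m := 0) (by norm_num)).continuousAt.clm_apply
      continuousAt_const).continuousWithinAt
  have conψ : ContinuousOn ψ D := fun y hy => (cψ y hy).continuousAt.continuousWithinAt
  have condψ : ∀ k, ContinuousOn (fun y => fderiv ℝ ψ y (eb k)) D := fun k y hy =>
    (((cψ y hy).fderiv_right (m := 0) (by norm_num)).continuousAt.clm_apply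
      continuousAt_const).continuousWithinAt
  have i1 : ∀ k, Integrable fun y => fderiv ℝ ψ y (eb k) * V y k := fun k =>
    integrable_of_support ((condψ k).mul (conV k)) fun y hy => by simp [fz y hy]
  have i2 : ∀ k, Integrable fun y => ψ y * fderiv ℝ (fun x => V x k) y (eb k) := fun k =>
    integrable_of_support (conψ.mul (condV k)) fun y hy => by simp [ψz y hy]
  have i3 : ∀ k, Integrable fun y => ψ y * V y k := fun k =>
    integrable_of_support (conψ.mul (conV k)) fun y hy => by simp [ψz y hy]
  have diffψ : ∀ y, DifferentiableAt ℝ ψ y := by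
    intro y
    by_cases hy : y ∈ D
    · exact (cψ y hy).differentiableAt (by simp)
    · have : ψ =ᶠ[𝓝 y] fun _ => 0 := by
        filter_upwards [Metric.isClosed_closedBall.isOpen_compl.mem_nhds hy] with x hx
        exact ψz x hx
      exact this.differentiableAt_iff.2 (differentiableAt_const _)
  have ibp : ∀ k, ∫ y, ψ y * fderiv ℝ (fun x => V x k) y (eb k)
      = -∫ y, fderiv ℝ ψ y (eb k) * V y k := fun k =>
    integral_mul_fderiv_eq_neg_fderiv_mul_of_integrable (i1 k) (i2 k) (i3 k)
      (fun y _ => diffψ y) fun y hy => (hV y (tsψ hy) k).differentiableAt (by simp)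
  -- The good term: the part of `∇ψ · V` in which the derivative falls on the height. It is a
  -- nonnegative weight times `A`.
  set F : Eu m → ℝ := fun y => 1 / (1 + ((v y - v c) / T) ^ 2) * η y * A y with hF
  have key : ∀ y ∈ D, F y ≤ ∑ k, fderiv ℝ ψ y (eb k) * V y k
      + ∑ k, ψ y * fderiv ℝ (fun x => V x k) y (eb k)
      + 2 * T * K * ((1 + 4 / R) * Wt y + Rt y) := by
    intro y hy
    have e1 : ∑ k, fderiv ℝ ψ y (eb k) * V y k
        = F y + φ y * ∑ k, fderiv ℝ η y (eb k) * V y k := by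
      rw [hF]
      simp only
      rw [hA y hy, Finset.mul_sum, Finset.mul_sum, ← Finset.sum_add_distrib]
      refine Finset.sum_congr rfl fun k _ => ?_
      rw [Dψ y hy]; ring
    rw [e1, ← Finset.mul_sum]
    have e2 : |φ y * ∑ k, fderiv ℝ η y (eb k) * V y k| ≤ 2 * T * (K * (4 / R) * Wt y) := by
      rw [abs_mul]
      have hw := hW0 y hy
      refine mul_le_mul (abs_squash_le hT _) ((h2 y hy _).trans ?_) (abs_nonneg _) (by positivity)
      gcongr
      exact norm_fderiv_cutoff_le hR y
    have e3 : |ψ y * ∑ k, fderiv ℝ (fun x => V x k) y (eb k)| ≤ 2 * T * (K * (Wt y + Rt y)) := by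
      rw [abs_mul]
      refine mul_le_mul ?_ (h3 y hy) (abs_nonneg _) (by positivity)
      rw [hψ]; simp only; rw [abs_mul, abs_of_nonneg (cutoff_nonneg c R y)]
      exact mul_le_of_le_one_right (abs_nonneg _) (cutoff_le_one c R y) |>.trans
        (abs_squash_le hT _)
    have e4 := neg_abs_le (φ y * ∑ k, fderiv ℝ η y (eb k) * V y k)
    have e5 := neg_abs_le (ψ y * ∑ k, fderiv ℝ (fun x => V x k) y (eb k))
    have : 2 * T * K * ((1 + 4 / R) * Wt y + Rt y)
        = 2 * T * (K * (4 / R) * Wt y) + 2 * T * (K * (Wt y + Rt y)) := by ring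
    linarith
  have conv : ContinuousOn v D := fun y hy => (hv y hy).continuousAt.continuousWithinAt
  have conA : ContinuousOn A D := by
    refine ContinuousOn.congr ?_ hA
    refine continuousOn_finsetSum _ fun k _ => ContinuousOn.mul (fun y hy => ?_) (conV k)
    exact (((hv y hy).fderiv_right (m := 0) (by norm_num)).continuousAt.clm_apply
      continuousAt_const).continuousWithinAt
  have conF : ContinuousOn F D := by
    refine ContinuousOn.mul (ContinuousOn.mul ?_ cη.continuous.continuousOn) conA
    refine continuousOn_const.div (by fun_prop) fun y _ => by positivity
  have iW : IntegrableOn Wt D := hWt.integrableOn_compact (isCompact_closedBall c R)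
  have iR : IntegrableOn Rt D := hRt.integrableOn_compact (isCompact_closedBall c R)
  have iF : IntegrableOn F D := conF.integrableOn_compact (isCompact_closedBall c R)
  have s1 : ∫ y in D, F y ≤ 2 * T * K * ((1 + 4 / R) * (∫ y in D, Wt y) + ∫ y in D, Rt y) := by
    have j1 : IntegrableOn (fun y => ∑ k, fderiv ℝ ψ y (eb k) * V y k) D :=
      (integrable_finsetSum _ fun k _ => i1 k).integrableOn
    have j2 : IntegrableOn (fun y => ∑ k, ψ y * fderiv ℝ (fun x => V x k) y (eb k)) D :=
      (integrable_finsetSum _ fun k _ => i2 k).integrableOn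
    have j3 : IntegrableOn (fun y => 2 * T * K * ((1 + 4 / R) * Wt y + Rt y)) D :=
      ((iW.const_mul _).add iR).const_mul _
    have j12 : IntegrableOn (fun y => ∑ k, fderiv ℝ ψ y (eb k) * V y k
        + ∑ k, ψ y * fderiv ℝ (fun x => V x k) y (eb k)) D := j1.add j2
    refine (setIntegral_mono_on iF (j12.add j3) measurableSet_closedBall key).trans ?_
    simp only [Pi.add_apply]
    rw [integral_add j12 j3, integral_add j1 j2, integral_const_mul,
      integral_add (iW.const_mul _) iR, integral_const_mul]
    -- Summed over `k`, the integration by parts says that the divergence of the compactly supported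
    -- field `ψ V` has integral zero.
    have z : ∫ y in D, ∑ k, fderiv ℝ ψ y (eb k) * V y k
        + 0 = -∫ y in D, ∑ k, ψ y * fderiv ℝ (fun x => V x k) y (eb k) := by
      rw [setIntegral_eq_integral_of_forall_compl_eq_zero fun y hy => by simp [fz y hy],
        setIntegral_eq_integral_of_forall_compl_eq_zero fun y hy => by simp [ψz y hy]]
      simp only [add_zero]
      rw [integral_finsetSum _ fun k _ => i1 k, integral_finsetSum _ fun k _ => i2 k,
        ← Finset.sum_neg_distrib]
      exact Finset.sum_congr rfl fun k _ => by rw [ibp k, neg_neg]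
    simp only [add_zero] at z
    linarith
  have hsub : Metric.closedBall c t ⊆ D := Metric.closedBall_subset_closedBall (by linarith)
  -- On the small ball the weight in `F` is at least `1/2` from the truncation times `9/16` from the
  -- cutoff.
  have s2 : ∫ y in Metric.closedBall c t, 9 / 32 * A y ≤ ∫ y in D, F y := by
    calc _ ≤ ∫ y in Metric.closedBall c t, F y := by
          refine setIntegral_mono_on ((conA.mono hsub).integrableOn_compact
            (isCompact_closedBall c t) |>.const_mul _) (iF.mono_set hsub)
            measurableSet_closedBall fun y hy => ?_
          have a0 := hA0 y (hsub hy)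
          rw [hF]
          simp only
          gcongr
          have b1 : 9 / 16 ≤ η y := by
            refine le_cutoff hR ?_
            rw [Metric.mem_closedBall, dist_eq_norm] at hy
            linarith
          have b2 : 1 / 2 ≤ 1 / (1 + ((v y - v c) / T) ^ 2) := by
            apply one_div_le_one_div_of_le (by positivity)
            have : ((v y - v c) / T) ^ 2 ≤ 1 := by
              rw [div_pow, div_le_one (by positivity), sq_le_sq, abs_of_pos hT]
              exact hbd y hy
            linarith
          calc (9 : ℝ) / 32 = 1 / 2 * (9 / 16) := by norm_num
            _ ≤ _ := by gcongr
      _ ≤ ∫ y in D, F y := by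
          refine setIntegral_mono_set iF ?_ hsub.eventuallyLE
          filter_upwards [ae_restrict_mem measurableSet_closedBall] with y hy
          have a0 := hA0 y hy
          have := cutoff_nonneg c R y
          simp only [Pi.zero_apply, hF]
          positivity
  rw [integral_const_mul] at s2
  have w0 : 0 ≤ ∫ y in D, Wt y := setIntegral_nonneg measurableSet_closedBall hW0
  have r0 : 0 ≤ ∫ y in D, Rt y := setIntegral_nonneg measurableSet_closedBall hR0
  -- The final constant `32` absorbs `64/9` and, in front of `1/R`, `256/9`.
  have : ∫ y in Metric.closedBall c t, A y ≤
      32 / 9 * (2 * T * K * ((1 + 4 / R) * (∫ y in D, Wt y) + ∫ y in D, Rt y)) := by linarith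
  refine this.trans ?_
  have hTK : 0 ≤ T * K := by positivity
  have hR1 : 0 < 1 / R := by positivity
  rw [show 4 / R = 4 * (1 / R) by ring]
  have k1 := mul_nonneg hTK w0
  have k2 := mul_nonneg hTK r0
  have k3 := mul_nonneg k1 hR1.le
  nlinarith

end Energy

/-! ### The metric in the charts of the spacetime -/

section SpacetimeCharts

set_option synthInstance.maxHeartbeats 200000

variable {m : ℕ} {S : Type*} [TopologicalSpace S] [ChartedSpace (EuclideanSpace ℝ (Fin m)) S]

theorem dtau_eq (p : ℝ × S) (v : TangentSpace (stModel m) p) : dtau p v = v.1 := by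
  rw [dtau, mfderiv_fst]; rfl

theorem dpi_eq (p : ℝ × S) (v : TangentSpace (stModel m) p) : dpi p v = v.2 := by
  rw [dpi, mfderiv_snd]; rfl

/-- The chart of the spacetime at `p`. -/
def stChart (p : ℝ × S) : PartialEquiv (ℝ × S) (ℝ × Eu m) := extChartAt (stModel m) p

theorem stChart_apply (p x : ℝ × S) : stChart (m := m) p x = (x.1, extChartAt (𝓡 m) p.2 x.2) := by
  rw [stChart, extChartAt_prod]; rfl

theorem stChart_symm_apply (p : ℝ × S) (z : ℝ × Eu m) :
    (stChart p).symm z = (z.1, (extChartAt (𝓡 m) p.2).symm z.2) := by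
  rw [stChart, extChartAt_prod]; rfl

theorem mem_stChart_source (p x : ℝ × S) :
    x ∈ (stChart (m := m) p).source ↔ x.2 ∈ (extChartAt (𝓡 m) p.2).source := by
  rw [stChart, extChartAt_prod, PartialEquiv.prod_source, mem_prod]
  exact and_iff_right (by rw [extChartAt_model_space_eq_id]; exact mem_univ _)

theorem mem_stChart_target (p : ℝ × S) (z : ℝ × Eu m) :
    z ∈ (stChart p).target ↔ z.2 ∈ (extChartAt (𝓡 m) p.2).target := by
  rw [stChart, extChartAt_prod, PartialEquiv.prod_target, mem_prod]
  exact and_iff_right (by rw [extChartAt_model_space_eq_id]; exact mem_univ _)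

theorem isOpen_stChart_target (p : ℝ × S) : IsOpen (stChart (m := m) p).target :=
  isOpen_extChartAt_target p

variable [IsManifold (𝓡 m) ∞ S]

/-- The differential of the inverse of a chart of the spacetime. -/
def stD (p : ℝ × S) (z : ℝ × Eu m) :
    (ℝ × Eu m) →L[ℝ] (ℝ × Eu m) :=
  mfderiv 𝓘(ℝ, ℝ × EuclideanSpace ℝ (Fin m)) (stModel m) (stChart p).symm z

theorem mdifferentiableAt_stChart_symm {p : ℝ × S} {z : ℝ × Eu m} (hz : z ∈ (stChart p).target) :
    MDifferentiableAt 𝓘(ℝ, ℝ × EuclideanSpace ℝ (Fin m)) (stModel m) (stChart p).symm z :=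
  ((contMDiffOn_extChartAt_symm (n := ∞) p).contMDiffAt
    ((isOpen_stChart_target p).mem_nhds hz)).mdifferentiableAt (by simp)

theorem stD_fst {p : ℝ × S} {z : ℝ × Eu m} (hz : z ∈ (stChart p).target) (a : ℝ × Eu m) :
    dtau ((stChart p).symm z) (stD p z a) = a.1 := by
  have h1 : (Prod.fst : ℝ × S → ℝ) ∘ (stChart (m := m) p).symm = Prod.fst := by
    funext z; simp [stChart_symm_apply]
  have h2 := mfderiv_comp z (mdifferentiableAt_fst (I := 𝓘(ℝ, ℝ)) (I' := 𝓡 m))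
    (mdifferentiableAt_stChart_symm hz)
  rw [h1, mfderiv_eq_fderiv] at h2
  have h3 := congrArg (fun L => L a) h2
  have h4 : fderiv ℝ (Prod.fst : ℝ × Eu m → ℝ) z a = a.1 := by
    rw [fderiv_fst]; rfl
  exact (h3.symm.trans h4 :)

/-- A chart of `ℝ × S` is a product, so coordinate vectors along the time axis stay tangent to the
factor `ℝ`, which is the kernel of `σ`. -/
theorem stD_snd {p : ℝ × S} {z : ℝ × Eu m} (hz : z ∈ (stChart p).target) (a : ℝ) :
    dpi ((stChart p).symm z) (stD p z (a, 0)) = 0 := by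
  have h1 : (Prod.snd : ℝ × S → S) ∘ (stChart (m := m) p).symm
      = (extChartAt (𝓡 m) p.2).symm ∘ Prod.snd := by
    funext z; simp [stChart_symm_apply]
  have h2 := mfderiv_comp z (mdifferentiableAt_snd (I := 𝓘(ℝ, ℝ)) (I' := 𝓡 m))
    (mdifferentiableAt_stChart_symm hz)
  have hd : MDifferentiableAt 𝓘(ℝ, EuclideanSpace ℝ (Fin m)) (𝓡 m)
      (extChartAt (𝓡 m) p.2).symm z.2 :=
    ((contMDiffOn_extChartAt_symm (n := ∞) p.2).contMDiffAt
      ((isOpen_extChartAt_target p.2).mem_nhds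
        ((mem_stChart_target p z).1 hz))).mdifferentiableAt (by simp)
  have h3 := mfderiv_comp z hd
    (differentiableAt_snd (𝕜 := ℝ) (E := ℝ) (F := Eu m)).mdifferentiableAt
  rw [h1, h3] at h2
  have h4 := congrArg (fun L => L ((a, 0) : ℝ × Eu m)) h2
  have h5 : mfderiv 𝓘(ℝ, ℝ × Eu m) 𝓘(ℝ, Eu m) (Prod.snd : ℝ × Eu m → Eu m) z (a, 0) = 0 := by
    rw [mfderiv_eq_fderiv, fderiv_snd]; rfl
  refine (h4.symm.trans ?_ :)
  refine (congrArg (mfderiv 𝓘(ℝ, EuclideanSpace ℝ (Fin m)) (𝓡 m)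
      (extChartAt (𝓡 m) p.2).symm z.2) h5).trans ?_
  exact map_zero _

variable (𝓜 : SplitMetric m S)

namespace SplitMetric

/-- The tensor `σ` in a chart of the spacetime. -/
def sigHat (p : ℝ × S) (z : ℝ × Eu m) : (ℝ × Eu m) →L[ℝ] (ℝ × Eu m) →L[ℝ] ℝ :=
  (show (ℝ × Eu m) →L[ℝ] (ℝ × Eu m) →L[ℝ] ℝ from 𝓜.sig ((stChart p).symm z)).bilinearComp (stD p z) (stD p z)

theorem sigHat_apply (p : ℝ × S) (z a b : ℝ × Eu m) :
    𝓜.sigHat p z a b = 𝓜.sig ((stChart p).symm z) (stD p z a) (stD p z b) := rfl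

/-- The Lorentzian metric in a chart of the spacetime. -/
def gHat (p : ℝ × S) (z : ℝ × Eu m) : (ℝ × Eu m) →L[ℝ] (ℝ × Eu m) →L[ℝ] ℝ :=
  𝓜.lapse ((stChart (m := m) p).symm z) ^ 2 •
    (-((ContinuousLinearMap.fst ℝ ℝ (Eu m)).smulRight (ContinuousLinearMap.fst ℝ ℝ (Eu m)))
      + 𝓜.sigHat p z)

theorem gHat_apply (p : ℝ × S) (z a b : ℝ × Eu m) : 𝓜.gHat p z a b =
    𝓜.lapse ((stChart (m := m) p).symm z) ^ 2 * (-(a.1 * b.1) + 𝓜.sigHat p z a b) := by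
  simp [gHat]
  ring

theorem gHat_eq {p : ℝ × S} {z : ℝ × Eu m} (hz : z ∈ (stChart p).target) (a b : ℝ × Eu m) :
    𝓜.gHat p z a b = 𝓜.gbar ((stChart p).symm z) (stD p z a) (stD p z b) := by
  refine (𝓜.gHat_apply p z a b).trans ?_
  rw [← stD_fst hz a, ← stD_fst hz b, sigHat_apply]
  rfl

theorem gHat_eq_chartMetric {p : ℝ × S} {z : ℝ × Eu m} (hz : z ∈ (stChart p).target)
    (a b : ℝ × Eu m) : 𝓜.gHat p z a b = 𝓜.chartMetric p z a b :=
  𝓜.gHat_eq hz a b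

theorem sigHat_symm (p : ℝ × S) (z a b : ℝ × Eu m) : 𝓜.sigHat p z a b = 𝓜.sigHat p z b a :=
  𝓜.sig_symm ((stChart p).symm z) (stD p z a) (stD p z b)

theorem gHat_symm (p : ℝ × S) (z a b : ℝ × Eu m) : 𝓜.gHat p z a b = 𝓜.gHat p z b a := by
  rw [gHat_apply, gHat_apply, sigHat_symm, mul_comm a.1]

theorem sigHat_vertical {p : ℝ × S} {z : ℝ × Eu m} (hz : z ∈ (stChart p).target) (a : ℝ)
    (b : ℝ × Eu m) : 𝓜.sigHat p z (a, 0) b = 0 :=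
  𝓜.sig_ker ((stChart p).symm z) (stD p z (a, 0)) (stD p z b) (stD_snd hz a)

/-- The spatial tensor `σ` in a chart of the spacetime. -/
def sHat (p : ℝ × S) (z : ℝ × Eu m) : Eu m →L[ℝ] Eu m →L[ℝ] ℝ :=
  (𝓜.sigHat p z).bilinearComp (ContinuousLinearMap.inr ℝ ℝ (Eu m))
    (ContinuousLinearMap.inr ℝ ℝ (Eu m))

theorem sHat_apply (p : ℝ × S) (z : ℝ × Eu m) (a b : Eu m) :
    𝓜.sHat p z a b = 𝓜.sigHat p z (0, a) (0, b) := rfl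

/-- In each slot the time component lies in the kernel of the tensor, so only the spatial components
survive. This gives the metric the form `α² (-dt² + s)` used in the computations on graphs. -/
theorem sigHat_eq_sHat {p : ℝ × S} {z : ℝ × Eu m} (hz : z ∈ (stChart p).target)
    (a b : ℝ × Eu m) : 𝓜.sigHat p z a b = 𝓜.sHat p z a.2 b.2 := by
  have e : ∀ a : ℝ × Eu m, a = (a.1, 0) + (0, a.2) := fun a => by simp
  conv_lhs => rw [e a, e b]
  simp only [map_add, _root_.add_apply, 𝓜.sigHat_vertical hz]
  rw [𝓜.sigHat_symm p z (0, a.2) (b.1, 0), 𝓜.sigHat_vertical hz, sHat_apply]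
  ring

theorem gHat_eq_sHat {p : ℝ × S} {z : ℝ × Eu m} (hz : z ∈ (stChart p).target)
    (a b : ℝ × Eu m) : 𝓜.gHat p z a b =
    𝓜.lapse ((stChart (m := m) p).symm z) ^ 2 * (-(a.1 * b.1) + 𝓜.sHat p z a.2 b.2) := by
  rw [gHat_apply, 𝓜.sigHat_eq_sHat hz]

theorem stD_injective {p : ℝ × S} {z : ℝ × Eu m} (hz : z ∈ (stChart p).target) :
    Function.Injective (stD p z) := by
  have := isInvertible_mfderivWithin_extChartAt_symm (I := stModel m) (x := p) hz
  have h2 : stD p z = mfderivWithin 𝓘(ℝ, ℝ × EuclideanSpace ℝ (Fin m)) (stModel m)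
      (stChart p).symm (range (stModel m)) z := by
    rw [stD, ModelWithCorners.Boundaryless.range_eq_univ, mfderivWithin_univ]
  obtain ⟨e, he⟩ := this
  have h3 : ∀ v, stD p z v = e v := by
    intro v
    rw [h2]
    exact congrArg (fun L => L v) he.symm
  intro v w hvw
  rw [h3, h3] at hvw
  exact e.injective hvw

theorem stD_surjective {p : ℝ × S} {z : ℝ × Eu m} (hz : z ∈ (stChart p).target)
    (v : ℝ × Eu m) : ∃ a, stD p z a = v := by
  have := isInvertible_mfderivWithin_extChartAt_symm (I := stModel m) (x := p) hz
  have h2 : stD p z = mfderivWithin 𝓘(ℝ, ℝ × EuclideanSpace ℝ (Fin m)) (stModel m)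
      (stChart p).symm (range (stModel m)) z := by
    rw [stD, ModelWithCorners.Boundaryless.range_eq_univ, mfderivWithin_univ]
  obtain ⟨e, he⟩ := this
  refine ⟨e.symm v, ?_⟩
  rw [h2]
  exact (congrArg (fun L => L (e.symm v)) he.symm).trans (e.apply_symm_apply v)

/-- If the image of `(0, a)` projected to zero in `S`, it would be zero, its time component being
zero as well; the inverse chart has an injective differential. -/
theorem sHat_pos {p : ℝ × S} {z : ℝ × Eu m} (hz : z ∈ (stChart p).target) {a : Eu m}
    (ha : a ≠ 0) : 0 < 𝓜.sHat p z a a := by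
  refine 𝓜.sig_pos ((stChart p).symm z) (stD p z (0, a)) fun h => ha ?_
  have h1 : stD p z ((0, a) : ℝ × Eu m) = 0 := by
    have h2 := stD_fst hz ((0, a) : ℝ × Eu m)
    exact Prod.ext ((dtau_eq ((stChart p).symm z) (stD p z (0, a))).symm.trans h2)
      ((dpi_eq ((stChart p).symm z) (stD p z (0, a))).symm.trans h)
  have := stD_injective hz (h1.trans (map_zero _).symm)
  exact (Prod.ext_iff.1 this).2

/-! Smoothness in charts. -/

/-- The map is the tangent map of the inverse chart composed with the constant vector field `a`. -/
theorem contMDiffOn_stD (p : ℝ × S) (a : ℝ × Eu m) :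
    ContMDiffOn 𝓘(ℝ, ℝ × Eu m) (stModel m).tangent ∞
      (fun z => (⟨(stChart p).symm z, stD p z a⟩ : TangentBundle (stModel m) (ℝ × S)))
      (stChart p).target := by
  have h1 := (contMDiffOn_extChartAt_symm (I := stModel m) (n := ∞) p).contMDiffOn_tangentMapWithin
    (m := ∞) (by simp) (isOpen_stChart_target p).uniqueMDiffOn
  have h2 : ContMDiff 𝓘(ℝ, ℝ × Eu m) 𝓘(ℝ, ℝ × Eu m).tangent ∞
      (fun z : ℝ × Eu m => (⟨z, a⟩ : TangentBundle 𝓘(ℝ, ℝ × Eu m) (ℝ × Eu m))) := by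
    exact contMDiff_vectorSpace_iff_contDiff.2 contDiff_const
  refine (h1.comp h2.contMDiffOn fun z hz => hz).congr fun z hz => ?_
  simp only [Function.comp_apply, tangentMapWithin]
  have h3 := mfderivWithin_of_isOpen (I := 𝓘(ℝ, ℝ × Eu m)) (I' := stModel m)
    (f := (stChart (m := m) p).symm) (isOpen_stChart_target p) hz
  have h4 : stD p z a = mfderivWithin 𝓘(ℝ, ℝ × Eu m) (stModel m)
      (extChartAt (stModel m) p).symm (extChartAt (stModel m) p).target z a :=
    (congrArg (fun L => L a) h3).symm
  exact congrArg (fun v => (⟨(stChart p).symm z, v⟩ : TangentBundle (stModel m) (ℝ × S))) h4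

/-- A smooth section of the bundle of bilinear forms, evaluated on two smooth vector fields along
the inverse chart. -/
theorem contDiffOn_sigHat_apply (p : ℝ × S) (a b : ℝ × Eu m) :
    ContDiffOn ℝ ∞ (fun z => 𝓜.sigHat p z a b) (stChart p).target := by
  rw [← contMDiffOn_iff_contDiffOn]
  intro z hz
  have h1 : ContMDiffWithinAt 𝓘(ℝ, ℝ × Eu m) ((stModel m).prod
      𝓘(ℝ, (ℝ × EuclideanSpace ℝ (Fin m)) →L[ℝ] (ℝ × EuclideanSpace ℝ (Fin m)) →L[ℝ] ℝ)) ∞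
      (fun z => Bundle.TotalSpace.mk'
      ((ℝ × EuclideanSpace ℝ (Fin m)) →L[ℝ] (ℝ × EuclideanSpace ℝ (Fin m)) →L[ℝ] ℝ)
      (E := fun p : ℝ × S =>
        TangentSpace (stModel m) p →L[ℝ] TangentSpace (stModel m) p →L[ℝ] ℝ)
        ((stChart p).symm z) (𝓜.sig ((stChart p).symm z))) (stChart p).target z :=
    (𝓜.sig_smooth _).comp_contMDiffWithinAt z (contMDiffOn_extChartAt_symm (n := ∞) p z hz)
  have h2 := ContMDiffWithinAt.clm_bundle_apply₂ (E₃ := Bundle.Trivial (ℝ × S) ℝ) h1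
    (contMDiffOn_stD p a z hz) (contMDiffOn_stD p b z hz)
  rw [Bundle.contMDiffWithinAt_totalSpace] at h2
  have h3 := h2.2
  simp only at h3
  exact h3

theorem contDiffOn_lapse (p : ℝ × S) :
    ContDiffOn ℝ ∞ (fun z => 𝓜.lapse ((stChart (m := m) p).symm z)) (stChart p).target := by
  rw [← contMDiffOn_iff_contDiffOn]
  exact 𝓜.lapse_smooth.comp_contMDiffOn (contMDiffOn_extChartAt_symm (n := ∞) p)

theorem contDiffOn_gHat (p : ℝ × S) : ContDiffOn ℝ ∞ (𝓜.gHat p) (stChart p).target := by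
  rw [contDiffOn_clm_apply]
  intro a
  rw [contDiffOn_clm_apply]
  intro b
  simp only [gHat_apply]
  exact ((𝓜.contDiffOn_lapse p).pow 2).mul (contDiffOn_const.add (𝓜.contDiffOn_sigHat_apply p a b))

theorem contDiffOn_sHat (p : ℝ × S) : ContDiffOn ℝ ∞ (𝓜.sHat p) (stChart p).target := by
  rw [contDiffOn_clm_apply]
  intro a
  rw [contDiffOn_clm_apply]
  intro b
  exact 𝓜.contDiffOn_sigHat_apply p (0, a) (0, b)

end SplitMetric

end SpacetimeCharts

/-! ### Changes of charts of the spacetime -/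

section Transition

set_option synthInstance.maxHeartbeats 200000

variable {m : ℕ} {S : Type*} [TopologicalSpace S] [ChartedSpace (EuclideanSpace ℝ (Fin m)) S]
  [IsManifold (𝓡 m) ∞ S]

/-- The domain of the change of charts from `p` to `p'`. -/
def stTransDom (p p' : ℝ × S) : Set (ℝ × Eu m) :=
  (stChart p).target ∩ (stChart p).symm ⁻¹' (stChart (m := m) p').source

/-- The change of charts from `p` to `p'`. -/
def stTrans (p p' : ℝ × S) (z : ℝ × Eu m) : ℝ × Eu m := stChart p' ((stChart p).symm z)

theorem isOpen_stChart_source (p : ℝ × S) : IsOpen (stChart (m := m) p).source :=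
  isOpen_extChartAt_source p

theorem isOpen_stTransDom (p p' : ℝ × S) : IsOpen (stTransDom (m := m) p p') :=
  (continuousOn_extChartAt_symm (I := stModel m) p).isOpen_inter_preimage
    (isOpen_stChart_target p) (isOpen_stChart_source p')

theorem contMDiffOn_stChart (p : ℝ × S) :
    ContMDiffOn (stModel m) 𝓘(ℝ, ℝ × Eu m) ∞ (stChart (m := m) p) (stChart (m := m) p).source := by
  have h := contMDiffOn_extChartAt (I := stModel m) (n := ∞) (x := p)
  rw [← extChartAt_source (I := stModel m)] at h
  exact h

theorem contMDiffOn_stChart_symm (p : ℝ × S) :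
    ContMDiffOn 𝓘(ℝ, ℝ × Eu m) (stModel m) ∞ (stChart (m := m) p).symm (stChart p).target :=
  contMDiffOn_extChartAt_symm (I := stModel m) (n := ∞) p

theorem contDiffOn_stTrans (p p' : ℝ × S) :
    ContDiffOn ℝ ∞ (stTrans (m := m) p p') (stTransDom p p') := by
  rw [← contMDiffOn_iff_contDiffOn]
  exact (contMDiffOn_stChart p').comp ((contMDiffOn_stChart_symm p).mono inter_subset_left)
    fun z hz => hz.2

theorem stTrans_mem_target {p p' : ℝ × S} {z : ℝ × Eu m} (hz : z ∈ stTransDom p p') :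
    stTrans p p' z ∈ (stChart p').target :=
  (stChart p').map_source hz.2

theorem stChart_symm_stTrans {p p' : ℝ × S} {z : ℝ × Eu m} (hz : z ∈ stTransDom p p') :
    (stChart p').symm (stTrans p p' z) = (stChart p).symm z :=
  (stChart p').left_inv hz.2

theorem stD_stTrans {p p' : ℝ × S} {z : ℝ × Eu m} (hz : z ∈ stTransDom p p') (a : ℝ × Eu m) :
    stD p' (stTrans p p' z) (fderiv ℝ (stTrans p p') z a) = stD p z a := by
  have h1 : (stChart (m := m) p).symm =ᶠ[𝓝 z] (stChart p').symm ∘ stTrans p p' := by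
    filter_upwards [(isOpen_stTransDom p p').mem_nhds hz] with x hx
    exact (stChart_symm_stTrans hx).symm
  have h2 : MDifferentiableAt 𝓘(ℝ, ℝ × Eu m) 𝓘(ℝ, ℝ × Eu m) (stTrans p p') z :=
    (((contDiffOn_stTrans p p').contDiffAt ((isOpen_stTransDom p p').mem_nhds hz)).differentiableAt
      (by simp)).mdifferentiableAt
  have h3 := mfderiv_comp z (mdifferentiableAt_stChart_symm (stTrans_mem_target hz)) h2
  rw [← h1.mfderiv_eq, mfderiv_eq_fderiv] at h3
  exact (congrArg (fun L => L a) h3).symm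

theorem SplitMetric.gHat_stTrans (𝓜 : SplitMetric m S) {p p' : ℝ × S} {z : ℝ × Eu m}
    (hz : z ∈ stTransDom p p') (a b : ℝ × Eu m) :
    𝓜.gHat p z a b = 𝓜.gHat p' (stTrans p p' z) (fderiv ℝ (stTrans p p') z a)
      (fderiv ℝ (stTrans p p') z b) := by
  rw [𝓜.gHat_eq hz.1, 𝓜.gHat_eq (stTrans_mem_target hz), stD_stTrans hz, stD_stTrans hz,
    stChart_symm_stTrans hz]

end Transition

/-! ### Charts of the hypersurface -/

section HypersurfaceCharts

set_option synthInstance.maxHeartbeats 200000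

variable {m : ℕ} [NeZero m] {N : Type*} [TopologicalSpace N] [ChartedSpace (EuclideanHalfSpace m) N]

/-- The chart of the hypersurface at `c`. -/
def nChart (c : N) : PartialEquiv N (Eu m) := extChartAt (𝓡∂ m) c

theorem nChart_target_subset_range (c : N) : (nChart (m := m) c).target ⊆ range (𝓡∂ m) :=
  extChartAt_target_subset_range c

theorem isOpen_nChart_source (c : N) : IsOpen (nChart (m := m) c).source :=
  isOpen_extChartAt_source c

theorem continuousOn_nChart_symm (c : N) :
    ContinuousOn (nChart (m := m) c).symm (nChart c).target :=
  continuousOn_extChartAt_symm c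

theorem continuousOn_nChart (c : N) : ContinuousOn (nChart (m := m) c) (nChart (m := m) c).source :=
  continuousOn_extChartAt c

theorem nChart_target_mem_nhdsWithin {c : N} {y : Eu m} (hy : y ∈ (nChart c).target) :
    (nChart (m := m) c).target ∈ 𝓝[range (𝓡∂ m)] y :=
  extChartAt_target_mem_nhdsWithin_of_mem hy

variable [IsManifold (𝓡∂ m) ∞ N]

theorem contMDiffOn_nChart (c : N) :
    ContMDiffOn (𝓡∂ m) 𝓘(ℝ, Eu m) ∞ (nChart (m := m) c) (nChart (m := m) c).source := by
  have h := contMDiffOn_extChartAt (I := 𝓡∂ m) (n := ∞) (x := c)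
  rw [← extChartAt_source (I := 𝓡∂ m)] at h
  exact h

theorem contMDiffOn_nChart_symm (c : N) :
    ContMDiffOn 𝓘(ℝ, Eu m) (𝓡∂ m) ∞ (nChart (m := m) c).symm (nChart c).target :=
  contMDiffOn_extChartAt_symm (I := 𝓡∂ m) (n := ∞) c

/-- Being an interior point does not depend on the chart. Moreover the chart target is a
neighbourhood within the half-space, so at a point interior to the half-space it is a full
neighbourhood. -/
theorem mem_interior_iff {c x : N} (hx : x ∈ (nChart (m := m) c).source) :
    x ∈ (𝓡∂ m).interior N ↔ nChart c x ∈ interior (range (𝓡∂ m)) := by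
  have : IsManifold (𝓡∂ m) 1 N := IsManifold.of_le (n := ∞) (by simp)
  have hx' : x ∈ (chartAt (EuclideanHalfSpace m) c).source := by
    rwa [nChart, extChartAt_source] at hx
  have h := (𝓡∂ m).isInteriorPoint_iff_of_mem_atlas (n := 1) (by simp)
    (chart_mem_atlas (EuclideanHalfSpace m) c) hx'
  refine h.trans ?_
  have h2 : ((chartAt (EuclideanHalfSpace m) c).extend (𝓡∂ m)) x
      ∈ ((chartAt (EuclideanHalfSpace m) c).extend (𝓡∂ m)).target :=
    (nChart (m := m) c).map_source hx
  constructor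
  · exact fun h => interior_mono (nChart_target_subset_range c) h
  · intro h3
    have h4 : (nChart c).target ∈ 𝓝[range (𝓡∂ m)] (nChart c x) :=
      nChart_target_mem_nhdsWithin h2
    rw [mem_interior_iff_mem_nhds] at h3 ⊢
    rw [nhdsWithin_eq_nhds.2 h3] at h4
    exact h4

/-- The differential of the inverse of a chart of the hypersurface. -/
def nD (c : N) (y : Eu m) : Eu m →L[ℝ] Eu m :=
  mfderivWithin 𝓘(ℝ, EuclideanSpace ℝ (Fin m)) (𝓡∂ m) (nChart c).symm (range (𝓡∂ m)) y

theorem nD_injective {c : N} {y : Eu m} (hy : y ∈ (nChart c).target) :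
    Function.Injective (nD c y) := by
  obtain ⟨e, he⟩ := isInvertible_mfderivWithin_extChartAt_symm (I := 𝓡∂ m) (x := c) hy
  have h3 : ∀ v, nD c y v = e v := fun v => congrArg (fun L => L v) he.symm
  intro v w hvw
  rw [h3, h3] at hvw
  exact e.injective hvw

theorem nD_surjective {c : N} {y : Eu m} (hy : y ∈ (nChart c).target) (v : Eu m) :
    ∃ a, nD c y a = v := by
  obtain ⟨e, he⟩ := isInvertible_mfderivWithin_extChartAt_symm (I := 𝓡∂ m) (x := c) hy
  exact ⟨e.symm v, (congrArg (fun L => L (e.symm v)) he.symm).trans (e.apply_symm_apply v)⟩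

theorem uniqueDiffWithinAt_range {c : N} {y : Eu m} (hy : y ∈ (nChart c).target) :
    UniqueDiffWithinAt ℝ (range (𝓡∂ m)) y :=
  (𝓡∂ m).uniqueDiffOn _ (nChart_target_subset_range c hy)

theorem mdifferentiableWithinAt_nChart_symm {c : N} {y : Eu m} (hy : y ∈ (nChart c).target) :
    MDifferentiableWithinAt 𝓘(ℝ, Eu m) (𝓡∂ m) (nChart c).symm (range (𝓡∂ m)) y :=
  ((contMDiffOn_nChart_symm c y hy).mono_of_mem_nhdsWithin
    (nChart_target_mem_nhdsWithin hy)).mdifferentiableWithinAt (by simp)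

theorem dFun_nD {u : N → ℝ} {c : N} {y : Eu m} (hy : y ∈ (nChart c).target)
    (hu : MDifferentiableAt (𝓡∂ m) 𝓘(ℝ, ℝ) u ((nChart c).symm y)) (v : Eu m) :
    dFun u ((nChart c).symm y) (nD c y v)
      = fderivWithin ℝ (fun y => u ((nChart c).symm y)) (range (𝓡∂ m)) y v := by
  have h := mfderiv_comp_mfderivWithin y hu (mdifferentiableWithinAt_nChart_symm hy)
    ((uniqueDiffWithinAt_range hy).uniqueMDiffWithinAt)
  rw [mfderivWithin_eq_fderivWithin] at h
  exact (congrArg (fun L => L v) h).symm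

variable {S : Type*} [TopologicalSpace S] [ChartedSpace (EuclideanSpace ℝ (Fin m)) S]
  [IsManifold (𝓡 m) ∞ S]

/-- The representation in charts of a map from the hypersurface to the spacetime. -/
def nRep (c : N) (p : ℝ × S) (F : N → ℝ × S) (y : Eu m) : ℝ × Eu m :=
  stChart p (F ((nChart c).symm y))

/-- The domain of the representation in charts. -/
def nDom (c : N) (p : ℝ × S) (F : N → ℝ × S) : Set (Eu m) :=
  (nChart c).target ∩ (nChart c).symm ⁻¹' (F ⁻¹' (stChart (m := m) p).source)

variable {c : N} {p : ℝ × S} {F : N → ℝ × S} {y : Eu m}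

theorem contDiffOn_nRep (hF : ContMDiff (𝓡∂ m) (stModel m) ∞ F) :
    ContDiffOn ℝ ∞ (nRep c p F) (nDom (m := m) c p F) := by
  rw [← contMDiffOn_iff_contDiffOn]
  exact (contMDiffOn_stChart p).comp (hF.comp_contMDiffOn
    ((contMDiffOn_nChart_symm c).mono inter_subset_left)) fun z hz => hz.2

theorem nDom_mem_nhdsWithin (hF : ContMDiff (𝓡∂ m) (stModel m) ∞ F) (hy : y ∈ nDom c p F) :
    nDom c p F ∈ 𝓝[range (𝓡∂ m)] y := by
  have h1 := nChart_target_mem_nhdsWithin hy.1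
  refine inter_mem h1 ?_
  have h2 : ContinuousWithinAt (fun y => F ((nChart (m := m) c).symm y)) (range (𝓡∂ m)) y :=
    hF.continuous.continuousAt.comp_continuousWithinAt
      ((continuousOn_nChart_symm c y hy.1).mono_of_mem_nhdsWithin h1)
  exact h2 ((isOpen_stChart_source p).mem_nhds hy.2)

theorem nRep_mem_target (hy : y ∈ nDom c p F) : nRep c p F y ∈ (stChart (m := m) p).target :=
  (stChart p).map_source hy.2

theorem stChart_symm_nRep (hy : y ∈ nDom c p F) :
    (stChart (m := m) p).symm (nRep c p F y) = F ((nChart c).symm y) :=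
  (stChart p).left_inv hy.2

/-- Two chain rules for the same map. The derivatives are taken within the half-space since `y` may
correspond to a boundary point. -/
theorem dMap_nD (hF : ContMDiff (𝓡∂ m) (stModel m) ∞ F) (hy : y ∈ nDom c p F) (v : Eu m) :
    dMap F ((nChart c).symm y) (nD c y v)
      = stD p (nRep c p F y) (fderivWithin ℝ (nRep c p F) (range (𝓡∂ m)) y v) := by
  have u1 := (uniqueDiffWithinAt_range hy.1).uniqueMDiffWithinAt
  have h := mfderiv_comp_mfderivWithin y
    ((hF ((nChart c).symm y)).mdifferentiableAt (by simp))
    (mdifferentiableWithinAt_nChart_symm hy.1) u1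
  have d1 : DifferentiableWithinAt ℝ (nRep c p F) (range (𝓡∂ m)) y :=
    ((contDiffOn_nRep hF y hy).mono_of_mem_nhdsWithin
      (nDom_mem_nhdsWithin hF hy)).differentiableWithinAt (by simp)
  have h2 := mfderiv_comp_mfderivWithin y
    (mdifferentiableAt_stChart_symm (nRep_mem_target hy)) d1.mdifferentiableWithinAt u1
  have h3 : (stChart (m := m) p).symm ∘ nRep c p F =ᶠ[𝓝[range (𝓡∂ m)] y]
      F ∘ (nChart (m := m) c).symm := by
    filter_upwards [nDom_mem_nhdsWithin hF hy] with x hx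
    exact stChart_symm_nRep hx
  have h4 := h3.mfderivWithin_eq (I := 𝓘(ℝ, Eu m)) (I' := stModel m) (stChart_symm_nRep hy)
  rw [h, h2, mfderivWithin_eq_fderivWithin] at h4
  exact (congrArg (fun L => L v) h4).symm

theorem fderivWithin_eq_fderiv_of_interior {G : Type*} [NormedAddCommGroup G] [NormedSpace ℝ G]
    (f : Eu m → G) (hy : y ∈ interior (range (𝓡∂ m))) :
    fderivWithin ℝ f (range (𝓡∂ m)) y = fderiv ℝ f y :=
  fderivWithin_of_mem_nhds (mem_interior_iff_mem_nhds.1 hy)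

theorem contDiffAt_nRep (hF : ContMDiff (𝓡∂ m) (stModel m) ∞ F) (hy : y ∈ nDom c p F)
    (hi : y ∈ interior (range (𝓡∂ m))) : ContDiffAt ℝ ∞ (nRep c p F) y := by
  refine (contDiffOn_nRep hF).contDiffAt ?_
  have := nDom_mem_nhdsWithin hF hy
  rwa [nhdsWithin_eq_nhds.2 (mem_interior_iff_mem_nhds.1 hi)] at this

end HypersurfaceCharts

/-! ### The mean curvature in arbitrary charts -/

theorem two_le_infty : (2 : WithTop ℕ∞) ≤ (∞ : WithTop ℕ∞) :=
  ENat.LEInfty.out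

theorem mcurv_congr {m : ℕ} {W : Type*} [NormedAddCommGroup W] [NormedSpace ℝ W]
    (B : W → W →L[ℝ] W →L[ℝ] ℝ) {f g : Eu m → W} {y : Eu m} (h : f =ᶠ[𝓝 y] g) (n : W) :
    mcurv B f y n = mcurv B g y n := by
  have h1 := h.fderiv_eq (𝕜 := ℝ)
  have h2 := (h.fderiv (𝕜 := ℝ)).fderiv_eq (𝕜 := ℝ)
  simp only [mcurv, gramF, fff, sff, h1, h2, h.self_of_nhds]

section MeanCurvatureCharts

set_option synthInstance.maxHeartbeats 200000

variable {m : ℕ} [NeZero m] {N : Type*} [TopologicalSpace N] [ChartedSpace (EuclideanHalfSpace m) N]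
  {S : Type*} [TopologicalSpace S] [ChartedSpace (EuclideanSpace ℝ (Fin m)) S]
  [IsManifold (𝓡 m) ∞ S]

theorem stD_mfderiv_stChart {p q : ℝ × S} (hq : q ∈ (stChart (m := m) p).source)
    (v : TangentSpace (stModel m) q) :
    stD p (stChart (m := m) p q) (mfderiv (stModel m) 𝓘(ℝ, ℝ × Eu m) (stChart (m := m) p) q v) = v := by
  have h1 : (stChart (m := m) p).symm ∘ stChart (m := m) p =ᶠ[𝓝 q] id := by
    filter_upwards [(isOpen_stChart_source p).mem_nhds hq] with x hx
    exact (stChart (m := m) p).left_inv hx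
  have h2 : MDifferentiableAt (stModel m) 𝓘(ℝ, ℝ × Eu m) (stChart (m := m) p) q :=
    ((contMDiffOn_stChart p).contMDiffAt
      ((isOpen_stChart_source p).mem_nhds hq)).mdifferentiableAt (by simp)
  have h3 := mfderiv_comp q (mdifferentiableAt_stChart_symm ((stChart (m := m) p).map_source hq)) h2
  rw [h1.mfderiv_eq, mfderiv_id] at h3
  exact (congrArg (fun L => L v) h3).symm

namespace SplitMetric

variable (𝓜 : SplitMetric m S)

theorem contDiffAt_gHat {p : ℝ × S} {z : ℝ × Eu m} (hz : z ∈ (stChart (m := m) p).target) :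
    ContDiffAt ℝ ∞ (𝓜.gHat p) z :=
  (𝓜.contDiffOn_gHat p).contDiffAt ((isOpen_stChart_target p).mem_nhds hz)

theorem fderiv_chartMetric {p : ℝ × S} {z : ℝ × Eu m} (hz : z ∈ (stChart (m := m) p).target)
    (a b c : ℝ × Eu m) :
    fderiv ℝ (fun y => 𝓜.chartMetric p y b c) z a = fderiv ℝ (𝓜.gHat p) z a b c := by
  have h1 : (fun y => 𝓜.chartMetric p y b c) =ᶠ[𝓝 z] fun y => 𝓜.gHat p y b c := by
    filter_upwards [(isOpen_stChart_target p).mem_nhds hz] with x hx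
    exact (𝓜.gHat_eq_chartMetric hx b c).symm
  have h2 : DifferentiableAt ℝ (𝓜.gHat p) z := (𝓜.contDiffAt_gHat hz).differentiableAt (by simp)
  rw [h1.fderiv_eq, fderiv_clm_apply (h2.clm_apply (differentiableAt_const b))
    (differentiableAt_const c), fderiv_clm_apply h2 (differentiableAt_const b)]
  simp

theorem christoffel_eq {p : ℝ × S} {z : ℝ × Eu m} (hz : z ∈ (stChart (m := m) p).target)
    (a b c : ℝ × Eu m) : 𝓜.christoffel p z a b c = christ (𝓜.gHat p) z a b c := by
  simp only [christoffel, christ, 𝓜.fderiv_chartMetric hz]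

end SplitMetric

variable [IsManifold (𝓡∂ m) ∞ N]

/-- The change of charts of the hypersurface. -/
def nTrans (c c' : N) (y : Eu m) : Eu m := nChart (m := m) c' ((nChart (m := m) c).symm y)

variable {c c' x : N} {p p' : ℝ × S} {F : N → ℝ × S} {y : Eu m}

theorem contDiffAt_nTrans (hx : x ∈ (nChart (m := m) c).source)
    (hx' : x ∈ (nChart (m := m) c').source) (hi : x ∈ (𝓡∂ m).interior N) :
    ContDiffAt ℝ ∞ (nTrans c c') (nChart (m := m) c x) := by
  have h1 : ContDiffOn ℝ ∞ (nTrans c c')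
      ((nChart (m := m) c).target ∩ (nChart (m := m) c).symm ⁻¹' (nChart (m := m) c').source) := by
    rw [← contMDiffOn_iff_contDiffOn]
    exact (contMDiffOn_nChart c').comp
      ((contMDiffOn_nChart_symm c).mono inter_subset_left) fun z hz => hz.2
  refine h1.contDiffAt ?_
  have hy := (nChart (m := m) c).map_source hx
  have h2 := nChart_target_mem_nhdsWithin hy
  have h3 := (continuousOn_nChart_symm c _ hy).mono_of_mem_nhdsWithin h2
  rw [(mem_interior_iff_mem_nhds.1 ((mem_interior_iff hx).1 hi)
    |> nhdsWithin_eq_nhds.2)] at h2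
  rw [continuousWithinAt_iff_continuousAt
    (mem_interior_iff_mem_nhds.1 ((mem_interior_iff hx).1 hi))] at h3
  refine inter_mem h2 (h3 ((isOpen_nChart_source c').mem_nhds ?_))
  rwa [(nChart (m := m) c).left_inv hx]

theorem nTrans_nChart (hx : x ∈ (nChart (m := m) c).source) :
    nTrans c c' (nChart (m := m) c x) = nChart (m := m) c' x := by
  rw [nTrans, (nChart (m := m) c).left_inv hx]

theorem eventually_nChart_symm_mem (hx : x ∈ (nChart (m := m) c).source)
    (hi : x ∈ (𝓡∂ m).interior N) {U : Set N} (hU : U ∈ 𝓝 x) :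
    ∀ᶠ y in 𝓝 (nChart (m := m) c x), y ∈ (nChart (m := m) c).target ∧ (nChart (m := m) c).symm y ∈ U := by
  have hy := (nChart (m := m) c).map_source hx
  have h2 := nChart_target_mem_nhdsWithin hy
  have h3 := (continuousOn_nChart_symm c _ hy).mono_of_mem_nhdsWithin h2
  rw [(mem_interior_iff_mem_nhds.1 ((mem_interior_iff hx).1 hi)
    |> nhdsWithin_eq_nhds.2)] at h2
  rw [continuousWithinAt_iff_continuousAt
    (mem_interior_iff_mem_nhds.1 ((mem_interior_iff hx).1 hi))] at h3
  refine inter_mem h2 (h3 ?_)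
  rwa [(nChart (m := m) c).left_inv hx]

theorem fderiv_nTrans_injective (hx : x ∈ (nChart (m := m) c).source)
    (hx' : x ∈ (nChart (m := m) c').source) (hi : x ∈ (𝓡∂ m).interior N) :
    Function.Injective (fderiv ℝ (nTrans c c') (nChart (m := m) c x)) := by
  have h1 : (fun y => nTrans c' c (nTrans c c' y)) =ᶠ[𝓝 (nChart (m := m) c x)] id := by
    filter_upwards [eventually_nChart_symm_mem hx hi ((isOpen_nChart_source c').mem_nhds hx')]
      with y hy
    rw [nTrans, nTrans, (nChart (m := m) c').left_inv hy.2, (nChart (m := m) c).right_inv hy.1]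
    rfl
  have h2 := (contDiffAt_nTrans hx' hx hi).differentiableAt (by simp)
  rw [← nTrans_nChart (c' := c') hx] at h2
  have h3 := fderiv_comp' (nChart (m := m) c x) h2
    ((contDiffAt_nTrans hx hx' hi).differentiableAt (by simp))
  rw [h1.fderiv_eq, fderiv_id] at h3
  intro v w hvw
  have := congrArg (fun L => L v) h3
  have h4 := congrArg (fun L => L w) h3
  simp only [ContinuousLinearMap.comp_apply, ContinuousLinearMap.id_apply] at this h4
  rw [this, h4, hvw]

theorem mem_nDom (hx : x ∈ (nChart (m := m) c).source)
    (hp : F x ∈ (stChart (m := m) p).source) : nChart (m := m) c x ∈ nDom c p F :=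
  ⟨(nChart (m := m) c).map_source hx, by rwa [mem_preimage, (nChart (m := m) c).left_inv hx]⟩

theorem nRep_nChart (hx : x ∈ (nChart (m := m) c).source) :
    nRep c p F (nChart (m := m) c x) = stChart (m := m) p (F x) := by
  rw [nRep, (nChart (m := m) c).left_inv hx]

namespace SplitMetric

variable (𝓜 : SplitMetric m S)

/-- Near the point, the second representation is the first one composed with a change of charts on
each side. The change in the target is handled by `fff_target` and `sff_target`, the one in the
source by `mcurv_source`; only the latter uses that `n` is normal. -/
theorem mcurv_change_charts (hF : ContMDiff (𝓡∂ m) (stModel m) ∞ F)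
    (hx : x ∈ (nChart (m := m) c).source) (hx' : x ∈ (nChart (m := m) c').source)
    (hi : x ∈ (𝓡∂ m).interior N) (hp : F x ∈ (stChart (m := m) p).source)
    (hp' : F x ∈ (stChart (m := m) p').source) {n n' : ℝ × Eu m}
    (hn : stD p (stChart (m := m) p (F x)) n = stD p' (stChart (m := m) p' (F x)) n')
    (hnn : ∀ v, 𝓜.gHat p (stChart (m := m) p (F x)) (fderiv ℝ (nRep c p F) (nChart (m := m) c x) v) n = 0) :
    mcurv (𝓜.gHat p') (nRep c' p' F) (nChart (m := m) c' x) n'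
      = mcurv (𝓜.gHat p) (nRep c p F) (nChart (m := m) c x) n := by
  set z := stChart (m := m) p (F x) with hz
  have hzt : z ∈ (stChart (m := m) p).target := (stChart (m := m) p).map_source hp
  have hzd : z ∈ stTransDom p p' := ⟨hzt, by rwa [mem_preimage, hz, (stChart (m := m) p).left_inv hp]⟩
  have hzz : stTrans p p' z = stChart (m := m) p' (F x) := by rw [stTrans, hz, (stChart (m := m) p).left_inv hp]
  have hΘ : ContDiffAt ℝ ∞ (stTrans p p') z :=
    (contDiffOn_stTrans p p').contDiffAt ((isOpen_stTransDom p p').mem_nhds hzd)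
  have hn' : n' = fderiv ℝ (stTrans p p') z n := by
    apply stD_injective ((stChart (m := m) p').map_source hp')
    rw [← hn, ← hzz, stD_stTrans hzd]
  have hi1 := (mem_interior_iff hx).1 hi
  have hr := contDiffAt_nRep hF (mem_nDom hx hp) hi1
  have hψx := nTrans_nChart (c' := c) hx'
  have hψ := contDiffAt_nTrans hx' hx hi
  have e1 : nRep c' p' F =ᶠ[𝓝 (nChart (m := m) c' x)]
      fun y => stTrans p p' (nRep c p F (nTrans c' c y)) := by
    filter_upwards [eventually_nChart_symm_mem hx' hi (inter_mem
      ((isOpen_nChart_source c).mem_nhds hx)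
      (hF.continuous.continuousAt ((isOpen_stChart_source p).mem_nhds hp)))] with y hy
    rw [stTrans, nRep, nRep, nTrans, (nChart (m := m) c).left_inv hy.2.1, (stChart (m := m) p).left_inv hy.2.2]
  have hr' : ContDiffAt ℝ ∞ (nRep c p F) (nTrans c' c (nChart (m := m) c' x)) := by rwa [hψx]
  have hf : ContDiffAt ℝ 2 (fun y => nRep c p F (nTrans c' c y)) (nChart (m := m) c' x) :=
    (hr'.comp _ hψ).of_le two_le_infty
  have hfx : nRep c p F (nTrans c' c (nChart (m := m) c' x)) = z := by rw [hψx, nRep_nChart hx]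
  have hB : ∀ᶠ w in 𝓝 z, ∀ a b, 𝓜.gHat p w a b = 𝓜.gHat p' (stTrans p p' w)
      (fderiv ℝ (stTrans p p') w a) (fderiv ℝ (stTrans p p') w b) := by
    filter_upwards [(isOpen_stTransDom p p').mem_nhds hzd] with w hw
    exact 𝓜.gHat_stTrans hw
  rw [mcurv_congr _ e1]
  have e2 : mcurv (𝓜.gHat p') (fun y => stTrans p p' (nRep c p F (nTrans c' c y))) (nChart (m := m) c' x) n'
      = mcurv (𝓜.gHat p) (fun y => nRep c p F (nTrans c' c y)) (nChart (m := m) c' x) n := by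
    have g := fff_target (B' := 𝓜.gHat p') (B := 𝓜.gHat p) (Θ := stTrans p p')
      (f := fun y => nRep c p F (nTrans c' c y)) (y := nChart (m := m) c' x)
      (by rw [hfx]; exact hΘ.differentiableAt (by simp)) (hf.differentiableAt (by simp))
      (by rw [hfx]; exact hB.self_of_nhds)
    have g2 := sff_target (B' := 𝓜.gHat p') (B := 𝓜.gHat p) (Θ := stTrans p p')
      (f := fun y => nRep c p F (nTrans c' c y)) (y := nChart (m := m) c' x)
      (by rw [hfx]; exact (𝓜.contDiffAt_gHat (stTrans_mem_target hzd)).differentiableAt (by simp))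
      (by rw [hfx]; exact (𝓜.contDiffAt_gHat hzt).differentiableAt (by simp))
      (by rw [hfx]; exact hΘ.of_le two_le_infty) hf
      (by rw [hfx]; exact hB) (fun a b => 𝓜.gHat_symm _ _ a b) n
    rw [hfx, ← hn'] at g2
    simp only [mcurv, gramF, g, g2]
  rw [e2]
  refine (mcurv_source (f := nRep c p F) (hr'.of_le two_le_infty)
    (hψ.of_le two_le_infty) (fderiv_nTrans_injective hx' hx hi) ?_).trans ?_
  · intro v
    rw [hfx, hψx]
    exact hnn v
  · rw [hψx]

/-- Matches the curvature of the statement, computed in the charts centred at `x` and `F x`, with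
the coordinate expression `mcurv`. -/
theorem meanCurvature_eq_self (hF : ContMDiff (𝓡∂ m) (stModel m) ∞ F)
    (hi : x ∈ (𝓡∂ m).interior N) (n : TangentSpace (stModel m) (F x)) :
    𝓜.meanCurvature F x n = mcurv (𝓜.gHat (F x)) (nRep x (F x) F) (nChart (m := m) x x)
      (mfderiv (stModel m) 𝓘(ℝ, ℝ × Eu m) (stChart (m := m) (F x)) (F x) n) := by
  have hx : x ∈ (nChart (m := m) x).source := mem_extChartAt_source x
  have hp : F x ∈ (stChart (m := m) (F x)).source := mem_extChartAt_source (F x)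
  have hz : stChart (m := m) (F x) (F x) ∈ (stChart (m := m) (F x)).target :=
    (stChart (m := m) (F x)).map_source hp
  have hr : ContDiffAt ℝ 2 (nRep x (F x) F) (nChart (m := m) x x) :=
    (contDiffAt_nRep hF (mem_nDom hx hp) ((mem_interior_iff hx).1 hi)).of_le
      two_le_infty
  have hd : DifferentiableAt ℝ (fderiv ℝ (nRep x (F x) F)) (nChart (m := m) x x) :=
    (hr.fderiv_right (m := 1) (by norm_num)).differentiableAt (by simp)
  have e1 : ∀ i j : Fin m, fderiv ℝ (fun y' => fderiv ℝ (nRep x (F x) F) y' (eb j)) (nChart (m := m) x x)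
      (eb i) = fderiv ℝ (fderiv ℝ (nRep x (F x) F)) (nChart (m := m) x x) (eb i) (eb j) := by
    intro i j
    rw [fderiv_clm_apply hd (differentiableAt_const _)]
    simp
  have e2 : 𝓜.inducedGram F x = gramF (𝓜.gHat (F x)) (nRep x (F x) F) (nChart (m := m) x x) := by
    ext i j
    have := 𝓜.gHat_eq_chartMetric hz (fderiv ℝ (nRep x (F x) F) (nChart (m := m) x x) (eb i))
      (fderiv ℝ (nRep x (F x) F) (nChart (m := m) x x) (eb j))
    rw [gramF, Matrix.of_apply, fff, nRep_nChart hx, this]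
    rfl
  have e3 : 𝓜.secondFF F x n = Matrix.of fun i j =>
      sff (𝓜.gHat (F x)) (nRep x (F x) F) (nChart (m := m) x x)
      (mfderiv (stModel m) 𝓘(ℝ, ℝ × Eu m) (stChart (m := m) (F x)) (F x) n) (eb i) (eb j) := by
    ext i j
    have h1 := 𝓜.gHat_eq_chartMetric hz
      (fderiv ℝ (fderiv ℝ (nRep x (F x) F)) (nChart (m := m) x x) (eb i) (eb j))
      (mfderiv (stModel m) 𝓘(ℝ, ℝ × Eu m) (stChart (m := m) (F x)) (F x) n)
    have h2 := 𝓜.christoffel_eq hz (fderiv ℝ (nRep x (F x) F) (nChart (m := m) x x) (eb i))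
      (fderiv ℝ (nRep x (F x) F) (nChart (m := m) x x) (eb j))
      (mfderiv (stModel m) 𝓘(ℝ, ℝ × Eu m) (stChart (m := m) (F x)) (F x) n)
    rw [← nRep_nChart (c := x) (p := F x) (F := F) hx] at h1 h2
    refine Eq.trans ?_ (congrArg₂ (fun a b => -(a + b)) h1 h2.symm).symm
    rw [nRep_nChart hx, ← e1]
    rfl
  simp only [meanCurvature]
  rw [e2, e3]
  rfl

theorem gbar_symm (p : ℝ × S) (v w : TangentSpace (stModel m) p) :
    𝓜.gbar p v w = 𝓜.gbar p w v := by
  rw [gbar, gbar, 𝓜.sig_symm p v w, mul_comm (dtau p v)]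

/-- The mean curvature can be computed in arbitrary charts. -/
theorem meanCurvature_eq (hF : ContMDiff (𝓡∂ m) (stModel m) ∞ F)
    (hx : x ∈ (nChart (m := m) c).source) (hi : x ∈ (𝓡∂ m).interior N)
    (hp : F x ∈ (stChart (m := m) p).source) {n : ℝ × Eu m}
    {n' : TangentSpace (stModel m) (F x)} (hnn : stD p (stChart (m := m) p (F x)) n = n')
    (hn : ∀ v, 𝓜.gbar (F x) n' (dMap F x v) = 0) :
    𝓜.meanCurvature F x n' = mcurv (𝓜.gHat p) (nRep c p F) (nChart (m := m) c x) n := by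
  rw [𝓜.meanCurvature_eq_self hF hi]
  have hx' : x ∈ (nChart (m := m) x).source := mem_extChartAt_source x
  have hp' : F x ∈ (stChart (m := m) (F x)).source := mem_extChartAt_source (F x)
  refine 𝓜.mcurv_change_charts hF hx hx' hi hp hp'
    (hnn.trans (stD_mfderiv_stChart hp' n').symm) ?_
  intro v
  have hy := mem_nDom (F := F) hx hp
  have h1 := dMap_nD hF hy v
  rw [fderivWithin_eq_fderiv_of_interior _ ((mem_interior_iff hx).1 hi), nRep_nChart hx] at h1
  have h2 := 𝓜.gHat_eq ((stChart (m := m) p).map_source hp)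
    (fderiv ℝ (nRep c p F) (nChart (m := m) c x) v) n
  refine h2.trans ?_
  rw [← h1, hnn]
  have key : ∀ x' : N, x' = x → ∀ q : ℝ × S, q = F x → ∀ w : Eu m,
      𝓜.gbar q (dMap F x' w) n' = 0 := by
    rintro _ rfl _ rfl w
    exact (𝓜.gbar_symm _ _ _).trans (hn w)
  exact key _ ((nChart (m := m) c).left_inv hx) _ ((stChart (m := m) p).left_inv hp) _

end SplitMetric

end MeanCurvatureCharts

/-! ### The Riemannian distance -/

section Distance

variable {m : ℕ} {H : Type*} [TopologicalSpace H]
  {I : ModelWithCorners ℝ (EuclideanSpace ℝ (Fin m)) H}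
  {M : Type*} [TopologicalSpace M] [ChartedSpace H M]
  {σ : ∀ x : M, TangentSpace I x → TangentSpace I x → ℝ}

/-- The quadratic form of `σ` is homogeneous of degree two. -/
def IsHomogeneous (σ : ∀ x : M, TangentSpace I x → TangentSpace I x → ℝ) : Prop :=
  ∀ x (c : ℝ) (v : TangentSpace I x), σ x (c • v) (c • v) = c ^ 2 * σ x v v

/-- Homogeneity makes the length independent of the parametrization; symmetry and the triangle
inequality for the distance rest on it. -/
theorem IsHomogeneous.enorm_smul (hσ : IsHomogeneous σ) (x : M) (c : ℝ) (v : TangentSpace I x) :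
    ENNReal.ofReal √(σ x (c • v) (c • v)) = ‖c‖ₑ * ENNReal.ofReal √(σ x v v) := by
  rw [hσ, Real.sqrt_mul (sq_nonneg c), Real.sqrt_sq_eq_abs, ENNReal.ofReal_mul (abs_nonneg c),
    Real.enorm_eq_ofReal_abs]

theorem metricEDist_comm [IsManifold I 1 M] (hσ : IsHomogeneous σ) (x y : M) :
    metricEDist I σ x y = metricEDist I σ y x := by
  letI : ∀ z : M, ENorm (TangentSpace I z) := fun z => ⟨fun v => ENNReal.ofReal √(σ z v v)⟩
  haveI : ∀ z : M, ENormSMulClass ℝ (TangentSpace I z) := fun z => ⟨fun c v => hσ.enorm_smul z c v⟩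
  exact Manifold.riemannianEDist_comm (I := I) (x := x) (y := y)

theorem metricEDist_triangle [IsManifold I 1 M] (hσ : IsHomogeneous σ) (x y z : M) :
    metricEDist I σ x z ≤ metricEDist I σ x y + metricEDist I σ y z := by
  letI : ∀ z : M, ENorm (TangentSpace I z) := fun z => ⟨fun v => ENNReal.ofReal √(σ z v v)⟩
  haveI : ∀ z : M, ENormSMulClass ℝ (TangentSpace I z) := fun z => ⟨fun c v => hσ.enorm_smul z c v⟩
  exact Manifold.riemannianEDist_triangle (I := I) (x := x) (y := y) (z := z)

theorem metricEDist_le_lintegral [IsManifold I 1 M] (hσ : IsHomogeneous σ) {γ : ℝ → M} (hγ : ContMDiffOn 𝓘(ℝ, ℝ) I 1 γ (Icc 0 1)) :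
    metricEDist I σ (γ 0) (γ 1) ≤ ∫⁻ t in Icc (0 : ℝ) 1, ENNReal.ofReal
      √(σ (γ t) (mfderivWithin 𝓘(ℝ, ℝ) I γ (Icc 0 1) t (1 : ℝ))
        (mfderivWithin 𝓘(ℝ, ℝ) I γ (Icc 0 1) t (1 : ℝ))) := by
  letI : ∀ z : M, ENorm (TangentSpace I z) := fun z => ⟨fun v => ENNReal.ofReal √(σ z v v)⟩
  haveI : ∀ z : M, ENormSMulClass ℝ (TangentSpace I z) := fun z => ⟨fun c v => hσ.enorm_smul z c v⟩
  exact (Manifold.riemannianEDist_le_pathELength hγ rfl rfl zero_le_one).trans_eq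
    Manifold.pathELength_eq_lintegral_mfderivWithin_Icc

theorem exists_lt_of_metricEDist_lt [IsManifold I 1 M] (hσ : IsHomogeneous σ) {x y : M} {r : ℝ≥0∞} (h : metricEDist I σ x y < r) :
    ∃ γ : ℝ → M, γ 0 = x ∧ γ 1 = y ∧ ContMDiffOn 𝓘(ℝ, ℝ) I 1 γ (Icc 0 1) ∧
      ∫⁻ t in Icc (0 : ℝ) 1, ENNReal.ofReal
      √(σ (γ t) (mfderivWithin 𝓘(ℝ, ℝ) I γ (Icc 0 1) t (1 : ℝ))
        (mfderivWithin 𝓘(ℝ, ℝ) I γ (Icc 0 1) t (1 : ℝ))) < r := by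
  letI : ∀ z : M, ENorm (TangentSpace I z) := fun z => ⟨fun v => ENNReal.ofReal √(σ z v v)⟩
  haveI : ∀ z : M, ENormSMulClass ℝ (TangentSpace I z) := fun z => ⟨fun c v => hσ.enorm_smul z c v⟩
  obtain ⟨γ, h0, h1, h2, h3⟩ := Manifold.exists_lt_of_riemannianEDist_lt (I := I) h
  rw [Manifold.pathELength_eq_lintegral_mfderivWithin_Icc] at h3
  exact ⟨γ, h0, h1, h2, h3⟩

end Distance

/-! ### Riemannian distance and chart coordinates -/

section ChartDistance

variable {m : ℕ} [NeZero m] {N : Type*} [TopologicalSpace N] [ChartedSpace (EuclideanHalfSpace m) N]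
  [IsManifold (𝓡∂ m) ∞ N]
  {σ : ∀ x : N, TangentSpace (𝓡∂ m) x → TangentSpace (𝓡∂ m) x → ℝ}

/-- A function whose differential is bounded by `K` is `K`-Lipschitz. -/
theorem abs_sub_le_metricEDist [IsManifold (𝓡∂ m) 1 N] (hσ : IsHomogeneous σ) {f : N → ℝ} (hf : ContMDiff (𝓡∂ m) 𝓘(ℝ, ℝ) 1 f) {K : ℝ}
    (h : ∀ x (v : TangentSpace (𝓡∂ m) x), |dFun f x v| ≤ K * √(σ x v v)) (x y : N)
    {r : ℝ≥0∞} (hr : metricEDist (𝓡∂ m) σ x y < r) :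
    ENNReal.ofReal |f y - f x| ≤ ENNReal.ofReal K * r := by
  obtain ⟨γ, h0, h1, h2, h3⟩ := exists_lt_of_metricEDist_lt hσ hr
  have hd : ContDiffOn ℝ 1 (f ∘ γ) (Icc 0 1) := by
    rw [← contMDiffOn_iff_contDiffOn]
    exact hf.comp_contMDiffOn h2
  have h4 := enorm_sub_le_lintegral_derivWithin_Icc_of_contDiffOn_Icc hd zero_le_one
  rw [← Real.enorm_eq_ofReal_abs, ← h0, ← h1]
  refine h4.trans (le_trans ?_ (mul_le_mul_right h3.le _))
  rw [← lintegral_const_mul' _ _ ENNReal.ofReal_ne_top]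
  refine setLIntegral_mono' measurableSet_Icc fun t ht => ?_
  have e := mfderiv_comp_mfderivWithin t ((hf (γ t)).mdifferentiableAt (by simp))
    ((h2 t ht).mdifferentiableWithinAt (by simp))
    ((uniqueDiffOn_Icc zero_lt_one t ht).uniqueMDiffWithinAt)
  rw [mfderivWithin_eq_fderivWithin] at e
  have e2 : derivWithin (f ∘ γ) (Icc 0 1) t = dFun f (γ t)
      (mfderivWithin 𝓘(ℝ, ℝ) (𝓡∂ m) γ (Icc 0 1) t (1 : ℝ)) :=
    congrArg (fun L => L (1 : ℝ)) e
  rw [e2, Real.enorm_eq_ofReal_abs]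
  rw [← ENNReal.ofReal_mul' (Real.sqrt_nonneg _)]
  exact ENNReal.ofReal_le_ofReal (h _ _)

theorem convex_range : Convex ℝ (range (𝓡∂ m)) := (𝓡∂ m).convex_range

/-- The distance is bounded by the length of segments in a chart. -/
theorem metricEDist_le_of_segment [IsManifold (𝓡∂ m) 1 N] (hσ : IsHomogeneous σ) {c : N} {y y' : Eu m} {L : ℝ}
    (hs : segment ℝ y y' ⊆ (nChart (m := m) c).target)
    (h : ∀ z ∈ segment ℝ y y', ∀ v,
      √(σ ((nChart c).symm z) (nD c z v) (nD c z v)) ≤ L * ‖v‖) :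
    metricEDist (𝓡∂ m) σ ((nChart c).symm y) ((nChart c).symm y')
      ≤ ENNReal.ofReal (L * ‖y' - y‖) := by
  set l : ℝ → Eu m := fun t => y + t • (y' - y) with hl
  have hl' : ∀ t ∈ Icc (0 : ℝ) 1, l t ∈ segment ℝ y y' := by
    intro t ht
    rw [segment_eq_image']
    exact ⟨t, ht, rfl⟩
  have hld : ContDiff ℝ ∞ l := by
    simp only [hl]
    fun_prop
  have hlm : ContMDiffOn 𝓘(ℝ, ℝ) 𝓘(ℝ, Eu m) 1 l (Icc 0 1) :=
    ((hld.of_le (by simp)).contMDiff).contMDiffOn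
  have hlder : ∀ t, HasDerivAt l (y' - y) t := fun t => by
    have := ((hasDerivAt_id t).smul_const (y' - y)).const_add y
    rwa [one_smul] at this
  have hγ : ContMDiffOn 𝓘(ℝ, ℝ) (𝓡∂ m) 1 ((nChart (m := m) c).symm ∘ l) (Icc 0 1) :=
    ((contMDiffOn_nChart_symm c).of_le (by simp)).comp hlm fun t ht => hs (hl' t ht)
  have h1 := metricEDist_le_lintegral hσ hγ
  have e0 : l 0 = y := by simp [hl]
  have e1 : l 1 = y' := by simp [hl]
  rw [Function.comp_apply, Function.comp_apply, e0, e1] at h1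
  refine h1.trans ?_
  have h2 : ∀ t ∈ Icc (0 : ℝ) 1,
      mfderivWithin 𝓘(ℝ, ℝ) (𝓡∂ m) ((nChart (m := m) c).symm ∘ l) (Icc 0 1) t (1 : ℝ)
        = nD c (l t) (y' - y) := by
    intro t ht
    have e := mfderivWithin_comp t (mdifferentiableWithinAt_nChart_symm (hs (hl' t ht)))
      ((hlm t ht).mdifferentiableWithinAt (by simp))
      (fun t ht => nChart_target_subset_range c (hs (hl' t ht)))
      ((uniqueDiffOn_Icc zero_lt_one t ht).uniqueMDiffWithinAt)
    rw [mfderivWithin_eq_fderivWithin] at e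
    have e2 := congrArg (fun L => L (1 : ℝ)) e
    refine e2.trans ?_
    have e3 : fderivWithin ℝ l (Icc 0 1) t 1 = y' - y :=
      (hlder t).hasDerivWithinAt.derivWithin (uniqueDiffOn_Icc zero_lt_one t ht)
    exact congrArg (nD c (l t)) e3
  refine (setLIntegral_mono' (g := fun _ => ENNReal.ofReal (L * ‖y' - y‖)) measurableSet_Icc
    fun t ht => ?_).trans (by simp)
  rw [h2 t ht]
  exact ENNReal.ofReal_le_ofReal (h _ (hl' t ht) _)

/-- Points at a small distance have close coordinates. -/
theorem mem_ball_of_metricEDist_lt [IsManifold (𝓡∂ m) 1 N] [T2Space N] (hσ : IsHomogeneous σ)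
    {c x : N} (hx : x ∈ (nChart (m := m) c).source)
    {R L : ℝ} (hR : 0 < R) (hL : 0 < L)
    (hs : Metric.closedBall (nChart (m := m) c x) R ∩ range (𝓡∂ m) ⊆ (nChart c).target)
    (h : ∀ y ∈ Metric.closedBall (nChart (m := m) c x) R ∩ range (𝓡∂ m), ∀ v,
      ‖v‖ ≤ L * √(σ ((nChart c).symm y) (nD c y v) (nD c y v)))
    {z : N} (hz : metricEDist (𝓡∂ m) σ x z < ENNReal.ofReal (R / (4 * L))) :
    z ∈ (nChart (m := m) c).source ∧ ‖nChart (m := m) c z - nChart (m := m) c x‖ < R := by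
  classical
  set y0 := nChart (m := m) c x with hy0
  -- A coordinate cutoff around `x`, extended by zero. It is `4L/R`-Lipschitz for the distance of
  -- `σ`, equals `1` at `x`, and vanishes wherever the conclusion fails; such points are therefore
  -- at distance at least `R/(4L)`.
  set f : N → ℝ := fun z => if z ∈ (nChart (m := m) c).source then
    cutoff y0 R (nChart (m := m) c z) else 0 with hf
  set K : Set N := (nChart (m := m) c).symm '' (Metric.closedBall y0 R ∩ range (𝓡∂ m)) with hK
  -- Compactness of the closed half ball and the Hausdorff property make its image closed in `N`, so
  -- the extension by zero is of class `C^1`.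
  have hKc : IsClosed K := by
    refine IsCompact.isClosed (IsCompact.image_of_continuousOn ?_
      ((continuousOn_nChart_symm c).mono hs))
    exact (isCompact_closedBall y0 R).inter_right (𝓡∂ m).isClosed_range
  have hKs : K ⊆ (nChart (m := m) c).source := by
    rintro _ ⟨y, hy, rfl⟩
    exact (nChart c).map_target (hs hy)
  have hf0 : ∀ w, w ∉ K → f w = 0 := by
    intro w hw
    rw [hf]
    dsimp only
    split_ifs with hws
    · refine cutoff_eq_zero hR (not_lt.1 fun hlt => hw ⟨nChart c w, ⟨?_, ?_⟩, ?_⟩)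
      · rw [Metric.mem_closedBall, dist_eq_norm]
        exact hlt.le
      · exact nChart_target_subset_range c ((nChart c).map_source hws)
      · exact (nChart c).left_inv hws
    · rfl
  have hf1 : ∀ w, w ∉ K → f =ᶠ[𝓝 w] fun _ => 0 := fun w hw => by
    filter_upwards [hKc.isOpen_compl.mem_nhds hw] with w' hw'
    exact hf0 w' hw'
  have hfs : ∀ w ∈ (nChart (m := m) c).source,
      f =ᶠ[𝓝 w] fun z => cutoff y0 R (nChart (m := m) c z) := fun w hw => by
    filter_upwards [(isOpen_nChart_source c).mem_nhds hw] with w' hw'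
    simp only [hf, hw', if_true]
  have hfd : ContMDiff (𝓡∂ m) 𝓘(ℝ, ℝ) 1 f := by
    intro w
    by_cases hw : w ∈ K
    · refine ContMDiffAt.congr_of_eventuallyEq ?_ (hfs w (hKs hw))
      exact (contDiff_cutoff y0 R).contMDiff.contMDiffAt.comp w
        (((contMDiffOn_nChart c).contMDiffAt
          ((isOpen_nChart_source c).mem_nhds (hKs hw))).of_le (by simp))
    · exact contMDiffAt_const.congr_of_eventuallyEq (hf1 w hw)
  have hbd : ∀ w (v : TangentSpace (𝓡∂ m) w),
      |dFun f w v| ≤ 4 / R * L * √(σ w v v) := by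
    intro w v
    by_cases hw : w ∈ K
    · obtain ⟨y, hy, rfl⟩ := hw
      obtain ⟨a, rfl⟩ := nD_surjective (hs hy) v
      have e1 := dFun_nD (hs hy) ((hfd _).mdifferentiableAt (by simp)) a
      have e2 : (fun y => f ((nChart (m := m) c).symm y)) =ᶠ[𝓝[range (𝓡∂ m)] y]
          cutoff y0 R := by
        filter_upwards [nChart_target_mem_nhdsWithin (hs hy)] with y' hy'
        simp only [hf, (nChart c).map_target hy', if_true]
        rw [(nChart c).right_inv hy']
      have e3 := e2.fderivWithin_eq (𝕜 := ℝ) (e2.self_of_nhdsWithin hy.2)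
      rw [fderivWithin_eq_fderiv (uniqueDiffWithinAt_range (hs hy))
        ((contDiff_cutoff y0 R).differentiable (by simp) y)] at e3
      rw [e3] at e1
      refine (congrArg abs e1).trans_le ?_
      refine ((fderiv ℝ (cutoff y0 R) y).le_opNorm a).trans ?_
      rw [mul_assoc]
      exact mul_le_mul (norm_fderiv_cutoff_le hR y) (h y hy a) (norm_nonneg _) (by positivity)
    · have e : mfderiv (𝓡∂ m) 𝓘(ℝ, ℝ) f w = 0 := by
        rw [(hf1 w hw).mfderiv_eq]
        exact mfderiv_const
      have e2 : dFun f w v = 0 := congrArg (fun L => L v) e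
      rw [e2, abs_zero]
      positivity
  have hfx : f x = 1 := by
    simp only [hf, hx, if_true]
    exact cutoff_self y0 R
  by_contra hcon
  have hfz : f z = 0 := by
    simp only [hf]
    split_ifs with hzs
    · exact cutoff_eq_zero hR (not_lt.1 fun hlt => hcon ⟨hzs, hlt⟩)
    · rfl
  -- The Lipschitz bound is available for every `r` above the distance; one strictly below `R/(4L)`
  -- gives `1 ≤ (4L/R) r < 1`.
  obtain ⟨r, hr1, hr2⟩ := exists_between hz
  have hr3 : r ≠ ⊤ := (hr2.trans ENNReal.ofReal_lt_top).ne
  have := abs_sub_le_metricEDist hσ hfd hbd x z hr1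
  rw [hfx, hfz, ← ENNReal.ofReal_toReal hr3, ← ENNReal.ofReal_mul (by positivity)] at this
  rw [← ENNReal.ofReal_toReal hr3, ENNReal.ofReal_lt_ofReal_iff (by positivity)] at hr2
  have h5 : (1 : ℝ) ≤ 4 / R * L * r.toReal := by
    rw [zero_sub, abs_neg, abs_one, ENNReal.ofReal_le_ofReal_iff (by positivity)] at this
    exact this
  have h6 : 4 / R * L * r.toReal < 4 / R * L * (R / (4 * L)) := by gcongr
  have h7 : 4 / R * L * (R / (4 * L)) = 1 := by field_simp
  linarith

end ChartDistance

/-! ### The Riemannian volume -/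

theorem det_linMat {m : ℕ} (A : Eu m →L[ℝ] Eu m) : (linMat A).det = A.det := by
  have h : linMat A = LinearMap.toMatrix (EuclideanSpace.basisFun (Fin m) ℝ).toBasis
      (EuclideanSpace.basisFun (Fin m) ℝ).toBasis A.toLinearMap := by
    ext i j
    simp [linMat, LinearMap.toMatrix_apply, eb]
  rw [h, LinearMap.det_toMatrix]

section Volume

variable {m : ℕ} [NeZero m] {N : Type*} [TopologicalSpace N] [ChartedSpace (EuclideanHalfSpace m) N]
  {σ : ∀ x : N, TangentSpace (𝓡∂ m) x → TangentSpace (𝓡∂ m) x → ℝ}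

/-- The tensor `σ` is bilinear, and continuous in the charts. -/
structure IsContMetric (σ : ∀ x : N, TangentSpace (𝓡∂ m) x → TangentSpace (𝓡∂ m) x → ℝ) : Prop where
  bilin : ∀ x, ∃ L : TangentSpace (𝓡∂ m) x →ₗ[ℝ] TangentSpace (𝓡∂ m) x →ₗ[ℝ] ℝ,
    ∀ v w, σ x v w = L v w
  cont : ∀ c : N, ContinuousOn (chartGram (𝓡∂ m) σ c) (nChart c).target

theorem IsContMetric.isHomogeneous (hσ : IsContMetric σ) : IsHomogeneous σ := by
  intro x c v
  obtain ⟨L, hL⟩ := hσ.bilin x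
  rw [hL, hL]
  simp
  ring

/-- The density of the Riemannian volume in a chart. -/
def volDensity (σ : ∀ x : N, TangentSpace (𝓡∂ m) x → TangentSpace (𝓡∂ m) x → ℝ) (c : N)
    (y : Eu m) : ℝ := √((chartGram (𝓡∂ m) σ c y).det)

theorem volDensity_nonneg (c : N) (y : Eu m) : 0 ≤ volDensity σ c y := Real.sqrt_nonneg _

theorem IsContMetric.continuousOn_volDensity (hσ : IsContMetric σ) (c : N) :
    ContinuousOn (volDensity σ c) (nChart c).target :=
  (Continuous.matrix_det continuous_id).comp_continuousOn (hσ.cont c) |>.sqrt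

theorem measurableSet_nChart_target (c : N) : MeasurableSet (nChart (m := m) c).target := by
  rw [nChart, extChartAt_target]
  refine MeasurableSet.inter ?_ (𝓡∂ m).isClosed_range.measurableSet
  exact ((chartAt _ c).open_target.preimage (𝓡∂ m).continuous_symm).measurableSet

theorem ContinuousOn.measurableSet_inter_preimage {X Y : Type*} [TopologicalSpace X]
    [MeasurableSpace X] [BorelSpace X] [TopologicalSpace Y] [MeasurableSpace Y] [BorelSpace Y]
    {f : X → Y} {s : Set X} (hs : MeasurableSet s) (hf : ContinuousOn f s) {t : Set Y}
    (ht : MeasurableSet t) : MeasurableSet (s ∩ f ⁻¹' t) := by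
  have h1 : Measurable (s.domRestrict f) := (continuousOn_iff_continuous_domRestrict.1 hf).measurable
  have h2 := hs.subtype_image (h1 ht)
  convert h2 using 1
  ext x
  simp only [mem_inter_iff, mem_preimage, mem_image, Subtype.exists, exists_and_right,
    exists_eq_right]
  exact ⟨fun h => ⟨h.1, h.2⟩, fun ⟨h, h'⟩ => ⟨h, h'⟩⟩

variable [IsManifold (𝓡∂ m) ∞ N] [MeasurableSpace N] [BorelSpace N]

theorem aemeasurable_nChart_symm (c : N) :
    AEMeasurable (nChart (m := m) c).symm (volume.restrict (nChart c).target) :=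
  (continuousOn_nChart_symm c).aemeasurable (measurableSet_nChart_target c)

theorem chartVolume_apply (c : N) {A : Set N} (hA : MeasurableSet A) :
    chartVolume (𝓡∂ m) σ c A = ∫⁻ y in (nChart c).target ∩ (nChart (m := m) c).symm ⁻¹' A,
      ENNReal.ofReal (volDensity σ c y) := by
  have h1 : AEMeasurable (nChart (m := m) c).symm ((volume.restrict (nChart c).target).withDensity
      fun y => ENNReal.ofReal (volDensity σ c y)) :=
    (aemeasurable_nChart_symm c).mono_ac (withDensity_absolutelyContinuous _ _)
  refine (Measure.map_apply_of_aemeasurable h1 hA).trans ?_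
  rw [withDensity_apply', Measure.restrict_restrict' (measurableSet_nChart_target c), inter_comm]

theorem fderivWithin_nTrans {c c' : N} {y : Eu m} (hy : y ∈ (nChart (m := m) c').target)
    (hs : (nChart c').symm y ∈ (nChart (m := m) c).source) :
    HasFDerivWithinAt (nTrans c' c) (fderivWithin ℝ (nTrans c' c) (range (𝓡∂ m)) y)
      (range (𝓡∂ m)) y ∧
    ∀ v, nD c' y v = nD c (nTrans c' c y) (fderivWithin ℝ (nTrans c' c) (range (𝓡∂ m)) y v) := by
  have h0 := nChart_target_mem_nhdsWithin hy
  have hcw := (continuousOn_nChart_symm c' y hy).mono_of_mem_nhdsWithin h0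
  have h1 : ∀ᶠ z in 𝓝[range (𝓡∂ m)] y, (nChart c').symm z ∈ (nChart (m := m) c).source :=
    hcw ((isOpen_nChart_source c).mem_nhds hs)
  have hd : DifferentiableWithinAt ℝ (nTrans c' c) (range (𝓡∂ m)) y := by
    have h2 : ContMDiffWithinAt 𝓘(ℝ, Eu m) 𝓘(ℝ, Eu m) ∞ (nTrans c' c)
        (range (𝓡∂ m)) y :=
      ((contMDiffOn_nChart c).contMDiffAt ((isOpen_nChart_source c).mem_nhds
        hs)).comp_contMDiffWithinAt y ((contMDiffOn_nChart_symm c' y hy).mono_of_mem_nhdsWithin h0)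
    exact (contMDiffWithinAt_iff_contDiffWithinAt.1 h2).differentiableWithinAt (by simp)
  refine ⟨hd.hasFDerivWithinAt, fun v => ?_⟩
  have ht : nTrans c' c y ∈ (nChart (m := m) c).target := (nChart c).map_source hs
  have e := mfderivWithin_comp_of_preimage_mem_nhdsWithin (I := 𝓘(ℝ, Eu m)) (I' := 𝓘(ℝ, Eu m))
    (I'' := 𝓡∂ m) (x := y) (s := range (𝓡∂ m)) (u := range (𝓡∂ m)) (f := nTrans c' c)
    (g := (nChart (m := m) c).symm)
    (mdifferentiableWithinAt_nChart_symm ht) hd.mdifferentiableWithinAt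
    (by
      filter_upwards [h1] with z hz
      exact nChart_target_subset_range c ((nChart c).map_source hz))
    ((uniqueDiffWithinAt_range hy).uniqueMDiffWithinAt)
  have h3 : (nChart (m := m) c).symm ∘ nTrans c' c =ᶠ[𝓝[range (𝓡∂ m)] y]
      (nChart (m := m) c').symm := by
    filter_upwards [h1] with z hz
    exact (nChart c).left_inv hz
  rw [h3.mfderivWithin_eq (I := 𝓘(ℝ, Eu m)) (I' := 𝓡∂ m)
    (h3.self_of_nhdsWithin (nChart_target_subset_range c' hy)),
    mfderivWithin_eq_fderivWithin] at e
  exact congrArg (fun L => L v) e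

/-- The Gram matrix becomes `AᵀGA` with `A` the differential of the change of charts, so the root of
its determinant picks up `|det A|`. -/
theorem volDensity_nTrans (hσ : IsContMetric σ) {c c' : N} {y : Eu m}
    (hy : y ∈ (nChart (m := m) c').target)
    (hs : (nChart c').symm y ∈ (nChart (m := m) c).source) :
    volDensity σ c' y = |(fderivWithin ℝ (nTrans c' c) (range (𝓡∂ m)) y).det|
      * volDensity σ c (nTrans c' c y) := by
  set A := fderivWithin ℝ (nTrans c' c) (range (𝓡∂ m)) y with hA
  have hx : (nChart (m := m) c).symm (nTrans c' c y) = (nChart (m := m) c').symm y :=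
    (nChart c).left_inv hs
  obtain ⟨L, hL⟩ := hσ.bilin ((nChart (m := m) c).symm (nTrans c' c y))
  set L' : Eu m →ₗ[ℝ] Eu m →ₗ[ℝ] ℝ :=
    (show Eu m →ₗ[ℝ] Eu m →ₗ[ℝ] ℝ from L).compl₁₂ (nD c (nTrans c' c y)).toLinearMap
      (nD c (nTrans c' c y)).toLinearMap with hL'
  have h1 := bilin_linMat (fun v w => L' v w) L' (fun _ _ => rfl) A
  have h2 : chartGram (𝓡∂ m) σ c (nTrans c' c y) = Matrix.of fun i j => L' (eb i) (eb j) := by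
    ext i j
    exact hL _ _
  have h3 : chartGram (𝓡∂ m) σ c' y = Matrix.of fun i j => L' (A (eb i)) (A (eb j)) := by
    ext i j
    have key : ∀ x' : N, x' = (nChart (m := m) c).symm (nTrans c' c y) → ∀ v w : Eu m,
        σ x' v w = (show Eu m →ₗ[ℝ] Eu m →ₗ[ℝ] ℝ from L) v w := by
      rintro _ rfl v w
      exact hL v w
    refine (key _ hx.symm (nD c' y (eb i)) (nD c' y (eb j))).trans ?_
    rw [(fderivWithin_nTrans hy hs).2, (fderivWithin_nTrans hy hs).2]
    rfl
  rw [volDensity, volDensity, h3, h1, ← h2, Matrix.det_mul, Matrix.det_mul,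
    Matrix.det_transpose, det_linMat]
  rw [show A.det * (chartGram (𝓡∂ m) σ c (nTrans c' c y)).det * A.det
    = A.det ^ 2 * (chartGram (𝓡∂ m) σ c (nTrans c' c y)).det by ring,
    Real.sqrt_mul (sq_nonneg _), Real.sqrt_sq_eq_abs]

/-- Change of variables on the overlap of the charts. The formula needs derivatives only within the
domain of integration, so boundary points need no special treatment. -/
theorem chartVolume_restrict_le (hσ : IsContMetric σ) (c c' : N) :
    (chartVolume (𝓡∂ m) σ c').restrict (nChart (m := m) c).source ≤ chartVolume (𝓡∂ m) σ c := by
  refine Measure.le_iff.2 fun A hA => ?_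
  have hso := (isOpen_nChart_source (m := m) c).measurableSet
  rw [Measure.restrict_apply hA, chartVolume_apply c' (hA.inter hso), chartVolume_apply c hA]
  set E := (nChart c').target ∩ (nChart (m := m) c').symm ⁻¹' (A ∩ (nChart (m := m) c).source)
    with hE
  have hEm : MeasurableSet E := ContinuousOn.measurableSet_inter_preimage
    (measurableSet_nChart_target c') (continuousOn_nChart_symm c') (hA.inter hso)
  have hinj : InjOn (nTrans (m := m) c' c) E := by
    intro y hy y' hy' h
    have h1 := (nChart (m := m) c).injOn hy.2.2 hy'.2.2 h
    exact (nChart (m := m) c').symm.injOn hy.1 hy'.1 h1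
  have h1 := lintegral_image_eq_lintegral_abs_det_fderiv_mul volume hEm
    (fun y hy => (fderivWithin_nTrans hy.1 hy.2.2).1.mono fun z hz =>
      nChart_target_subset_range c' hz.1) hinj (fun y => ENNReal.ofReal (volDensity σ c y))
  have h2 : ∫⁻ y in E, ENNReal.ofReal (volDensity σ c' y) =
      ∫⁻ y in E, ENNReal.ofReal |(fderivWithin ℝ (nTrans c' c) (range (𝓡∂ m)) y).det|
        * ENNReal.ofReal (volDensity σ c (nTrans c' c y)) := by
    refine setLIntegral_congr_fun hEm fun y hy => ?_
    rw [← ENNReal.ofReal_mul (abs_nonneg _), ← volDensity_nTrans hσ hy.1 hy.2.2]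
  rw [h2, ← h1]
  refine lintegral_mono_set ?_
  rintro _ ⟨y, hy, rfl⟩
  refine ⟨(nChart c).map_source hy.2.2, ?_⟩
  rw [mem_preimage, nTrans, (nChart c).left_inv hy.2.2]
  exact hy.2.1

/-- Every chart measure is at most the measure of the chart `c` plus the part of the supremum
outside the domain of `c`. Hence so is the supremum, and restricting to this domain removes the
second summand. The converse holds because the chart measure is carried by its domain. -/
theorem riemannianVolume_restrict (hσ : IsContMetric σ) (c : N) :
    (riemannianVolume (𝓡∂ m) σ).restrict (nChart (m := m) c).source
      = chartVolume (𝓡∂ m) σ c := by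
  have hso := (isOpen_nChart_source (m := m) c).measurableSet
  set V := riemannianVolume (𝓡∂ m) σ with hV
  have hle : ∀ c', chartVolume (𝓡∂ m) σ c' ≤ V := fun c' => le_iSup (chartVolume (𝓡∂ m) σ) c'
  apply le_antisymm
  · have h1 : V ≤ chartVolume (𝓡∂ m) σ c + V.restrict (nChart (m := m) c).sourceᶜ := by
      refine iSup_le fun c' => ?_
      rw [← Measure.restrict_add_restrict_compl (μ := chartVolume (𝓡∂ m) σ c') hso]
      exact add_le_add (chartVolume_restrict_le hσ c c') (Measure.restrict_mono le_rfl (hle c'))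
    refine (Measure.restrict_mono le_rfl h1).trans ?_
    rw [Measure.restrict_add, Measure.restrict_restrict hso, inter_compl_self,
      Measure.restrict_empty, add_zero]
    exact Measure.restrict_le_self
  · have h2 : (chartVolume (𝓡∂ m) σ c).restrict (nChart (m := m) c).source
        = chartVolume (𝓡∂ m) σ c := by
      refine Measure.restrict_eq_self_of_ae_mem ?_
      rw [ae_iff]
      have : {a | a ∉ (nChart (m := m) c).source} = (nChart (m := m) c).sourceᶜ := rfl
      rw [this, chartVolume_apply c hso.compl]
      have e : (nChart (m := m) c).target ∩ (nChart c).symm ⁻¹' (nChart (m := m) c).sourceᶜ = ∅ := by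
        ext y
        simp only [mem_inter_iff, mem_preimage, mem_compl_iff, mem_empty_iff_false, iff_false,
          not_and, not_not]
        exact fun hy => (nChart c).map_target hy
      rw [e]
      simp
    rw [← h2]
    exact Measure.restrict_mono le_rfl (hle c)

theorem inter_preimage_image {c : N} {E : Set (Eu m)} (hE : E ⊆ (nChart c).target) :
    (nChart c).target ∩ (nChart (m := m) c).symm ⁻¹' ((nChart (m := m) c).symm '' E) = E := by
  ext y
  constructor
  · rintro ⟨hy, y', hy', he⟩
    rwa [← (nChart (m := m) c).symm.injOn (hE hy') hy he]
  · exact fun hy => ⟨hE hy, y, hy, rfl⟩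

theorem image_subset_source {c : N} {E : Set (Eu m)} (hE : E ⊆ (nChart c).target) :
    (nChart (m := m) c).symm '' E ⊆ (nChart (m := m) c).source := by
  rintro _ ⟨y, hy, rfl⟩
  exact (nChart c).map_target (hE hy)

variable [T2Space N]

theorem isCompact_image_nChart_symm {c : N} {E : Set (Eu m)} (hE : E ⊆ (nChart c).target)
    (hc : IsCompact E) : IsCompact ((nChart (m := m) c).symm '' E) :=
  hc.image_of_continuousOn ((continuousOn_nChart_symm c).mono hE)

theorem riemannianVolume_image (hσ : IsContMetric σ) {c : N} {E : Set (Eu m)}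
    (hE : E ⊆ (nChart c).target) (hc : IsCompact E) :
    riemannianVolume (𝓡∂ m) σ ((nChart (m := m) c).symm '' E)
      = ∫⁻ y in E, ENNReal.ofReal (volDensity σ c y) := by
  have hA := (isCompact_image_nChart_symm hE hc).isClosed.measurableSet
  have h2 := chartVolume_apply (σ := σ) c hA
  rw [inter_preimage_image hE, ← riemannianVolume_restrict hσ c, Measure.restrict_apply hA,
    inter_eq_left.2 (image_subset_source hE)] at h2
  exact h2

/-- Inside one chart the volume is a pushforward of Lebesgue measure with a density, so integrals
over metric regions become the coordinate integrals of the energy estimate. -/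
theorem setIntegral_image (hσ : IsContMetric σ) {c : N} {E : Set (Eu m)}
    (hE : E ⊆ (nChart c).target) (hc : IsCompact E) {g : N → ℝ}
    (hg : ContinuousOn g ((nChart (m := m) c).symm '' E)) :
    ∫ x in (nChart (m := m) c).symm '' E, g x ∂(riemannianVolume (𝓡∂ m) σ)
      = ∫ y in E, volDensity σ c y * g ((nChart (m := m) c).symm y) := by
  set A := (nChart (m := m) c).symm '' E with hAdef
  have hA : MeasurableSet A := (isCompact_image_nChart_symm hE hc).isClosed.measurableSet
  have hEm := hc.measurableSet
  set μ := (volume.restrict (nChart (m := m) c).target).withDensity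
    fun y => ENNReal.ofReal (volDensity σ c y) with hμ
  have h1 : AEMeasurable (nChart (m := m) c).symm μ :=
    (aemeasurable_nChart_symm c).mono_ac (withDensity_absolutelyContinuous _ _)
  have e0 : (riemannianVolume (𝓡∂ m) σ).restrict A
      = (Measure.map (nChart (m := m) c).symm μ).restrict A := by
    have : Measure.map (nChart (m := m) c).symm μ = chartVolume (𝓡∂ m) σ c := rfl
    rw [this, ← riemannianVolume_restrict hσ c, Measure.restrict_restrict hA,
      inter_eq_left.2 (image_subset_source hE)]
  have e1 : (Measure.map (nChart (m := m) c).symm μ).restrict A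
      = Measure.map (nChart (m := m) c).symm (μ.restrict E) := by
    rw [Measure.restrict_map_of_aemeasurable h1 hA]
    congr 1
    refine Measure.restrict_congr_set ?_
    have h3 : ∀ᵐ y ∂μ, y ∈ (nChart (m := m) c).target :=
      (withDensity_absolutelyContinuous _ _).ae_le
        (ae_restrict_mem (measurableSet_nChart_target c))
    filter_upwards [h3] with y hy
    apply propext
    rw [← inter_preimage_image hE]
    exact ⟨fun h => ⟨hy, h⟩, fun h => h.2⟩
  have hgm : AEStronglyMeasurable g ((riemannianVolume (𝓡∂ m) σ).restrict A) :=
    hg.aestronglyMeasurable hA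
  rw [e0, e1] at hgm ⊢
  rw [integral_map (h1.mono_measure Measure.restrict_le_self) hgm, hμ, restrict_withDensity hEm,
    Measure.restrict_restrict hEm, inter_eq_left.2 hE,
    integral_withDensity_eq_integral_toReal_smul₀]
  · refine setIntegral_congr_fun hEm fun y _ => ?_
    simp only [smul_eq_mul]
    rw [ENNReal.toReal_ofReal (volDensity_nonneg c y)]
  · exact (((hσ.continuousOn_volDensity c).mono hE).aemeasurable hEm).ennreal_ofReal
  · exact Eventually.of_forall fun y => ENNReal.ofReal_lt_top

theorem exists_closedBall_subset_target (c : N) : ∃ ε > 0,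
    Metric.closedBall (nChart (m := m) c c) ε ∩ range (𝓡∂ m) ⊆ (nChart c).target := by
  have h := nChart_target_mem_nhdsWithin ((nChart (m := m) c).map_source
    (mem_extChartAt_source (I := 𝓡∂ m) c))
  obtain ⟨ε, hε, h1⟩ := Metric.mem_nhdsWithin_iff.1 h
  refine ⟨ε / 2, by positivity, fun y hy => h1 ⟨?_, hy.2⟩⟩
  exact Metric.closedBall_subset_ball (by linarith) hy.1

theorem image_mem_nhds {c : N} {ε : ℝ} (hε : 0 < ε) :
    (nChart (m := m) c).symm '' (Metric.closedBall (nChart (m := m) c c) ε ∩ range (𝓡∂ m))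
      ∈ 𝓝 c := by
  have hc : c ∈ (nChart (m := m) c).source := mem_extChartAt_source (I := 𝓡∂ m) c
  have h1 := (isOpen_nChart_source (m := m) c).mem_nhds hc
  have h2 := ((continuousOn_nChart c).continuousAt h1) (Metric.closedBall_mem_nhds _ hε)
  filter_upwards [h1, h2] with x hx hx2
  exact ⟨nChart c x, ⟨hx2, nChart_target_subset_range c ((nChart c).map_source hx)⟩,
    (nChart c).left_inv hx⟩

/-- Every point has a neighbourhood which is the image of a compact half ball, where the density is
continuous and hence integrable. -/
theorem isFiniteMeasure_riemannianVolume [CompactSpace N] (hσ : IsContMetric σ) :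
    IsFiniteMeasure (riemannianVolume (𝓡∂ m) σ) := by
  refine ⟨isCompact_univ.measure_lt_top_of_nhdsWithin fun c _ => ?_⟩
  obtain ⟨ε, hε, h⟩ := exists_closedBall_subset_target (m := m) c
  refine ⟨_, mem_nhdsWithin_of_mem_nhds (image_mem_nhds (m := m) hε), ?_⟩
  have hc : IsCompact (Metric.closedBall (nChart (m := m) c c) ε ∩ range (𝓡∂ m)) :=
    (isCompact_closedBall _ _).inter_right (𝓡∂ m).isClosed_range
  rw [riemannianVolume_image hσ h hc]
  have h1 : IntegrableOn (volDensity σ c) (Metric.closedBall (nChart (m := m) c c) ε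
      ∩ range (𝓡∂ m)) :=
    ((hσ.continuousOn_volDensity c).mono h).integrableOn_compact hc
  exact h1.lintegral_lt_top

end Volume

/-! ### The norm of the differential in coordinates -/

section CovectorNorm

open Matrix

variable {m : ℕ}

theorem dot_gram_mulVec (b : Eu m →L[ℝ] Eu m →L[ℝ] ℝ) (v w : Eu m) :
    v.ofLp ⬝ᵥ (Matrix.of fun i j => b (eb i) (eb j)) *ᵥ w.ofLp = b v w := by
  conv_rhs => rw [← sum_smul_eb v, ← sum_smul_eb w]
  simp only [map_sum, map_smul, _root_.sum_apply, _root_.smul_apply, dotProduct, mulVec,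
    smul_eq_mul, Matrix.of_apply]
  simp only [Finset.mul_sum]
  rw [Finset.sum_comm]
  refine Finset.sum_congr rfl fun i _ => Finset.sum_congr rfl fun j _ => ?_
  ring

theorem dot_self_eq (v : Eu m) : v.ofLp ⬝ᵥ v.ofLp = ‖v‖ ^ 2 := by
  rw [EuclideanSpace.norm_sq_eq]
  simp [dotProduct, sq]

/-- The Cauchy–Schwarz inequality between `G` and its dual norm, obtained by evaluating `G` on `q a
- (ℓ · a) G⁻¹ℓ`. The case `q = 0` forces `ℓ = 0` and is treated apart. -/
theorem dot_sq_le_sqn {G : Matrix (Fin m) (Fin m) ℝ} (hG : G.PosDef) (ℓ a : Fin m → ℝ) :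
    (ℓ ⬝ᵥ a) ^ 2 ≤ sqn G ℓ * (a ⬝ᵥ G *ᵥ a) := by
  have hsym : ∀ x y : Fin m → ℝ, x ⬝ᵥ G *ᵥ y = y ⬝ᵥ G *ᵥ x := by
    intro x y
    have h : Gᵀ = G := by simpa using hG.isHermitian.eq
    rw [dotProduct_mulVec, ← mulVec_transpose, h, dotProduct_comm]
  have hpos : ∀ x : Fin m → ℝ, 0 ≤ x ⬝ᵥ G *ᵥ x := fun x => by
    simpa using hG.posSemidef.dotProduct_mulVec_nonneg x
  have hs := mulVec_sharp (u := ℓ) hG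
  have hq := sqn_eq (u := ℓ) hG
  set s := sharp G ℓ
  set q := sqn G ℓ
  rcases (sqn_nonneg (u := ℓ) hG).eq_or_lt with h0 | h0
  · have hs0 : s = 0 := by
      by_contra hne
      have := hG.dotProduct_mulVec_pos hne
      simp only [star_trivial] at this
      rw [hq] at this
      exact this.ne h0
    have : ℓ = 0 := by rw [← hs, hs0, mulVec_zero]
    simp [this, ← h0, q]
  · have h1 := hpos (q • a - (ℓ ⬝ᵥ a) • s)
    have h2 : a ⬝ᵥ G *ᵥ s = ℓ ⬝ᵥ a := by rw [hs, dotProduct_comm]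
    have h3 : s ⬝ᵥ G *ᵥ a = ℓ ⬝ᵥ a := by rw [hsym, h2]
    simp only [mulVec_sub, mulVec_smul, dotProduct_sub, sub_dotProduct, smul_dotProduct,
      dotProduct_smul, smul_eq_mul, h2, h3, hq] at h1
    have h4 : 0 ≤ q * (q * (a ⬝ᵥ G *ᵥ a) - (ℓ ⬝ᵥ a) ^ 2) := by
      have : q = sqn G ℓ := rfl
      nlinarith [h1]
    have := nonneg_of_mul_nonneg_right h4 h0
    linarith

/-- Cauchy–Schwarz gives the upper bound, and the normalized dual vector `G⁻¹l / √q` attains it. -/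
theorem covectorNorm_eq {V : Type*} {σ : V → V → ℝ} {ℓ : V → ℝ} {D : Eu m → V}
    (hD : Function.Surjective D) {G : Matrix (Fin m) (Fin m) ℝ} (hG : G.PosDef)
    (hσ : ∀ a : Eu m, σ (D a) (D a) = a.ofLp ⬝ᵥ G *ᵥ a.ofLp) {l : Fin m → ℝ}
    (hl : ∀ a : Eu m, ℓ (D a) = l ⬝ᵥ a.ofLp) : covectorNorm σ ℓ = √(sqn G l) := by
  have hq0 := sqn_nonneg (u := l) hG
  refine IsGreatest.csSup_eq ⟨?_, ?_⟩
  · rcases hq0.eq_or_lt with h0 | h0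
    · refine ⟨D 0, ?_, ?_⟩
      · simp [hσ]
      · simp [hl, ← h0]
    · set q := sqn G l with hq
      refine ⟨D (WithLp.toLp 2 ((1 / √q) • sharp G l)), ?_, ?_⟩
      · rw [mem_setOf_eq, hσ]
        simp only [mulVec_smul, dotProduct_smul, smul_dotProduct, smul_eq_mul]
        rw [sqn_eq hG, ← hq, ← mul_assoc, ← sq, div_pow, one_pow, Real.sq_sqrt h0.le,
          one_div_mul_cancel h0.ne']
      · simp only [hl, dotProduct_smul, smul_eq_mul]
        have : l ⬝ᵥ sharp G l = q := rfl
        rw [this, abs_of_nonneg (by positivity), div_mul_eq_mul_div, one_mul, Real.div_sqrt]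
  · rintro _ ⟨v, hv, rfl⟩
    obtain ⟨a, rfl⟩ := hD v
    simp only [mem_setOf_eq, hσ] at hv
    simp only [hl]
    refine Real.abs_le_sqrt ((dot_sq_le_sqn hG l a.ofLp).trans ?_)
    nlinarith

end CovectorNorm

/-! ### The metric `σ_u`, the gradient and the tilt in charts -/

section Graphs

set_option synthInstance.maxHeartbeats 200000

variable {m : ℕ} [NeZero m] {N : Type*} [TopologicalSpace N] [ChartedSpace (EuclideanHalfSpace m) N]
  [IsManifold (𝓡∂ m) ∞ N]
  {S : Type*} [TopologicalSpace S] [ChartedSpace (EuclideanSpace ℝ (Fin m)) S]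
  [IsManifold (𝓡 m) ∞ S] (𝓜 : SplitMetric m S)
  {ι : N → ℝ × S} {u : N → ℝ} {c : N} {p : ℝ × S} {y : Eu m}

/-- The projection of the hypersurface to `S` in charts. -/
def hRep (ι : N → ℝ × S) (c : N) (p : ℝ × S) (y : Eu m) : Eu m := (nRep c p ι y).2

/-- The differential of the projection of the hypersurface to `S` in charts. -/
def hD (ι : N → ℝ × S) (c : N) (p : ℝ × S) (y : Eu m) : Eu m →L[ℝ] Eu m :=
  fderivWithin ℝ (hRep ι c p) (range (𝓡∂ m)) y

/-- A function on the hypersurface in a chart. -/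
def uRep (u : N → ℝ) (c : N) (y : Eu m) : ℝ := u ((nChart c).symm y)

/-- The components of the differential of a function on the hypersurface in a chart. -/
def uSlope (u : N → ℝ) (c : N) (y : Eu m) (k : Fin m) : ℝ :=
  fderivWithin ℝ (uRep u c) (range (𝓡∂ m)) y (eb k)

/-- The charts of `ℝ × S` restrict only the component in `S`, which the graph shares with `ι`. The
same chart domains therefore serve all height functions. -/
theorem nDom_graphMap : nDom (m := m) c p (graphMap ι u) = nDom c p ι := by
  ext y
  simp only [nDom, mem_inter_iff, mem_preimage, mem_stChart_source, graphMap]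

theorem nRep_graphMap (y : Eu m) : nRep c p (graphMap ι u) y = (uRep u c y, hRep ι c p y) := by
  rw [nRep, hRep, nRep, stChart_apply, stChart_apply]
  rfl

theorem contMDiff_graphMap (hι : ContMDiff (𝓡∂ m) (stModel m) ∞ ι)
    (hu : ContMDiff (𝓡∂ m) 𝓘(ℝ, ℝ) ∞ u) : ContMDiff (𝓡∂ m) (stModel m) ∞ (graphMap ι u) :=
  hu.prodMk (contMDiff_snd.comp hι)

theorem contDiffWithinAt_hRep (hι : ContMDiff (𝓡∂ m) (stModel m) ∞ ι) (hy : y ∈ nDom c p ι) :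
    ContDiffWithinAt ℝ ∞ (hRep ι c p) (range (𝓡∂ m)) y :=
  ((contDiffOn_nRep hι y hy).snd).mono_of_mem_nhdsWithin (nDom_mem_nhdsWithin hι hy)

theorem contDiffWithinAt_uRep (hu : ContMDiff (𝓡∂ m) 𝓘(ℝ, ℝ) ∞ u)
    (hy : y ∈ (nChart (m := m) c).target) :
    ContDiffWithinAt ℝ ∞ (uRep u c) (range (𝓡∂ m)) y := by
  rw [← contMDiffWithinAt_iff_contDiffWithinAt]
  exact (hu _).comp_contMDiffWithinAt y
    ((contMDiffOn_nChart_symm c y hy).mono_of_mem_nhdsWithin (nChart_target_mem_nhdsWithin hy))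

theorem continuousWithinAt_hD (hι : ContMDiff (𝓡∂ m) (stModel m) ∞ ι) (hy : y ∈ nDom c p ι) :
    ContinuousWithinAt (hD ι c p) (range (𝓡∂ m)) y :=
  ((contDiffWithinAt_hRep hι hy).fderivWithin_right (m := 0) (𝓡∂ m).uniqueDiffOn (by simp)
    (nChart_target_subset_range c hy.1)).continuousWithinAt

theorem continuousWithinAt_uSlope (hu : ContMDiff (𝓡∂ m) 𝓘(ℝ, ℝ) ∞ u)
    (hy : y ∈ (nChart (m := m) c).target) :
    ContinuousWithinAt (uSlope u c) (range (𝓡∂ m)) y := by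
  refine continuousWithinAt_pi.2 fun k => ?_
  exact (((contDiffWithinAt_uRep hu hy).fderivWithin_right (m := 0) (𝓡∂ m).uniqueDiffOn (by simp)
    (nChart_target_subset_range c hy)).continuousWithinAt).clm_apply continuousWithinAt_const

theorem fderivWithin_nRep_graphMap (hι : ContMDiff (𝓡∂ m) (stModel m) ∞ ι)
    (hu : ContMDiff (𝓡∂ m) 𝓘(ℝ, ℝ) ∞ u) (hy : y ∈ nDom c p ι) (v : Eu m) :
    fderivWithin ℝ (nRep c p (graphMap ι u)) (range (𝓡∂ m)) y v
      = (fderivWithin ℝ (uRep u c) (range (𝓡∂ m)) y v, hD ι c p y v) := by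
  have e : nRep c p (graphMap ι u) = fun y : Eu m => (uRep u c y, hRep ι c p y) :=
    funext nRep_graphMap
  rw [e, DifferentiableWithinAt.fderivWithin_prodMk
    ((contDiffWithinAt_uRep hu hy.1).differentiableWithinAt (by simp))
    ((contDiffWithinAt_hRep hι hy).differentiableWithinAt (by simp)) (uniqueDiffWithinAt_range hy.1)]
  rfl

theorem uRep_hRep_mem_target (hy : y ∈ nDom c p ι) (t : ℝ) :
    (t, hRep ι c p y) ∈ (stChart (m := m) p).target := by
  rw [mem_stChart_target]
  exact (mem_stChart_target p _).1 (nRep_mem_target hy)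

theorem dFun_nD_eq (hu : ContMDiff (𝓡∂ m) 𝓘(ℝ, ℝ) ∞ u) (hy : y ∈ (nChart (m := m) c).target)
    (v : Eu m) : dFun u ((nChart c).symm y) (nD c y v) = uSlope u c y ⬝ᵥ v.ofLp := by
  rw [dFun_nD hy ((hu _).mdifferentiableAt (by simp))]
  conv_lhs => rw [← sum_smul_eb v]
  simp only [map_sum, map_smul, smul_eq_mul, dotProduct]
  exact Finset.sum_congr rfl fun k _ => mul_comm _ _

theorem apply_uSlope (u : N → ℝ) (c : N) (y v : Eu m) :
    fderivWithin ℝ (uRep (m := m) u c) (range (𝓡∂ m)) y v = uSlope u c y ⬝ᵥ v.ofLp := by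
  conv_lhs => rw [← sum_smul_eb v]
  simp only [map_sum, map_smul, smul_eq_mul, dotProduct]
  exact Finset.sum_congr rfl fun k _ => mul_comm _ _

namespace SplitMetric

/-- The metric `σ_u` in a chart, as a function of the height and the point. -/
def sigRep (ι : N → ℝ × S) (c : N) (p : ℝ × S) (t : ℝ) (y : Eu m) : Eu m →L[ℝ] Eu m →L[ℝ] ℝ :=
  (𝓜.sHat p (t, hRep ι c p y)).bilinearComp (hD ι c p y) (hD ι c p y)

theorem sigRep_apply (t : ℝ) (y v w : Eu m) : 𝓜.sigRep ι c p t y v w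
    = 𝓜.sHat p (t, hRep ι c p y) (hD ι c p y v) (hD ι c p y w) := rfl

/-- The component of `dF_u` along the time axis lies in the kernel of the tensor, so no derivative
of `u` enters `σ_u`. Bounds uniform in the height value are thus bounds uniform in `u`. -/
theorem sigU_nD (hι : ContMDiff (𝓡∂ m) (stModel m) ∞ ι)
    (hu : ContMDiff (𝓡∂ m) 𝓘(ℝ, ℝ) ∞ u) (hy : y ∈ nDom c p ι) (v w : Eu m) :
    𝓜.sigU ι u ((nChart c).symm y) (nD c y v) (nD c y w)
      = 𝓜.sigRep ι c p (uRep u c y) y v w := by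
  have hF := contMDiff_graphMap hι hu
  have hy' : y ∈ nDom c p (graphMap ι u) := by rwa [nDom_graphMap]
  have h1 := dMap_nD hF hy' v
  have h2 := dMap_nD hF hy' w
  have key : ∀ q q' : ℝ × S, q = q' → ∀ a b : ℝ × Eu m, 𝓜.sig q a b = 𝓜.sig q' a b := by
    rintro _ _ rfl a b
    rfl
  have h3 : 𝓜.sigU ι u ((nChart c).symm y) (nD c y v) (nD c y w)
      = 𝓜.sig (graphMap ι u ((nChart c).symm y))
        (stD p (nRep c p (graphMap ι u) y)
          (fderivWithin ℝ (nRep c p (graphMap ι u)) (range (𝓡∂ m)) y v))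
        (stD p (nRep c p (graphMap ι u) y)
          (fderivWithin ℝ (nRep c p (graphMap ι u)) (range (𝓡∂ m)) y w)) := by
    rw [← h1, ← h2]
    rfl
  rw [h3]
  refine (key _ _ (stChart_symm_nRep hy').symm _ _).trans ?_
  refine (𝓜.sigHat_apply p _ _ _).symm.trans ?_
  rw [𝓜.sigHat_eq_sHat (nRep_mem_target hy'), fderivWithin_nRep_graphMap hι hu hy,
    fderivWithin_nRep_graphMap hι hu hy, nRep_graphMap, sigRep_apply]

theorem chartGram_sigU (hι : ContMDiff (𝓡∂ m) (stModel m) ∞ ι)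
    (hu : ContMDiff (𝓡∂ m) 𝓘(ℝ, ℝ) ∞ u) (hy : y ∈ nDom c p ι) :
    chartGram (𝓡∂ m) (𝓜.sigU ι u) c y
      = Matrix.of fun i j => 𝓜.sigRep ι c p (uRep u c y) y (eb i) (eb j) := by
  ext i j
  exact 𝓜.sigU_nD hι hu hy (eb i) (eb j)

/-- A tangent vector of the hypersurface with zero projection to `S` would have `ḡ(v, v) = -α² (dτ
v)² ≤ 0`, against spacelikeness. So the hypersurface is immersed in `S`. -/
theorem hD_injective (hι : 𝓜.IsCompactSpacelike ι) (hy : y ∈ nDom c p ι) {v : Eu m} (hv : v ≠ 0) :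
    hD ι c p y v ≠ 0 := by
  intro h0
  have hn : nD c y v ≠ 0 := fun h => hv (nD_injective hy.1 (h.trans (map_zero _).symm))
  have h1 := hι.spacelike ((nChart (m := m) c).symm y) (nD c y v) hn
  have h2 := dMap_nD hι.smooth hy v
  have key : ∀ q q' : ℝ × S, q = q' → ∀ a b : ℝ × Eu m, 𝓜.gbar q a b = 𝓜.gbar q' a b := by
    rintro _ _ rfl a b
    rfl
  have h3 : 𝓜.gbar (ι ((nChart c).symm y)) (dMap ι ((nChart c).symm y) (nD c y v))
      (dMap ι ((nChart c).symm y) (nD c y v))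
      = 𝓜.gbar ((stChart p).symm (nRep c p ι y))
        (stD p (nRep c p ι y) (fderivWithin ℝ (nRep c p ι) (range (𝓡∂ m)) y v))
        (stD p (nRep c p ι y) (fderivWithin ℝ (nRep c p ι) (range (𝓡∂ m)) y v)) := by
    rw [← h2]
    exact key _ _ (stChart_symm_nRep hy).symm _ _
  rw [← 𝓜.gHat_eq (nRep_mem_target hy), 𝓜.gHat_eq_sHat (nRep_mem_target hy)] at h3
  have h4 := fderivWithin_nRep_graphMap (u := fun x => (ι x).1) hι.smooth
    (contMDiff_fst.comp hι.smooth) hy v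
  rw [show graphMap ι (fun x => (ι x).1) = ι from rfl, h0] at h4
  rw [h3, h4] at h1
  simp only [map_zero, add_zero] at h1
  have := 𝓜.lapse_pos ((stChart (m := m) p).symm (nRep c p ι y))
  nlinarith [mul_self_nonneg (fderivWithin ℝ (uRep (fun x => (ι x).1) c) (range (𝓡∂ m)) y v),
    mul_nonneg (sq_nonneg (𝓜.lapse ((stChart (m := m) p).symm (nRep c p ι y)))) (mul_self_nonneg
      (fderivWithin ℝ (uRep (fun x => (ι x).1) c) (range (𝓡∂ m)) y v))]

theorem sigRep_pos (hι : 𝓜.IsCompactSpacelike ι) (hy : y ∈ nDom c p ι) (t : ℝ) {v : Eu m}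
    (hv : v ≠ 0) : 0 < 𝓜.sigRep ι c p t y v v := by
  rw [sigRep_apply]
  exact 𝓜.sHat_pos (uRep_hRep_mem_target hy t) (𝓜.hD_injective hι hy hv)

theorem sigRep_symm (t : ℝ) (y v w : Eu m) :
    𝓜.sigRep ι c p t y v w = 𝓜.sigRep ι c p t y w v := 𝓜.sigHat_symm _ _ _ _

theorem posDef_sigRep (hι : 𝓜.IsCompactSpacelike ι) (hy : y ∈ nDom c p ι) (t : ℝ) :
    (Matrix.of fun i j => 𝓜.sigRep ι c p t y (eb i) (eb j)).PosDef := by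
  refine Matrix.PosDef.of_dotProduct_mulVec_pos ?_ fun x hx => ?_
  · ext i j
    simp only [Matrix.conjTranspose_apply, Matrix.of_apply, star_trivial]
    exact 𝓜.sigRep_symm _ _ _ _
  · have h := dot_gram_mulVec (𝓜.sigRep ι c p t y) (WithLp.toLp 2 x) (WithLp.toLp 2 x)
    rw [star_trivial]
    refine lt_of_lt_of_eq ?_ h.symm
    exact 𝓜.sigRep_pos hι hy t fun h => hx (by simpa using congrArg WithLp.ofLp h)

/-- `|du|²_{σ_u}` in a chart. -/
def gradSq (ι : N → ℝ × S) (u : N → ℝ) (c : N) (y : Eu m) : ℝ :=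
  sqn (chartGram (𝓡∂ m) (𝓜.sigU ι u) c y) (uSlope u c y)

theorem posDef_chartGram (hι : 𝓜.IsCompactSpacelike ι)
    (hu : ContMDiff (𝓡∂ m) 𝓘(ℝ, ℝ) ∞ u) (hy : y ∈ nDom c p ι) :
    (chartGram (𝓡∂ m) (𝓜.sigU ι u) c y).PosDef := by
  rw [𝓜.chartGram_sigU hι.smooth hu hy]
  exact 𝓜.posDef_sigRep hι hy _

theorem gradNorm_eq (hι : 𝓜.IsCompactSpacelike ι)
    (hu : ContMDiff (𝓡∂ m) 𝓘(ℝ, ℝ) ∞ u) (hy : y ∈ nDom c p ι) :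
    𝓜.gradNorm ι u ((nChart c).symm y) = √(𝓜.gradSq ι u c y) := by
  refine covectorNorm_eq (D := nD c y) (nD_surjective hy.1) (𝓜.posDef_chartGram hι hu hy)
    (fun a => ?_) (fun a => dFun_nD_eq hu hy.1 a)
  rw [𝓜.chartGram_sigU hι.smooth hu hy, dot_gram_mulVec]
  exact 𝓜.sigU_nD hι.smooth hu hy a a

theorem gradSq_nonneg (hι : 𝓜.IsCompactSpacelike ι)
    (hu : ContMDiff (𝓡∂ m) 𝓘(ℝ, ℝ) ∞ u) (hy : y ∈ nDom c p ι) : 0 ≤ 𝓜.gradSq ι u c y :=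
  sqn_nonneg (𝓜.posDef_chartGram hι hu hy)

theorem tilt_eq (hι : 𝓜.IsCompactSpacelike ι)
    (hu : ContMDiff (𝓡∂ m) 𝓘(ℝ, ℝ) ∞ u) (hy : y ∈ nDom c p ι) :
    𝓜.tilt ι u ((nChart c).symm y) = 1 / √(1 - 𝓜.gradSq ι u c y) := by
  rw [tilt, 𝓜.gradNorm_eq hι hu hy, Real.sq_sqrt (𝓜.gradSq_nonneg hι hu hy)]

theorem continuousWithinAt_sHat_hRep (hι : ContMDiff (𝓡∂ m) (stModel m) ∞ ι)
    (hu : ContMDiff (𝓡∂ m) 𝓘(ℝ, ℝ) ∞ u) (hy : y ∈ nDom c p ι) :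
    ContinuousWithinAt (fun y => 𝓜.sHat p (uRep u c y, hRep ι c p y)) (range (𝓡∂ m)) y := by
  have h1 : ContinuousAt (𝓜.sHat p) (uRep u c y, hRep ι c p y) :=
    (𝓜.contDiffOn_sHat p).continuousOn.continuousAt ((isOpen_stChart_target p).mem_nhds
      (uRep_hRep_mem_target hy _))
  have h2 : ContinuousWithinAt (fun y => (uRep u c y, hRep ι c p y)) (range (𝓡∂ m)) y :=
    (contDiffWithinAt_uRep hu hy.1).continuousWithinAt.prodMk
      (contDiffWithinAt_hRep hι hy).continuousWithinAt
  exact ContinuousAt.comp_continuousWithinAt (f := fun y => (uRep u c y, hRep ι c p y)) h1 h2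

theorem continuousWithinAt_sigRep_apply (hι : ContMDiff (𝓡∂ m) (stModel m) ∞ ι)
    (hu : ContMDiff (𝓡∂ m) 𝓘(ℝ, ℝ) ∞ u) (hy : y ∈ nDom c p ι) (a b : Eu m) :
    ContinuousWithinAt (fun y => 𝓜.sigRep ι c p (uRep u c y) y a b) (range (𝓡∂ m)) y := by
  have h2 := 𝓜.continuousWithinAt_sHat_hRep hι hu hy
  have h4 : ∀ i, ContinuousWithinAt (fun y => hD ι c p y i) (range (𝓡∂ m)) y := fun i =>
    (continuousWithinAt_hD hι hy).clm_apply continuousWithinAt_const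
  simp only [sigRep_apply]
  exact (h2.clm_apply (h4 a)).clm_apply (h4 b)

theorem continuousWithinAt_chartGram (hι : ContMDiff (𝓡∂ m) (stModel m) ∞ ι)
    (hu : ContMDiff (𝓡∂ m) 𝓘(ℝ, ℝ) ∞ u) (hy : y ∈ nDom c p ι) :
    ContinuousWithinAt (chartGram (𝓡∂ m) (𝓜.sigU ι u) c) (range (𝓡∂ m)) y := by
  refine continuousWithinAt_pi.2 fun i => continuousWithinAt_pi.2 fun j => ?_
  refine (𝓜.continuousWithinAt_sigRep_apply hι hu hy (eb i) (eb j)).congr_of_eventuallyEq ?_ ?_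
  · filter_upwards [nDom_mem_nhdsWithin hι hy] with z hz
    rw [𝓜.chartGram_sigU hι hu hz, Matrix.of_apply]
  · rw [𝓜.chartGram_sigU hι hu hy, Matrix.of_apply]

theorem mem_nDom_self (ι : N → ℝ × S) (c : N) (hy : y ∈ (nChart (m := m) c).target) :
    y ∈ nDom (m := m) c (ι ((nChart c).symm y)) ι :=
  ⟨hy, mem_extChartAt_source (I := stModel m) _⟩

theorem isContMetric_sigU (hι : ContMDiff (𝓡∂ m) (stModel m) ∞ ι)
    (hu : ContMDiff (𝓡∂ m) 𝓘(ℝ, ℝ) ∞ u) : IsContMetric (𝓜.sigU ι u) := by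
  refine ⟨fun x => ⟨LinearMap.mk₂ ℝ (𝓜.sigU ι u x) ?_ ?_ ?_ ?_, fun v w => rfl⟩, fun c y hy => ?_⟩
  · intro v v' w
    simp only [sigU, dMap, map_add, _root_.add_apply]
  · intro a v w
    simp only [sigU, dMap, map_smul, _root_.smul_apply]
  · intro v v' w
    simp only [sigU, dMap, map_add]
  · intro a v w
    simp only [sigU, dMap, map_smul]
  · exact (𝓜.continuousWithinAt_chartGram hι hu (mem_nDom_self ι c hy)).mono
      (nChart_target_subset_range c)

theorem continuousWithinAt_gradSq (hι : 𝓜.IsCompactSpacelike ι)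
    (hu : ContMDiff (𝓡∂ m) 𝓘(ℝ, ℝ) ∞ u) (hy : y ∈ nDom c p ι) :
    ContinuousWithinAt (𝓜.gradSq ι u c) (range (𝓡∂ m)) y := by
  have h1 := 𝓜.continuousWithinAt_chartGram hι.smooth hu hy
  have h2 := continuousWithinAt_uSlope hu hy.1
  have h0 : (chartGram (𝓡∂ m) (𝓜.sigU ι u) c y).det ≠ 0 :=
    (𝓜.posDef_chartGram hι hu hy).det_pos.ne'
  have h3 : ContinuousWithinAt (fun y => (chartGram (𝓡∂ m) (𝓜.sigU ι u) c y)⁻¹)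
      (range (𝓡∂ m)) y := by
    simp only [Matrix.inv_def, Ring.inverse_eq_inv']
    exact ((((Continuous.matrix_det continuous_id).continuousAt).comp_continuousWithinAt h1).inv₀
      h0).smul (((Continuous.matrix_adjugate continuous_id).continuousAt).comp_continuousWithinAt h1)
  have h4 : Continuous fun q : Matrix (Fin m) (Fin m) ℝ × (Fin m → ℝ) =>
      q.2 ⬝ᵥ (q.1.mulVec q.2) :=
    continuous_snd.dotProduct (continuous_fst.matrix_mulVec continuous_snd)
  exact h4.continuousAt.comp_continuousWithinAt (h3.prodMk h2)

end SplitMetric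

end Graphs

/-! ### Charts with uniform bounds -/

section VectorFields

variable {m : ℕ} {S : Type*} [TopologicalSpace S] [ChartedSpace (EuclideanSpace ℝ (Fin m)) S]
  [IsManifold (𝓡 m) ∞ S]

/-- A vector field on the spacetime in a chart. -/
def vecRep (X : ∀ p : ℝ × S, TangentSpace (stModel m) p) (p : ℝ × S) (z : ℝ × Eu m) : ℝ × Eu m :=
  mfderiv (stModel m) 𝓘(ℝ, ℝ × Eu m) (stChart (m := m) p) ((stChart (m := m) p).symm z)
    (X ((stChart p).symm z))

theorem continuousOn_vecRep {X : ∀ p : ℝ × S, TangentSpace (stModel m) p}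
    (hX : ContMDiff (stModel m) (stModel m).tangent ∞
      (fun p => (⟨p, X p⟩ : TangentBundle (stModel m) (ℝ × S)))) (p : ℝ × S) :
    ContinuousOn (vecRep X p) (stChart p).target := by
  have h1 := (contMDiffOn_stChart (m := m) p).contMDiffOn_tangentMapWithin (m := 1) (by rw [one_add_one_eq_two]; exact two_le_infty)
    (isOpen_stChart_source p).uniqueMDiffOn
  have h2 : ContMDiffOn 𝓘(ℝ, ℝ × Eu m) (stModel m).tangent 1
      (fun z => (⟨(stChart (m := m) p).symm z, X ((stChart p).symm z)⟩ :
        TangentBundle (stModel m) (ℝ × S))) (stChart p).target :=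
    (hX.of_le (by simp)).comp_contMDiffOn ((contMDiffOn_stChart_symm p).of_le (by simp))
  have h3 := (h1.comp h2 fun z hz => (stChart (m := m) p).map_target hz).continuousOn
  have h4 : Continuous fun w : TangentBundle 𝓘(ℝ, ℝ × Eu m) (ℝ × Eu m) => w.2 :=
    (contMDiff_snd_tangentBundle_modelSpace (ℝ × Eu m) 𝓘(ℝ, ℝ × Eu m) (n := 1)).continuous
  refine (h4.comp_continuousOn h3).congr fun z hz => ?_
  have h5 := mfderivWithin_of_isOpen (I := stModel m) (I' := 𝓘(ℝ, ℝ × Eu m))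
    (f := stChart (m := m) p) (isOpen_stChart_source p) ((stChart (m := m) p).map_target hz)
  exact (congrArg (fun L => L (X ((stChart (m := m) p).symm z))) h5).symm

theorem SplitMetric.gHat_vecRep [NeZero m] (𝓜 : SplitMetric m S)
    (X : ∀ p : ℝ × S, TangentSpace (stModel m) p) {p q : ℝ × S}
    (hq : q ∈ (stChart (m := m) p).source) (b : ℝ × Eu m)
    {w : TangentSpace (stModel m) q} (hw : stD p (stChart (m := m) p q) b = w) :
    𝓜.gHat p (stChart (m := m) p q) (vecRep X p (stChart (m := m) p q)) b = 𝓜.gbar q (X q) w := by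
  have hz := (stChart (m := m) p).map_source hq
  rw [𝓜.gHat_eq hz]
  have key : ∀ q' : ℝ × S, q' = q → 𝓜.gbar q' (stD p (stChart (m := m) p q)
      (mfderiv (stModel m) 𝓘(ℝ, ℝ × Eu m) (stChart (m := m) p) q' (X q')))
      (stD p (stChart (m := m) p q) b) = 𝓜.gbar q (X q) w := by
    rintro _ rfl
    rw [hw]
    exact congrArg (fun v => 𝓜.gbar _ v w) (stD_mfderiv_stChart hq (X _))
  exact key _ ((stChart (m := m) p).left_inv hq)

end VectorFields

section GoodCharts

set_option maxSynthPendingDepth 3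
set_option synthInstance.maxHeartbeats 200000

variable {m : ℕ} [NeZero m] {N : Type*} [TopologicalSpace N] [ChartedSpace (EuclideanHalfSpace m) N]
  {S : Type*} [TopologicalSpace S] [ChartedSpace (EuclideanSpace ℝ (Fin m)) S]

/-- The coordinates in a half ball. -/
def halfBall (c : N) (ε : ℝ) : Set (Eu m) :=
  Metric.closedBall (nChart (m := m) c c) ε ∩ range (𝓡∂ m)

theorem isCompact_halfBall (c : N) (ε : ℝ) : IsCompact (halfBall (m := m) c ε) :=
  (isCompact_closedBall _ _).inter_right (𝓡∂ m).isClosed_range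

/-- The centre of the chart of the spacetime used around the point `c` of the hypersurface. -/
def ctr (ι : N → ℝ × S) (c : N) : ℝ × S := (0, (ι c).2)

variable [IsManifold (𝓡 m) ∞ S]

/-- On the half ball of radius `ε`, and at the heights between `-T` and `T`, the metric, its
time derivative and the vector field are controlled by the constant `L`. -/
structure GoodChart (𝓜 : SplitMetric m S) (ι : N → ℝ × S)
    (X : ∀ p : ℝ × S, TangentSpace (stModel m) p) (T : ℝ) (c : N) (ε L : ℝ) : Prop where
  pos : 0 < ε
  one_le : 1 ≤ L
  subset : halfBall (m := m) c ε ⊆ nDom c (ctr ι c) ι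
  lower : ∀ t, |t| ≤ T → ∀ y ∈ halfBall (m := m) c ε, ∀ v,
    ‖v‖ ^ 2 ≤ L * 𝓜.sigRep ι c (ctr ι c) t y v v
  upper : ∀ t, |t| ≤ T → ∀ y ∈ halfBall (m := m) c ε, ∀ v,
    𝓜.sigRep ι c (ctr ι c) t y v v ≤ L * ‖v‖ ^ 2
  lapse_lower : ∀ t, |t| ≤ T → ∀ y ∈ halfBall (m := m) c ε,
    1 / L ≤ 𝓜.lapse ((stChart (m := m) (ctr ι c)).symm (t, hRep ι c (ctr ι c) y))
  lapse_upper : ∀ t, |t| ≤ T → ∀ y ∈ halfBall (m := m) c ε,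
    𝓜.lapse ((stChart (m := m) (ctr ι c)).symm (t, hRep ι c (ctr ι c) y)) ≤ L
  deriv_le : ∀ t, |t| ≤ T → ∀ y ∈ halfBall (m := m) c ε, ∀ a b,
    |fderiv ℝ (𝓜.gHat (ctr ι c)) (t, hRep ι c (ctr ι c) y) (1, 0) a b| ≤ L * ‖a‖ * ‖b‖
  hD_le : ∀ y ∈ halfBall (m := m) c ε, ∀ v, ‖hD ι c (ctr ι c) y v‖ ≤ L * ‖v‖
  vec_le : ∀ t, |t| ≤ T → ∀ y ∈ halfBall (m := m) c ε, ∀ b,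
    |𝓜.gHat (ctr ι c) (t, hRep ι c (ctr ι c) y)
      (vecRep X (ctr ι c) (t, hRep ι c (ctr ι c) y)) b| ≤ L * ‖b‖

variable [IsManifold (𝓡∂ m) ∞ N]

/-- All the quantities are continuous on the product of `[-T, T]` and a compact half ball, hence
bounded there. The height is an independent variable, which keeps `L` independent of `u`. -/
theorem exists_goodChart (𝓜 : SplitMetric m S) {ι : N → ℝ × S} (hι : 𝓜.IsCompactSpacelike ι)
    {X : ∀ p : ℝ × S, TangentSpace (stModel m) p}
    (hX : ContMDiff (stModel m) (stModel m).tangent ∞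
      (fun p => (⟨p, X p⟩ : TangentBundle (stModel m) (ℝ × S)))) (T : ℝ) (c : N) :
    ∃ ε L, GoodChart 𝓜 ι X T c ε L := by
  set p := ctr ι c with hp
  have hc : nChart (m := m) c c ∈ nDom (m := m) c p ι :=
    mem_nDom (mem_extChartAt_source (I := 𝓡∂ m) c)
      ((mem_stChart_source p _).2 (mem_extChartAt_source (I := 𝓡 m) (ι c).2))
  obtain ⟨δ, hδ, hsub⟩ := Metric.mem_nhdsWithin_iff.1 (nDom_mem_nhdsWithin hι.smooth hc)
  have hK : halfBall (m := m) c (δ / 2) ⊆ nDom c p ι := fun y hy =>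
    hsub ⟨Metric.closedBall_subset_ball (by linarith) hy.1, hy.2⟩
  set K := halfBall (m := m) c (δ / 2) with hKdef
  set Q : Set (ℝ × Eu m) := Icc (-T) T ×ˢ K with hQ
  have hQc : IsCompact Q := isCompact_Icc.prod (isCompact_halfBall c _)
  have hh : ContinuousOn (hRep ι c p) K := fun y hy =>
    (contDiffWithinAt_hRep hι.smooth (hK hy)).continuousWithinAt.mono inter_subset_right
  have hd : ContinuousOn (hD ι c p) K := fun y hy =>
    (continuousWithinAt_hD hι.smooth (hK hy)).mono inter_subset_right
  have hφ : ContinuousOn (fun q : ℝ × Eu m => (q.1, hRep ι c p q.2)) Q :=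
    continuousOn_fst.prodMk (hh.comp continuousOn_snd fun q hq => hq.2)
  have hφm : MapsTo (fun q : ℝ × Eu m => (q.1, hRep ι c p q.2)) Q (stChart (m := m) p).target :=
    fun q hq => uRep_hRep_mem_target (hK hq.2) q.1
  have hdQ : ContinuousOn (fun q : ℝ × Eu m => hD ι c p q.2) Q :=
    hd.comp continuousOn_snd fun q hq => hq.2
  have hs : ContinuousOn (fun q : ℝ × Eu m => 𝓜.sHat p (q.1, hRep ι c p q.2)) Q :=
    (𝓜.contDiffOn_sHat p).continuousOn.comp hφ hφm
  have hg : ContinuousOn (fun q : ℝ × Eu m => 𝓜.gHat p (q.1, hRep ι c p q.2)) Q :=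
    (𝓜.contDiffOn_gHat p).continuousOn.comp hφ hφm
  have hl : ContinuousOn (fun q : ℝ × Eu m =>
      𝓜.lapse ((stChart (m := m) p).symm (q.1, hRep ι c p q.2))) Q :=
    (𝓜.contDiffOn_lapse p).continuousOn.comp hφ hφm
  have hfd : ContinuousOn (fun q : ℝ × Eu m =>
      fderiv ℝ (𝓜.gHat p) (q.1, hRep ι c p q.2)) Q := by
    have : ContinuousOn (fderiv ℝ (𝓜.gHat p)) (stChart (m := m) p).target := fun z hz =>
      ((𝓜.contDiffAt_gHat hz).fderiv_right (m := 0) (by simp)).continuousAt.continuousWithinAt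
    exact this.comp hφ hφm
  have hx : ContinuousOn (fun q : ℝ × Eu m => 𝓜.gHat p (q.1, hRep ι c p q.2)
      (vecRep X p (q.1, hRep ι c p q.2))) Q :=
    hg.clm_apply ((continuousOn_vecRep hX p).comp hφ hφm)
  -- The lower bound for the metric is an upper bound for the inverse of its quadratic form on unit
  -- vectors, extended to all vectors by homogeneity.
  have hsi : ContinuousOn (fun q : (ℝ × Eu m) × Eu m =>
      (𝓜.sigRep ι c p q.1.1 q.1.2 q.2 q.2)⁻¹) (Q ×ˢ Metric.sphere 0 1) := by
    have h1 : ContinuousOn (fun q : (ℝ × Eu m) × Eu m => hD ι c p q.1.2 q.2)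
        (Q ×ˢ Metric.sphere 0 1) :=
      (hdQ.comp continuousOn_fst fun q hq => hq.1).clm_apply continuousOn_snd
    have h2 : ContinuousOn (fun q : (ℝ × Eu m) × Eu m => 𝓜.sHat p (q.1.1, hRep ι c p q.1.2))
        (Q ×ˢ Metric.sphere 0 1) := hs.comp continuousOn_fst fun q hq => hq.1
    refine ContinuousOn.inv₀ ?_ ?_
    · simp only [SplitMetric.sigRep_apply]
      exact (h2.clm_apply h1).clm_apply h1
    · intro q hq
      refine (𝓜.sigRep_pos hι (hK hq.1.2) q.1.1 ?_).ne'
      exact ne_zero_of_mem_unit_sphere (⟨q.2, hq.2⟩ : Metric.sphere (0 : Eu m) 1)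
  obtain ⟨C1, hC1⟩ := hQc.exists_bound_of_continuousOn hs
  obtain ⟨C2, hC2⟩ := (isCompact_halfBall c (δ / 2)).exists_bound_of_continuousOn hd
  obtain ⟨C3, hC3⟩ := hQc.exists_bound_of_continuousOn hl
  obtain ⟨C4, hC4⟩ := hQc.exists_bound_of_continuousOn (hl.inv₀ fun q _ => (𝓜.lapse_pos _).ne')
  obtain ⟨C5, hC5⟩ := hQc.exists_bound_of_continuousOn hfd
  obtain ⟨C6, hC6⟩ := hQc.exists_bound_of_continuousOn hx
  obtain ⟨C7, hC7⟩ := (hQc.prod (isCompact_sphere (0 : Eu m) 1)).exists_bound_of_continuousOn hsi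
  set L := 1 + |C1| * |C2| * |C2| + |C2| + |C3| + |C4| + |C5| + |C6| + |C7| with hL
  have a12 : 0 ≤ |C1| * |C2| * |C2| := by positivity
  have a1 := abs_nonneg C1
  have a2 := abs_nonneg C2
  have a3 := abs_nonneg C3
  have a4 := abs_nonneg C4
  have a5 := abs_nonneg C5
  have a6 := abs_nonneg C6
  have a7 := abs_nonneg C7
  have hL1 : 1 ≤ L := by linarith
  have mem : ∀ t, |t| ≤ T → ∀ y ∈ K, ((t, y) : ℝ × Eu m) ∈ Q := fun t ht y hy =>
    ⟨abs_le.1 ht, hy⟩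
  have hDle : ∀ y ∈ K, ∀ v, ‖hD ι c p y v‖ ≤ |C2| * ‖v‖ := fun y hy v =>
    ((hD ι c p y).le_opNorm v).trans
      (mul_le_mul_of_nonneg_right ((hC2 y hy).trans (le_abs_self C2)) (norm_nonneg v))
  refine ⟨δ / 2, L, by positivity, hL1, hK, ?_, ?_, ?_, ?_, ?_, ?_, ?_⟩
  · intro t ht y hy v
    rcases eq_or_ne v 0 with rfl | hv
    · simp
    · have hv' : 0 < ‖v‖ := norm_pos_iff.2 hv
      have he : ‖v‖⁻¹ • v ∈ Metric.sphere (0 : Eu m) 1 := by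
        rw [mem_sphere_zero_iff_norm, norm_smul, norm_inv, norm_norm, inv_mul_cancel₀ hv'.ne']
      have h1 := hC7 ((t, y), ‖v‖⁻¹ • v) ⟨mem t ht y hy, he⟩
      have h2 := 𝓜.sigRep_pos hι (hK hy) t hv
      simp only [map_smul, _root_.smul_apply, smul_eq_mul] at h1
      rw [Real.norm_eq_abs, abs_of_pos (by positivity), mul_inv, mul_inv, inv_inv] at h1
      have h3 : ‖v‖ * (‖v‖ * (𝓜.sigRep ι c p t y v v)⁻¹) ≤ L := by
        have := le_abs_self C7
        linarith
      rw [← mul_assoc, ← div_eq_mul_inv, div_le_iff₀ h2] at h3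
      rw [sq]
      exact h3
  · intro t ht y hy v
    rw [SplitMetric.sigRep_apply]
    have h1 := (le_abs_self _).trans ((𝓜.sHat p (t, hRep ι c p y)).le_opNorm₂ (hD ι c p y v)
      (hD ι c p y v))
    have h2 : ‖𝓜.sHat p (t, hRep ι c p y)‖ ≤ |C1| := (hC1 _ (mem t ht y hy)).trans (le_abs_self C1)
    have h3 := hDle y hy v
    calc _ ≤ _ := h1
      _ ≤ |C1| * (|C2| * ‖v‖) * (|C2| * ‖v‖) := by gcongr
      _ = (|C1| * |C2| * |C2|) * ‖v‖ ^ 2 := by ring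
      _ ≤ L * ‖v‖ ^ 2 := by gcongr; linarith
  · intro t ht y hy
    have h1 := hC4 _ (mem t ht y hy)
    have h2 := 𝓜.lapse_pos ((stChart (m := m) p).symm (t, hRep ι c p y))
    rw [Pi.inv_apply, Real.norm_eq_abs, abs_of_pos (inv_pos.2 h2)] at h1
    rw [one_div]
    refine inv_le_of_inv_le₀ h2 (h1.trans ?_)
    have := le_abs_self C4
    linarith
  · intro t ht y hy
    have h1 := (le_abs_self _).trans (hC3 _ (mem t ht y hy))
    have := le_abs_self C3
    exact h1.trans (by linarith)
  · intro t ht y hy a b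
    have h2 : ‖fderiv ℝ (𝓜.gHat p) (t, hRep ι c p y)‖ ≤ L :=
      (hC5 _ (mem t ht y hy)).trans ((le_abs_self C5).trans (by linarith))
    have h3 : ‖fderiv ℝ (𝓜.gHat p) (t, hRep ι c p y) (1, 0)‖ ≤ L :=
      ((fderiv ℝ (𝓜.gHat p) (t, hRep ι c p y)).le_opNorm (1, 0)).trans (by simpa using h2)
    refine ((fderiv ℝ (𝓜.gHat p) (t, hRep ι c p y) (1, 0)).le_opNorm₂ a b).trans ?_
    gcongr
  · intro y hy v
    refine (hDle y hy v).trans ?_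
    gcongr
    linarith
  · intro t ht y hy b
    refine ((𝓜.gHat p (t, hRep ι c p y) (vecRep X p (t, hRep ι c p y))).le_opNorm b).trans ?_
    gcongr
    exact (hC6 _ (mem t ht y hy)).trans ((le_abs_self C6).trans (by linarith))

end GoodCharts

/-! ### The local estimate -/

section LocalEstimate

open Matrix

set_option maxSynthPendingDepth 3
set_option synthInstance.maxHeartbeats 200000

variable {m : ℕ} [NeZero m] {N : Type*} [TopologicalSpace N] [ChartedSpace (EuclideanHalfSpace m) N]
  [IsManifold (𝓡∂ m) ∞ N]
  {S : Type*} [TopologicalSpace S] [ChartedSpace (EuclideanSpace ℝ (Fin m)) S]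
  [IsManifold (𝓡 m) ∞ S] {𝓜 : SplitMetric m S} {ι : N → ℝ × S}
  {X : ∀ p : ℝ × S, TangentSpace (stModel m) p} {T : ℝ} {c : N} {ε L : ℝ} {u ρ : N → ℝ} {y : Eu m}

theorem abs_det_le {m : ℕ} {M : Matrix (Fin m) (Fin m) ℝ} {x : ℝ} (h : ∀ i j, |M i j| ≤ x) :
    |M.det| ≤ m.factorial * x ^ m := by
  have := Matrix.det_le (A := M) (abv := AbsoluteValue.abs) (x := x) h
  simpa using this

theorem norm_eb {m : ℕ} (i : Fin m) : ‖(eb i : Eu m)‖ = 1 := by simp [eb]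

theorem SplitMetric.sHat_symm (𝓜 : SplitMetric m S) (p : ℝ × S) (z : ℝ × Eu m) (a b : Eu m) :
    𝓜.sHat p z a b = 𝓜.sHat p z b a := by
  rw [sHat_apply, sHat_apply, sigHat_symm]

/-- The tilt function in a chart. -/
def SplitMetric.tiltRep (𝓜 : SplitMetric m S) (ι : N → ℝ × S) (u : N → ℝ) (c : N) (y : Eu m) : ℝ :=
  1 / √(1 - 𝓜.gradSq ι u c y)

/-- Identifies the spatial Gram matrix of the coordinate computation with `σ_u`; at interior points
one-sided derivatives are ordinary ones. -/
theorem spatialGram_eq (hι : 𝓜.IsCompactSpacelike ι) (hu : ContMDiff (𝓡∂ m) 𝓘(ℝ, ℝ) ∞ u)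
    {p : ℝ × S} (hy : y ∈ nDom c p ι) (hi : y ∈ interior (range (𝓡∂ m))) :
    spatialGram (𝓜.sHat p (nRep c p (graphMap ι u) y)) (nRep c p (graphMap ι u)) y
      = chartGram (𝓡∂ m) (𝓜.sigU ι u) c y := by
  ext i j
  rw [𝓜.chartGram_sigU hι.smooth hu hy, spatialGram, Matrix.of_apply, Matrix.of_apply,
    ← fderivWithin_eq_fderiv_of_interior _ hi, fderivWithin_nRep_graphMap hι.smooth hu hy,
    fderivWithin_nRep_graphMap hι.smooth hu hy, nRep_graphMap, SplitMetric.sigRep_apply]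

theorem slope_eq (hι : 𝓜.IsCompactSpacelike ι) (hu : ContMDiff (𝓡∂ m) 𝓘(ℝ, ℝ) ∞ u)
    {p : ℝ × S} (hy : y ∈ nDom c p ι) (hi : y ∈ interior (range (𝓡∂ m))) :
    slope (nRep c p (graphMap ι u)) y = uSlope u c y := by
  ext k
  rw [slope, ← fderivWithin_eq_fderiv_of_interior _ hi,
    fderivWithin_nRep_graphMap hι.smooth hu hy]
  rfl

theorem symm_mem_interior (hy : y ∈ (nChart (m := m) c).target)
    (hi : y ∈ interior (range (𝓡∂ m))) : (nChart c).symm y ∈ (𝓡∂ m).interior N := by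
  rw [mem_interior_iff ((nChart (m := m) c).map_target hy), (nChart (m := m) c).right_inv hy]
  exact hi

theorem gradSq_lt_one (hι : 𝓜.IsCompactSpacelike ι) (hu : 𝓜.IsSmoothSolution ι X ρ u)
    {p : ℝ × S} (hy : y ∈ nDom c p ι) (hi : y ∈ interior (range (𝓡∂ m))) :
    𝓜.gradSq ι u c y < 1 := by
  have h := hu.spacelike _ (symm_mem_interior hy.1 hi)
  rw [𝓜.gradNorm_eq hι hu.smooth hy] at h
  by_contra hcon
  have := Real.one_le_sqrt.2 (not_lt.1 hcon)
  linarith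

namespace GoodChart

theorem pos_L (hG : GoodChart 𝓜 ι X T c ε L) : 0 < L := by
  linarith [hG.one_le]

theorem lower_gram (hG : GoodChart 𝓜 ι X T c ε L) (hι : 𝓜.IsCompactSpacelike ι)
    (hu : ContMDiff (𝓡∂ m) 𝓘(ℝ, ℝ) ∞ u) (hT : ∀ x, |u x| ≤ T)
    (hy : y ∈ halfBall (m := m) c ε) (v : Fin m → ℝ) :
    1 / L * (v ⬝ᵥ v) ≤ v ⬝ᵥ chartGram (𝓡∂ m) (𝓜.sigU ι u) c y *ᵥ v := by
  rw [𝓜.chartGram_sigU hι.smooth hu (hG.subset hy)]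
  have h1 := hG.lower (uRep u c y) (hT _) y hy (WithLp.toLp 2 v)
  have h2 := dot_gram_mulVec (𝓜.sigRep ι c (ctr ι c) (uRep u c y) y)
    (WithLp.toLp 2 v) (WithLp.toLp 2 v)
  rw [← h2, ← dot_self_eq] at h1
  rw [div_mul_eq_mul_div, one_mul, div_le_iff₀' hG.pos_L]
  exact h1

/-- Since `|du|_{σ_u} < 1` and `σ_u` is at most `L` times the Euclidean metric, the coordinate
gradient of `u` is at most `√L ≤ L`, with no regularity theory. -/
theorem slope_sq_le (hG : GoodChart 𝓜 ι X T c ε L) (hι : 𝓜.IsCompactSpacelike ι)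
    (hu : 𝓜.IsSmoothSolution ι X ρ u) (hT : ∀ x, |u x| ≤ T)
    (hy : y ∈ halfBall (m := m) c ε) (hi : y ∈ interior (range (𝓡∂ m))) (v : Eu m) :
    |uSlope u c y ⬝ᵥ v.ofLp| ≤ L * ‖v‖ := by
  have hyd := hG.subset hy
  have h1 := dot_sq_le_sqn (𝓜.posDef_chartGram hι hu.smooth hyd) (uSlope u c y) v.ofLp
  have h2 : sqn (chartGram (𝓡∂ m) (𝓜.sigU ι u) c y) (uSlope u c y) < 1 :=
    gradSq_lt_one hι hu hyd hi
  have h3 := hG.upper (uRep u c y) (hT _) y hy v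
  rw [𝓜.chartGram_sigU hι.smooth hu.smooth hyd] at h1 h2
  rw [dot_gram_mulVec] at h1
  have h4 : 0 ≤ 𝓜.sigRep ι c (ctr ι c) (uRep u c y) y v v := by
    have := hG.lower _ (hT ((nChart (m := m) c).symm y)) y hy v
    have h5 := hG.pos_L
    exact nonneg_of_mul_nonneg_right ((sq_nonneg _).trans this) h5
  refine abs_le_of_sq_le_sq ?_ (mul_nonneg hG.pos_L.le (norm_nonneg v))
  calc _ ≤ _ := h1
    _ ≤ 1 * 𝓜.sigRep ι c (ctr ι c) (uRep u c y) y v v := by gcongr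
    _ ≤ L * ‖v‖ ^ 2 := by rw [one_mul]; exact h3
    _ ≤ (L * ‖v‖) ^ 2 := by
      rw [mul_pow]
      have := hG.one_le
      gcongr
      nlinarith

/-- Expand the quadratic form at `a + b` and `a - b`, where it is at most `4L`, and drop the
nonnegative squares. -/
theorem abs_sigRep_le (hG : GoodChart 𝓜 ι X T c ε L) {t : ℝ} (ht : |t| ≤ T)
    (hy : y ∈ halfBall (m := m) c ε) {a b : Eu m} (ha : ‖a‖ ≤ 1) (hb : ‖b‖ ≤ 1) :
    |𝓜.sigRep ι c (ctr ι c) t y a b| ≤ 2 * L := by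
  have h1 := hG.upper t ht y hy (a + b)
  have h2 := hG.upper t ht y hy (a - b)
  have hpos : ∀ v, 0 ≤ 𝓜.sigRep ι c (ctr ι c) t y v v := fun v =>
    nonneg_of_mul_nonneg_right ((sq_nonneg _).trans (hG.lower t ht y hy v)) hG.pos_L
  have h3 := hpos a
  have h4 := hpos b
  have h5 := 𝓜.sigRep_symm (ι := ι) (c := c) (p := ctr ι c) t y a b
  have h6 : ‖a + b‖ ^ 2 ≤ 4 := by nlinarith [norm_add_le a b, norm_nonneg (a + b)]
  have h7 : ‖a - b‖ ^ 2 ≤ 4 := by nlinarith [norm_sub_le a b, norm_nonneg (a - b)]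
  have h8 := mul_le_mul_of_nonneg_left h6 hG.pos_L.le
  have h9 := mul_le_mul_of_nonneg_left h7 hG.pos_L.le
  simp only [map_add, map_sub, _root_.add_apply, _root_.sub_apply] at h1 h2
  rw [abs_le]
  constructor <;> linarith

theorem volDensity_le (hG : GoodChart 𝓜 ι X T c ε L) (hι : 𝓜.IsCompactSpacelike ι)
    (hu : ContMDiff (𝓡∂ m) 𝓘(ℝ, ℝ) ∞ u) (hT : ∀ x, |u x| ≤ T)
    (hy : y ∈ halfBall (m := m) c ε) :
    volDensity (𝓜.sigU ι u) c y ≤ 1 + m.factorial * (2 * L) ^ m := by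
  have h1 := abs_det_le (M := chartGram (𝓡∂ m) (𝓜.sigU ι u) c y) (x := 2 * L) (fun i j => by
    rw [𝓜.chartGram_sigU hι.smooth hu (hG.subset hy), Matrix.of_apply]
    exact hG.abs_sigRep_le (t := uRep u c y) (hT _) hy (norm_eb i).le (norm_eb j).le)
  rw [volDensity]
  refine Real.sqrt_le_iff.2 ⟨?_, ?_⟩
  · have := hG.pos_L
    positivity
  · have h2 := le_abs_self (chartGram (𝓡∂ m) (𝓜.sigU ι u) c y).det
    have h3 : 0 ≤ (m.factorial : ℝ) * (2 * L) ^ m := (abs_nonneg _).trans h1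
    nlinarith

theorem tiltRep_eq (hG : GoodChart 𝓜 ι X T c ε L) (hι : 𝓜.IsCompactSpacelike ι)
    (hu : ContMDiff (𝓡∂ m) 𝓘(ℝ, ℝ) ∞ u) (hy : y ∈ halfBall (m := m) c ε) :
    𝓜.tilt ι u ((nChart c).symm y) = 𝓜.tiltRep ι u c y :=
  𝓜.tilt_eq hι hu (hG.subset hy)

/-- The constant of the local estimate. -/
def energyConst (m : ℕ) (L : ℝ) : ℝ :=
  L ^ m * (m ^ 2 * L ^ 6 + L ^ 3 * (1 + m * L ^ 2) + L + m * L)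

set_option maxHeartbeats 1000000 in
theorem local_estimate (hG : GoodChart 𝓜 ι X T c ε L) (hι : 𝓜.IsCompactSpacelike ι)
    (hu : 𝓜.IsSmoothSolution ι X ρ u) (hρ : ContMDiff (𝓡∂ m) 𝓘(ℝ, ℝ) ∞ ρ)
    (hT : ∀ x, |u x| ≤ T) {y0 : Eu m} {R t : ℝ} (ht0 : 0 < t) (htR : t ≤ R / 2)
    (hsub : Metric.closedBall y0 R ⊆ halfBall (m := m) c ε)
    (hint : Metric.closedBall y0 R ⊆ interior (range (𝓡∂ m))) :
    ∫ y in Metric.closedBall y0 t, volDensity (𝓜.sigU ι u) c y * 𝓜.tiltRep ι u c y ≤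
      L ^ m * (32 * (L * t) * energyConst m L * ((1 + 1 / R) *
        (∫ y in Metric.closedBall y0 R, volDensity (𝓜.sigU ι u) c y * 𝓜.tiltRep ι u c y) +
        ∫ y in Metric.closedBall y0 R, volDensity (𝓜.sigU ι u) c y * |ρ ((nChart c).symm y)|)) +
      (1 + m.factorial * (2 * L) ^ m) * (t ^ m *
        (volume (Metric.closedBall (0 : Eu m) 1)).toReal) := by
  have hL := hG.pos_L
  have hL1 := hG.one_le
  have hR : 0 < R := by linarith
  set p := ctr ι c with hp
  set f : Eu m → ℝ × Eu m := nRep c p (graphMap ι u) with hf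
  set B := 𝓜.gHat p with hB
  have hF := contMDiff_graphMap hι.smooth hu.smooth
  have hyd : ∀ y ∈ Metric.closedBall y0 R, y ∈ nDom c p ι := fun y hy => hG.subset (hsub hy)
  have hyd' : ∀ y ∈ Metric.closedBall y0 R, y ∈ nDom c p (graphMap ι u) := fun y hy => by
    rw [nDom_graphMap]
    exact hyd y hy
  have hfc : ∀ y ∈ Metric.closedBall y0 R, ContDiffAt ℝ 2 f y := fun y hy =>
    (contDiffAt_nRep hF (hyd' y hy) (hint hy)).of_le two_le_infty
  have hft : ∀ y ∈ Metric.closedBall y0 R, f y ∈ (stChart (m := m) p).target := fun y hy =>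
    nRep_mem_target (hyd' y hy)
  have hBc : ∀ y ∈ Metric.closedBall y0 R, ContDiffAt ℝ 1 B (f y) := fun y hy =>
    (𝓜.contDiffAt_gHat (hft y hy)).of_le (by simp)
  set α : Eu m → ℝ := fun y => 𝓜.lapse ((stChart (m := m) p).symm (f y)) with hα
  have hfy : ∀ y, f y = (uRep u c y, hRep ι c p y) := fun y => nRep_graphMap y
  have hBf : ∀ y ∈ Metric.closedBall y0 R, ∀ a b,
      B (f y) a b = α y ^ 2 * (-(a.1 * b.1) + 𝓜.sHat p (f y) a.2 b.2) := fun y hy =>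
    𝓜.gHat_eq_sHat (hft y hy)
  have hα0 : ∀ y, 0 < α y := fun y => 𝓜.lapse_pos _
  have hα1 : ∀ y ∈ Metric.closedBall y0 R, 1 / L ≤ α y := fun y hy => by
    simp only [hα, hfy]
    exact hG.lapse_lower (uRep u c y) (hT _) y (hsub hy)
  have hα2 : ∀ y ∈ Metric.closedBall y0 R, α y ≤ L := fun y hy => by
    simp only [hα, hfy]
    exact hG.lapse_upper (uRep u c y) (hT _) y (hsub hy)
  have hsp : ∀ y ∈ Metric.closedBall y0 R, spatialGram (𝓜.sHat p (f y)) f y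
      = chartGram (𝓡∂ m) (𝓜.sigU ι u) c y := fun y hy =>
    spatialGram_eq hι hu.smooth (hyd y hy) (hint hy)
  have hsl : ∀ y ∈ Metric.closedBall y0 R, slope f y = uSlope u c y := fun y hy =>
    slope_eq hι hu.smooth (hyd y hy) (hint hy)
  have hpd : ∀ y ∈ Metric.closedBall y0 R, (spatialGram (𝓜.sHat p (f y)) f y).PosDef :=
    fun y hy => by
      rw [hsp y hy]
      exact 𝓜.posDef_chartGram hι hu.smooth (hyd y hy)
  have hsq : ∀ y ∈ Metric.closedBall y0 R,
      sqn (spatialGram (𝓜.sHat p (f y)) f y) (slope f y) = 𝓜.gradSq ι u c y := fun y hy => by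
    rw [hsp y hy, hsl y hy]
    rfl
  have hq : ∀ y ∈ Metric.closedBall y0 R,
      sqn (spatialGram (𝓜.sHat p (f y)) f y) (slope f y) < 1 := fun y hy => by
    rw [hsq y hy]
    exact gradSq_lt_one hι hu (hyd y hy) (hint hy)
  have hflux : ∀ y ∈ Metric.closedBall y0 R, ∀ k, flux B f y k = α y ^ m *
      volDensity (𝓜.sigU ι u) c y * 𝓜.tiltRep ι u c y *
      sharp (chartGram (𝓡∂ m) (𝓜.sigU ι u) c y) (uSlope u c y) k := fun y hy k => by
    rw [flux_eq (hBf y hy) (hpd y hy) (hα0 y) (hq y hy), hsq y hy, hsp y hy, hsl y hy]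
    rfl
  have hw0 : ∀ y, 0 ≤ 𝓜.tiltRep ι u c y := fun y => by
    rw [SplitMetric.tiltRep]
    positivity
  have hv0 : ∀ y, 0 ≤ volDensity (𝓜.sigU ι u) c y := volDensity_nonneg c
  have hrange : ∀ y ∈ Metric.closedBall y0 R, range (𝓡∂ m) ∈ 𝓝 y := fun y hy =>
    mem_interior_iff_mem_nhds.1 (hint hy)
  have hud : ∀ y ∈ Metric.closedBall y0 R, ContDiffAt ℝ 1 (uRep u c) y := fun y hy =>
    ((contDiffWithinAt_uRep hu.smooth (hyd y hy).1).contDiffAt (hrange y hy)).of_le (by simp)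
  have hufd : ∀ y ∈ Metric.closedBall y0 R, ∀ v, fderiv ℝ (uRep u c) y v
      = uSlope u c y ⬝ᵥ v.ofLp := fun y hy v => by
    rw [← apply_uSlope, fderivWithin_eq_fderiv_of_interior _ (hint hy)]
  have hcv : ContinuousOn (volDensity (𝓜.sigU ι u) c) (Metric.closedBall y0 R) :=
    ((𝓜.isContMetric_sigU hι.smooth hu.smooth).continuousOn_volDensity c).mono
      fun y hy => (hyd y hy).1
  have hcw : ContinuousOn (𝓜.tiltRep ι u c) (Metric.closedBall y0 R) := fun y hy => by
    have h1 : ContinuousAt (𝓜.gradSq ι u c) y :=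
      (𝓜.continuousWithinAt_gradSq hι hu.smooth (hyd y hy)).continuousAt (hrange y hy)
    have h2 : 0 < 1 - 𝓜.gradSq ι u c y := by
      have := hq y hy
      rw [hsq y hy] at this
      linarith
    exact (continuousAt_const.div (continuousAt_const.sub h1).sqrt
      (Real.sqrt_pos.2 h2).ne').continuousWithinAt
  have hcr : ContinuousOn (fun y => |ρ ((nChart (m := m) c).symm y)|) (Metric.closedBall y0 R) :=
    (hρ.continuous.comp_continuousOn ((continuousOn_nChart_symm c).mono
      fun y hy => (hyd y hy).1)).abs
  have hαm : ∀ y ∈ Metric.closedBall y0 R, α y ^ m ≤ L ^ m := fun y hy =>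
    pow_le_pow_left₀ (hα0 y).le (hα2 y hy) m
  set Wt : Eu m → ℝ := fun y => volDensity (𝓜.sigU ι u) c y * 𝓜.tiltRep ι u c y with hWt
  set Rt : Eu m → ℝ := fun y => volDensity (𝓜.sigU ι u) c y * |ρ ((nChart c).symm y)| with hRt
  have hWt0 : ∀ y, 0 ≤ Wt y := fun y => mul_nonneg (hv0 y) (hw0 y)
  have hRt0 : ∀ y, 0 ≤ Rt y := fun y => mul_nonneg (hv0 y) (abs_nonneg _)
  -- The pairing of the flux with `du`.
  set A : Eu m → ℝ := fun y => α y ^ m * Wt y * 𝓜.gradSq ι u c y with hA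
  have hK0 : 0 ≤ energyConst m L := by
    rw [energyConst]
    positivity
  -- The truncation height is `L t`, since `u` is `L`-Lipschitz in the coordinates and so oscillates
  -- by at most `L t` on the small ball.
  have hmain := local_energy (c := y0) (R := R) (T := L * t) (K := energyConst m L) (v := uRep u c)
    (V := flux B f) (Wt := Wt) (Rt := Rt) (A := A) hR (by positivity) hK0 (hcv.mul hcw)
    (hcv.mul hcr) hud ?_ ?_ ?_ ?_ ?_ (fun y _ => hWt0 y) (fun y _ => hRt0 y) htR ?_
  · have hss : Metric.closedBall y0 t ⊆ Metric.closedBall y0 R :=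
      Metric.closedBall_subset_closedBall (by linarith)
    have hcα : ContinuousOn α (Metric.closedBall y0 R) := fun y hy =>
      (ContinuousAt.comp (f := f) ((𝓜.contDiffOn_lapse p).continuousOn.continuousAt
        ((isOpen_stChart_target p).mem_nhds (hft y hy))) (hfc y hy).continuousAt).continuousWithinAt
    have hcq : ContinuousOn (𝓜.gradSq ι u c) (Metric.closedBall y0 R) := fun y hy =>
      ((𝓜.continuousWithinAt_gradSq hι hu.smooth (hyd y hy)).continuousAt
        (hrange y hy)).continuousWithinAt
    have hcA : ContinuousOn A (Metric.closedBall y0 R) :=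
      ((hcα.pow m).mul (hcv.mul hcw)).mul hcq
    -- Here the energy density controls the tilt: `w = w |du|² + 1/w`, the last term being at most
    -- `1`. The factor `L ^ m` compensates the lapse, which is at least `1/L`.
    have hpt : ∀ y ∈ Metric.closedBall y0 t,
        Wt y ≤ L ^ m * A y + (1 + m.factorial * (2 * L) ^ m) := fun y hy' => by
      have hy := hss hy'
      have h1 := hG.volDensity_le hι hu.smooth hT (hsub hy)
      have h2 : 0 < 1 - 𝓜.gradSq ι u c y := by
        have := hq y hy
        rw [hsq y hy] at this
        linarith
      have h3 : 𝓜.tiltRep ι u c y = 𝓜.tiltRep ι u c y * 𝓜.gradSq ι u c y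
          + √(1 - 𝓜.gradSq ι u c y) := by
        rw [SplitMetric.tiltRep]
        have h4 := Real.sq_sqrt h2.le
        have h5 := Real.sqrt_pos.2 h2
        field_simp
        linarith
      have h6 : √(1 - 𝓜.gradSq ι u c y) ≤ 1 := by
        refine Real.sqrt_le_one.2 ?_
        linarith [𝓜.gradSq_nonneg hι hu.smooth (hyd y hy)]
      have h7 : 1 ≤ L ^ m * α y ^ m := by
        rw [← mul_pow]
        refine one_le_pow₀ ?_
        have := hα1 y hy
        rwa [div_le_iff₀' hL] at this
      have h8 : 0 ≤ Wt y * 𝓜.gradSq ι u c y :=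
        mul_nonneg (hWt0 y) (𝓜.gradSq_nonneg hι hu.smooth (hyd y hy))
      calc Wt y = Wt y * 𝓜.gradSq ι u c y
            + volDensity (𝓜.sigU ι u) c y * √(1 - 𝓜.gradSq ι u c y) := by
            simp only [hWt]
            conv_lhs => rw [h3]
            ring
        _ ≤ (L ^ m * α y ^ m) * (Wt y * 𝓜.gradSq ι u c y) +
            (1 + m.factorial * (2 * L) ^ m) * 1 := by
            refine add_le_add (le_mul_of_one_le_left h8 h7) ?_
            exact mul_le_mul h1 h6 (Real.sqrt_nonneg _) ((hv0 y).trans h1)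
        _ = L ^ m * A y + (1 + m.factorial * (2 * L) ^ m) := by
            simp only [hA]
            ring
    have hiW : IntegrableOn Wt (Metric.closedBall y0 t) :=
      ((hcv.mul hcw).mono hss).integrableOn_compact (isCompact_closedBall y0 t)
    have hiA : IntegrableOn A (Metric.closedBall y0 t) :=
      (hcA.mono hss).integrableOn_compact (isCompact_closedBall y0 t)
    have hic : IntegrableOn (fun _ : Eu m => 1 + m.factorial * (2 * L) ^ m)
        (Metric.closedBall y0 t) :=
      continuousOn_const.integrableOn_compact (isCompact_closedBall y0 t)
    have h1 := setIntegral_mono_on hiW ((hiA.const_mul (L ^ m)).add hic)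
      Metric.isClosed_closedBall.measurableSet hpt
    refine h1.trans ?_
    simp only [Pi.add_apply]
    rw [integral_add (hiA.const_mul (L ^ m)) hic, integral_const_mul, setIntegral_const,
      smul_eq_mul, measureReal_def, Measure.addHaar_closedBall' _ _ ht0.le, ENNReal.toReal_mul,
      ENNReal.toReal_ofReal (by positivity), finrank_euclideanSpace_fin,
      mul_comm (t ^ m * _) (1 + _)]
    gcongr
  · intro y hy k
    have h0 : (gramF B f y).det ≠ 0 := (det_gramF_pos (hBf y hy) (hpd y hy) (hα0 y) (hq y hy)).ne'
    have h1 := contDiffAt_sqrt_det_gramF (hBc y hy) (hfc y hy) h0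
    have h2 := contDiffAt_tanPart (hBc y hy) (hfc y hy) h0 (1, 0) k
    exact (h1.mul h2).neg
  · intro y hy
    have h1 : 𝓜.gradSq ι u c y = ∑ k, uSlope u c y k *
      sharp (chartGram (𝓡∂ m) (𝓜.sigU ι u) c y) (uSlope u c y) k := rfl
    simp only [hA, hWt]
    rw [h1, Finset.mul_sum]
    refine Finset.sum_congr rfl fun k _ => ?_
    rw [hflux y hy k, hufd y hy]
    have h2 : uSlope u c y ⬝ᵥ (eb k : Eu m).ofLp = uSlope u c y k := by
      simp [eb]
    rw [h2]
    ring
  · intro y hy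
    exact mul_nonneg (mul_nonneg (pow_nonneg (hα0 y).le m) (hWt0 y))
      (𝓜.gradSq_nonneg hι hu.smooth (hyd y hy))
  · intro y hy ℓ
    have h1 : ∀ k, |ℓ (eb k) * flux B f y k| ≤ ‖ℓ‖ * (L ^ m * Wt y * L) := fun k => by
      rw [abs_mul]
      refine mul_le_mul ?_ ?_ (abs_nonneg _) (norm_nonneg _)
      · have := ℓ.le_opNorm (eb k)
        simpa [eb] using this
      · rw [hflux y hy k, abs_mul, mul_assoc (α y ^ m), abs_mul,
          abs_of_nonneg (pow_nonneg (hα0 y).le m), abs_of_nonneg (hWt0 y)]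
        refine mul_le_mul (mul_le_mul_of_nonneg_right (hαm y hy) (hWt0 y)) ?_ (abs_nonneg _)
          (mul_nonneg (by positivity) (hWt0 y))
        refine abs_sharp_le (𝓜.posDef_chartGram hι hu.smooth (hyd y hy)) ?_ (by positivity) hL1 rfl
          (hG.lower_gram hι hu.smooth hT (hsub hy)) k
        exact gradSq_lt_one hι hu (hyd y hy) (hint hy)
    calc |∑ k, ℓ (eb k) * flux B f y k| ≤ ∑ k, |ℓ (eb k) * flux B f y k| :=
          Finset.abs_sum_le_sum_abs _ _
      _ ≤ ∑ _k : Fin m, ‖ℓ‖ * (L ^ m * Wt y * L) := Finset.sum_le_sum fun k _ => h1 k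
      _ = (L ^ m * (m * L)) * (‖ℓ‖ * Wt y) := by
          rw [Finset.sum_const, Finset.card_univ, Fintype.card_fin, nsmul_eq_mul]
          ring
      _ ≤ energyConst m L * (‖ℓ‖ * Wt y) := by
          refine mul_le_mul_of_nonneg_right ?_ (mul_nonneg (norm_nonneg _) (hWt0 y))
          rw [energyConst]
          refine mul_le_mul_of_nonneg_left ?_ (by positivity)
          have : 0 ≤ (m : ℝ) ^ 2 * L ^ 6 + L ^ 3 * (1 + m * L ^ 2) + L := by positivity
          linarith
      _ = energyConst m L * ‖ℓ‖ * Wt y := by ring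
  · intro y hy
    set x := (nChart (m := m) c).symm y with hx
    have hxs : x ∈ (nChart (m := m) c).source := (nChart (m := m) c).map_target (hyd y hy).1
    have hxy : nChart (m := m) c x = y := (nChart (m := m) c).right_inv (hyd y hy).1
    have hxi := symm_mem_interior (hyd y hy).1 (hint hy)
    have hps : graphMap ι u x ∈ (stChart (m := m) p).source := (hyd' y hy).2
    have hzf : stChart (m := m) p (graphMap ι u x) = f y := rfl
    obtain ⟨n, hn, hH⟩ := hu.equation x hxi
    -- The unit normal of the equation is pulled back to the fixed chart, where it is again normal,
    -- unit and future pointing.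
    obtain ⟨n', hn'⟩ := SplitMetric.stD_surjective (hft y hy) n
    have hgb : ∀ a b : ℝ × Eu m, ∀ (v w : TangentSpace (stModel m) (graphMap ι u x)),
        stD p (f y) a = v → stD p (f y) b = w → B (f y) a b = 𝓜.gbar (graphMap ι u x) v w := by
      rintro a b v w rfl rfl
      have key : ∀ q q' : ℝ × S, q = q' → ∀ a b : ℝ × Eu m, 𝓜.gbar q a b = 𝓜.gbar q' a b := by
        rintro _ _ rfl a b
        rfl
      exact (𝓜.gHat_eq (hft y hy) a b).trans (key _ _ (stChart_symm_nRep (hyd' y hy)) _ _)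
    have hdm : ∀ v, stD p (f y) (fderiv ℝ f y v) = dMap (graphMap ι u) x (nD c y v) := fun v => by
      rw [← fderivWithin_eq_fderiv_of_interior _ (hint hy)]
      exact (dMap_nD hF (hyd' y hy) v).symm
    have hH' : mcurv B f y n' = ρ x + B (f y) (vecRep X p (f y)) n' := by
      have h1 := 𝓜.meanCurvature_eq hF hxs hxi hps (n := n') (n' := n) hn' hn.normal
      rw [hxy] at h1
      rw [← h1, hH]
      exact congrArg (ρ x + ·) (𝓜.gHat_vecRep X hps n' hn').symm
    have hn0 : 0 < n'.1 := by
      have h1 := stD_fst (hft y hy) n'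
      have key : ∀ q q' : ℝ × S, q = q' → ∀ a : ℝ × Eu m, dtau (m := m) q a = dtau (m := m) q' a := by
        rintro _ _ rfl a
        rfl
      rw [← h1]
      refine lt_of_lt_of_eq hn.future ?_
      rw [hn']
      exact key _ _ (stChart_symm_nRep (hyd' y hy)).symm _
    have hfin := abs_div_flux_le (α := α y) (L := L) (ρ := ρ x) (hBc y hy) (hfc y hy)
      (Eventually.of_forall fun z a b => 𝓜.gHat_symm p z a b) (hBf y hy)
      (𝓜.sHat_symm p (f y)) hL1
      (by rw [hsp y hy]; exact hG.lower_gram hι hu.smooth hT (hsub hy))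
      (hα1 y hy) (hα2 y hy) (hq y hy)
      (fun v => (hgb _ _ _ _ hn' (hdm v)).trans (hn.normal _))
      ((hgb _ _ _ _ hn' hn').trans hn.unit) hn0
      (by rw [hfy]; exact hG.deriv_le (uRep u c y) (hT _) y (hsub hy))
      (fun k => by
        rw [← fderivWithin_eq_fderiv_of_interior _ (hint hy), hf,
          fderivWithin_nRep_graphMap hι.smooth hu.smooth (hyd y hy)]
        refine max_le ?_ ?_
        · rw [Real.norm_eq_abs, apply_uSlope]
          have := hG.slope_sq_le hι hu hT (hsub hy) (hint hy) (eb k)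
          simpa [eb] using this
        · have := hG.hD_le y (hsub hy) (eb k)
          simpa [eb] using this)
      (by rw [hfy]; exact hG.vec_le (uRep u c y) (hT _) y (hsub hy)) hH'
    rw [hsq y hy, hsp y hy] at hfin
    refine hfin.trans ?_
    have e1 : √(chartGram (𝓡∂ m) (𝓜.sigU ι u) c y).det = volDensity (𝓜.sigU ι u) c y := rfl
    have e2 : 1 / √(1 - 𝓜.gradSq ι u c y) = 𝓜.tiltRep ι u c y := rfl
    rw [e1, e2]
    calc _ = α y ^ m * ((m ^ 2 * L ^ 6 + L ^ 3 * (1 + m * L ^ 2)) * Wt y + L * Rt y) := by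
          simp only [hWt, hRt]
          ring
      _ ≤ L ^ m * ((m ^ 2 * L ^ 6 + L ^ 3 * (1 + m * L ^ 2) + L + m * L) * Wt y
          + (m ^ 2 * L ^ 6 + L ^ 3 * (1 + m * L ^ 2) + L + m * L) * Rt y) := by
          have hW := hWt0 y
          have hRR := hRt0 y
          have hα' := hαm y hy
          have hα'' := (pow_pos (hα0 y) m).le
          have a1 : 0 ≤ (m : ℝ) ^ 2 * L ^ 6 + L ^ 3 * (1 + m * L ^ 2) := by positivity
          have a2 : 0 ≤ (m : ℝ) * L := by positivity
          exact mul_le_mul hα' (add_le_add (mul_le_mul_of_nonneg_right (by linarith) hW)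
            (mul_le_mul_of_nonneg_right (by linarith) hRR)) (by positivity) (by positivity)
      _ = energyConst m L * (Wt y + Rt y) := by
          rw [energyConst]
          ring
  · intro y hy'
    have hss : Metric.closedBall y0 t ⊆ Metric.closedBall y0 R :=
      Metric.closedBall_subset_closedBall (by linarith)
    have h1 := Convex.norm_image_sub_le_of_norm_fderiv_le (𝕜 := ℝ) (f := uRep u c) (C := L)
      (s := Metric.closedBall y0 t) (x := y0) (y := y)
      (fun z hz => (hud z (hss hz)).differentiableAt (by simp))
      (fun z hz => ContinuousLinearMap.opNorm_le_bound _ hL.le fun v => by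
        rw [hufd z (hss hz) v]
        exact hG.slope_sq_le hι hu hT (hsub (hss hz)) (hint (hss hz)) v)
      (convex_closedBall y0 t) (Metric.mem_closedBall_self ht0.le) hy'
    rw [Real.norm_eq_abs] at h1
    refine h1.trans ?_
    gcongr
    rw [← dist_eq_norm]
    exact hy'

end GoodChart

end LocalEstimate

/-! ### Causal curves in charts -/

section CausalCurves

variable {m : ℕ} [NeZero m] {S : Type*} [TopologicalSpace S]
  [ChartedSpace (EuclideanSpace ℝ (Fin m)) S] [IsManifold (𝓡 m) ∞ S]

/-- Causal curves on `[0, ∞)`, in terms of the right derivatives in charts. They are past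
pointing for `κ = 1` and future pointing for `κ = -1`. -/
structure CausalCurve (𝓜 : SplitMetric m S) (κ : ℝ) (γ : ℝ → ℝ × S) : Prop where
  cont : ContinuousOn γ (Ici 0)
  deriv : ∀ s, 0 ≤ s → ∀ p, γ s ∈ (stChart (m := m) p).source →
    ∃ a : ℝ × Eu m, HasDerivWithinAt (fun t => stChart (m := m) p (γ t)) a (Ici s) s ∧
      κ * a.1 < 0 ∧ 𝓜.sHat p (stChart (m := m) p (γ s)) a.2 a.2 ≤ a.1 ^ 2

theorem IsPiecewiseC1.exists_right {Q : ∀ p : ℝ × S, TangentSpace (stModel m) p → Prop}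
    {γ : ℝ → ℝ × S} (h : IsPiecewiseC1 Q γ (Ici 0)) {s : ℝ} (hs : 0 ≤ s) :
    ∃ b, s < b ∧ ContMDiffOn 𝓘(ℝ, ℝ) (stModel m) 1 γ (Icc s b) ∧
      Q (γ s) (mfderivWithin 𝓘(ℝ, ℝ) (stModel m) γ (Icc s b) s (1 : ℝ)) := by
  obtain ⟨-, P, hP, h1⟩ := h
  -- The point `s` may itself be a break point. It is removed, so that a small interval to the right
  -- of `s` is free of break points.
  have hfin : ((P ∩ Icc s (s + 1)) \ {s}).Finite := (hP s (s + 1)).subset sdiff_subset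
  obtain ⟨r, hr, hsub⟩ := Metric.mem_nhds_iff.1
    (hfin.isClosed.isOpen_compl.mem_nhds (show s ∈ ((P ∩ Icc s (s + 1)) \ {s})ᶜ by simp))
  set b := s + min r 1 with hb
  have hm : 0 < min r 1 := lt_min hr one_pos
  have hsb : s < b := by linarith
  have hd : Disjoint (Ioo s b) P := by
    refine Set.disjoint_left.2 fun t ht htP => ?_
    have h2 : t ∈ Metric.ball s r := by
      rw [Metric.mem_ball, Real.dist_eq, abs_of_pos (by linarith [ht.1])]
      linarith [ht.2, min_le_left r 1]
    exact hsub h2 ⟨⟨htP, ht.1.le, by linarith [ht.2, min_le_right r 1]⟩, ht.1.ne'⟩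
  obtain ⟨h2, h3⟩ := h1 s b hsb (fun t ht => hs.trans ht.1) hd
  exact ⟨b, hsb, h2, h3 s (left_mem_Icc.2 hsb.le)⟩

theorem exists_right_deriv {γ : ℝ → ℝ × S} {s b : ℝ} (hsb : s < b)
    (h : ContMDiffOn 𝓘(ℝ, ℝ) (stModel m) 1 γ (Icc s b)) {p : ℝ × S}
    (hp : γ s ∈ (stChart (m := m) p).source) :
    ∃ a : ℝ × Eu m, HasDerivWithinAt (fun t => stChart (m := m) p (γ t)) a (Ici s) s ∧
      stD p (stChart (m := m) p (γ s)) a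
        = mfderivWithin 𝓘(ℝ, ℝ) (stModel m) γ (Icc s b) s (1 : ℝ) := by
  have hs : s ∈ Icc s b := left_mem_Icc.2 hsb.le
  have hu : UniqueDiffWithinAt ℝ (Icc s b) s := uniqueDiffOn_Icc hsb s hs
  have hg : MDifferentiableAt (stModel m) 𝓘(ℝ, ℝ × Eu m) (stChart (m := m) p) (γ s) :=
    ((contMDiffOn_stChart p).contMDiffAt
      ((isOpen_stChart_source p).mem_nhds hp)).mdifferentiableAt (by simp)
  have hγ := (h s hs).mdifferentiableWithinAt (by simp)
  have h1 := mfderiv_comp_mfderivWithin s hg hγ hu.uniqueMDiffWithinAt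
  rw [mfderivWithin_eq_fderivWithin] at h1
  have h2 : DifferentiableWithinAt ℝ (stChart (m := m) p ∘ γ) (Icc s b) s :=
    mdifferentiableWithinAt_iff_differentiableWithinAt.1 (hg.comp_mdifferentiableWithinAt s hγ)
  refine ⟨derivWithin (stChart (m := m) p ∘ γ) (Icc s b) s,
    h2.hasDerivWithinAt.mono_of_mem_nhdsWithin (Icc_mem_nhdsGE hsb), ?_⟩
  have h3 : derivWithin (stChart (m := m) p ∘ γ) (Icc s b) s
      = mfderiv (stModel m) 𝓘(ℝ, ℝ × Eu m) (stChart (m := m) p) (γ s)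
        (mfderivWithin 𝓘(ℝ, ℝ) (stModel m) γ (Icc s b) s (1 : ℝ)) :=
    congrArg (fun L => L (1 : ℝ)) h1
  rw [h3]
  exact stD_mfderiv_stChart hp _

namespace SplitMetric

variable (𝓜 : SplitMetric m S)

theorem gbar_stD {p q : ℝ × S} (hq : q ∈ (stChart (m := m) p).source) (a : ℝ × Eu m)
    {v : TangentSpace (stModel m) q} (hv : stD p (stChart (m := m) p q) a = v) :
    𝓜.gbar q v v = 𝓜.lapse q ^ 2 * (-(a.1 * a.1)
      + 𝓜.sHat p (stChart (m := m) p q) a.2 a.2) ∧ dtau q v = a.1 := by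
  have hz := (stChart (m := m) p).map_source hq
  have h1 := 𝓜.gHat_eq hz a a
  rw [𝓜.gHat_eq_sHat hz] at h1
  have h2 := stD_fst hz a
  have key : ∀ q' : ℝ × S, q' = q → 𝓜.lapse q' ^ 2 * (-(a.1 * a.1)
      + 𝓜.sHat p (stChart (m := m) p q) a.2 a.2) = 𝓜.gbar q' (stD p (stChart (m := m) p q) a)
        (stD p (stChart (m := m) p q) a) → dtau q' (stD p (stChart (m := m) p q) a) = a.1 →
      𝓜.gbar q v v = 𝓜.lapse q ^ 2 * (-(a.1 * a.1)
      + 𝓜.sHat p (stChart (m := m) p q) a.2 a.2) ∧ dtau q v = a.1 := by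
    rintro _ rfl h1 h2
    rw [← hv]
    exact ⟨h1.symm, h2⟩
  exact key _ ((stChart (m := m) p).left_inv hq) h1 h2

theorem PastInextendibleCausalFrom.causalCurve {p : ℝ × S} {γ : ℝ → ℝ × S}
    (h : 𝓜.PastInextendibleCausalFrom p γ) : CausalCurve 𝓜 1 γ := by
  refine ⟨h.1.1, fun s hs p' hp' => ?_⟩
  obtain ⟨b, hsb, h1, h2⟩ := h.1.exists_right hs
  obtain ⟨a, ha, ha'⟩ := exists_right_deriv hsb h1 hp'
  obtain ⟨h3, h4⟩ := 𝓜.gbar_stD hp' a ha'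
  have h5 := h2.1
  have h6 := h2.2
  rw [h3] at h5
  rw [h4] at h6
  refine ⟨a, ha, by linarith, ?_⟩
  have h7 := 𝓜.lapse_pos (γ s)
  have h8 := nonpos_of_mul_nonpos_right h5 (by positivity)
  nlinarith

theorem FutureInextendibleCausalFrom.causalCurve {p : ℝ × S} {γ : ℝ → ℝ × S}
    (h : 𝓜.FutureInextendibleCausalFrom p γ) : CausalCurve 𝓜 (-1) γ := by
  refine ⟨h.1.1, fun s hs p' hp' => ?_⟩
  obtain ⟨b, hsb, h1, h2⟩ := h.1.exists_right hs
  obtain ⟨a, ha, ha'⟩ := exists_right_deriv hsb h1 hp'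
  obtain ⟨h3, h4⟩ := 𝓜.gbar_stD hp' (-a) (((stD p' _).map_neg a).trans (congrArg Neg.neg ha'))
  have h5 := h2.1
  have h6 := h2.2
  have h5' := h3.symm.trans_le h5
  have h6' := h4.symm.trans_lt h6
  simp only [Prod.fst_neg, Prod.snd_neg, map_neg, _root_.neg_apply, neg_neg] at h5' h6'
  refine ⟨a, ha, by linarith, ?_⟩
  have h7 := 𝓜.lapse_pos (γ s)
  have h8 := nonpos_of_mul_nonpos_right h5' (by positivity)
  nlinarith

end SplitMetric

/-! ### Causal curves in a compact set converge -/

variable {𝓜 : SplitMetric m S} {κ : ℝ} {γ : ℝ → ℝ × S}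

/-- Compactness of heights, points and unit vectors. On causal curves this bounds the coordinate
speed in `S` by the rate of change of the time. -/
theorem exists_lower_bound_sHat (𝓜 : SplitMetric m S) (p : ℝ × S) (T : ℝ) {K : Set (Eu m)}
    (hK : IsCompact K) (hKt : ∀ z ∈ K, ∀ t : ℝ, (t, z) ∈ (stChart (m := m) p).target) :
    ∃ C : ℝ, 0 ≤ C ∧ ∀ t : ℝ, |t| ≤ T → ∀ z ∈ K, ∀ a, ‖a‖ ^ 2 ≤ C * 𝓜.sHat p (t, z) a a := by
  have hc : ContinuousOn (fun q : (ℝ × Eu m) × Eu m => (𝓜.sHat p q.1 q.2 q.2)⁻¹)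
      ((Icc (-T) T ×ˢ K) ×ˢ Metric.sphere 0 1) := by
    have h1 : ContinuousOn (fun q : (ℝ × Eu m) × Eu m => 𝓜.sHat p q.1)
        ((Icc (-T) T ×ˢ K) ×ˢ Metric.sphere 0 1) :=
      (𝓜.contDiffOn_sHat p).continuousOn.comp continuousOn_fst fun q hq => hKt _ hq.1.2 _
    refine ContinuousOn.inv₀ ((h1.clm_apply continuousOn_snd).clm_apply continuousOn_snd) ?_
    intro q hq
    exact (𝓜.sHat_pos (hKt _ hq.1.2 _)
      (ne_zero_of_mem_unit_sphere (⟨q.2, hq.2⟩ : Metric.sphere (0 : Eu m) 1))).ne'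
  obtain ⟨C, hC⟩ := ((isCompact_Icc.prod hK).prod
    (isCompact_sphere (0 : Eu m) 1)).exists_bound_of_continuousOn hc
  refine ⟨|C|, abs_nonneg C, fun t ht z hz v => ?_⟩
  rcases eq_or_ne v 0 with rfl | hv
  · simp
  have hv' : 0 < ‖v‖ := norm_pos_iff.2 hv
  have he : ‖v‖⁻¹ • v ∈ Metric.sphere (0 : Eu m) 1 := by
    rw [mem_sphere_zero_iff_norm, norm_smul, norm_inv, norm_norm, inv_mul_cancel₀ hv'.ne']
  have h1 := hC ((t, z), ‖v‖⁻¹ • v) ⟨⟨abs_le.1 ht, hz⟩, he⟩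
  have h2 := 𝓜.sHat_pos (hKt z hz t) hv
  simp only [map_smul, _root_.smul_apply, smul_eq_mul] at h1
  rw [Real.norm_eq_abs, abs_of_pos (by positivity), mul_inv, mul_inv, inv_inv] at h1
  have h3 : ‖v‖ * (‖v‖ * (𝓜.sHat p (t, z) v v)⁻¹) ≤ |C| := h1.trans (le_abs_self C)
  rw [← mul_assoc, ← div_eq_mul_inv, div_le_iff₀ h2] at h3
  rw [sq]
  exact h3

theorem antitoneOn_of_right_deriv_nonpos {f : ℝ → ℝ} (hf : ContinuousOn f (Ici 0))
    (h : ∀ s, 0 ≤ s → ∃ f', HasDerivWithinAt f f' (Ici s) s ∧ f' ≤ 0) : AntitoneOn f (Ici 0) := by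
  intro a ha b hb hab
  choose! f' hf' hf0 using h
  exact image_le_of_deriv_right_le_deriv_boundary (f := f) (f' := f') (a := a) (b := b)
    (B := fun _ => f a) (B' := fun _ => 0) (hf.mono fun x hx => le_trans ha hx.1)
    (fun x hx => hf' x (le_trans ha hx.1)) le_rfl continuousOn_const
    (fun x _ => hasDerivWithinAt_const _ _ _) (fun x hx => hf0 x (le_trans ha hx.1))
    (right_mem_Icc.2 hab)

theorem exists_tendsto_of_antitoneOn {f : ℝ → ℝ} (hf : AntitoneOn f (Ici 0)) {C : ℝ}
    (h : ∀ s, 0 ≤ s → C ≤ f s) : ∃ l, Tendsto f atTop (𝓝 l) := by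
  have h1 : Antitone fun s => f (max s 0) := fun a b hab =>
    hf (le_max_right a 0) (le_max_right b 0) (max_le_max_right 0 hab)
  refine ⟨_, (tendsto_atTop_ciInf h1 ⟨C, ?_⟩).congr' ?_⟩
  · rintro _ ⟨s, rfl⟩
    exact h _ (le_max_right s 0)
  · filter_upwards [eventually_ge_atTop 0] with s hs
    rw [max_eq_left hs]

theorem CausalCurve.fst_deriv (hγ : CausalCurve 𝓜 κ γ) {s : ℝ} (hs : 0 ≤ s) :
    ∃ a, HasDerivWithinAt (fun t => (γ t).1) a (Ici s) s ∧ κ * a < 0 := by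
  obtain ⟨a, ha, h1, -⟩ := hγ.deriv s hs (γ s) (mem_extChartAt_source (I := stModel m) _)
  refine ⟨a.1, ?_, h1⟩
  have h2 := (hasFDerivAt_fst (𝕜 := ℝ) (E := ℝ) (F := Eu m)
    (p := stChart (m := m) (γ s) (γ s))).comp_hasDerivWithinAt s ha
  refine h2.congr (fun t _ => ?_) ?_ <;> simp [stChart_apply]

variable [T2Space S]

/-- Along a causal curve the coordinate speed in `S` is at most `√C |τ'|`, so a bump function on `S`
varies along the curve no faster than a constant times `τ`. Adding a multiple of the monotone
quantity `κ τ` makes it nonincreasing. -/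
theorem CausalCurve.bump_deriv (hγ : CausalCurve 𝓜 κ γ) (hκ : κ ^ 2 = 1) {T : ℝ}
    (hT : ∀ s, 0 ≤ s → |(γ s).1| ≤ T) {q : S} {R : ℝ} (hR : 0 < R)
    (hRt : Metric.closedBall (extChartAt (𝓡 m) q q) R ⊆ (extChartAt (𝓡 m) q).target) :
    ∃ (C : ℝ) (B : S → ℝ), (∀ x, 0 ≤ B x) ∧ ContinuousAt B q ∧ B q = 1 ∧
      (∀ x, B x ≠ 0 → x ∈ (extChartAt (𝓡 m) q).symm ''
        Metric.closedBall (extChartAt (𝓡 m) q q) R) ∧ Continuous B ∧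
      ∀ s, 0 ≤ s → ∃ b a, HasDerivWithinAt (fun t => B (γ t).2) b (Ici s) s ∧
        HasDerivWithinAt (fun t => (γ t).1) a (Ici s) s ∧ b + C * (κ * a) ≤ 0 := by
  classical
  set e := extChartAt (𝓡 m) q with he
  set z0 := e q with hz0
  set B : S → ℝ := fun x => if x ∈ e.source then cutoff z0 R (e x) else 0 with hB
  set K : Set S := e.symm '' Metric.closedBall z0 R with hK
  have hKc : IsClosed K := ((isCompact_closedBall z0 R).image_of_continuousOn
    ((continuousOn_extChartAt_symm (I := 𝓡 m) q).mono hRt)).isClosed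
  have hes : IsOpen e.source := isOpen_extChartAt_source (I := 𝓡 m) q
  have hKs : K ⊆ e.source := by
    rintro _ ⟨y, hy, rfl⟩
    exact e.map_target (hRt hy)
  have hB0 : ∀ w, w ∉ K → B w = 0 := by
    intro w hw
    simp only [hB]
    split_ifs with hws
    · refine cutoff_eq_zero hR (not_lt.1 fun hlt => hw ⟨e w, ?_, e.left_inv hws⟩)
      rw [Metric.mem_closedBall, dist_eq_norm]
      exact hlt.le
    · rfl
  have hqs : q ∈ e.source := mem_extChartAt_source (I := 𝓡 m) q
  have hBc : Continuous B := by
    refine continuous_iff_continuousAt.2 fun w => ?_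
    by_cases hw : w ∈ e.source
    · have : B =ᶠ[𝓝 w] fun x => cutoff z0 R (e x) := by
        filter_upwards [hes.mem_nhds hw] with x hx
        simp only [hB, hx, if_true]
      refine ContinuousAt.congr ?_ this.symm
      exact (contDiff_cutoff z0 R).continuous.continuousAt.comp
        ((continuousOn_extChartAt (I := 𝓡 m) q).continuousAt (hes.mem_nhds hw))
    · have : B =ᶠ[𝓝 w] fun _ => 0 := by
        filter_upwards [hKc.isOpen_compl.mem_nhds fun h => hw (hKs h)] with x hx
        exact hB0 x hx
      exact continuousAt_const.congr this.symm
  obtain ⟨C, hC0, hC⟩ := exists_lower_bound_sHat 𝓜 ((0, q) : ℝ × S) T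
    (isCompact_closedBall z0 R) (fun z hz t => (mem_stChart_target _ _).2 (hRt hz))
  refine ⟨4 / R * √C, B, fun x => ?_, hBc.continuousAt, ?_, fun x hx => ?_, hBc, fun s hs => ?_⟩
  · simp only [hB]
    split_ifs
    · exact cutoff_nonneg _ _ _
    · exact le_rfl
  · simp only [hB, hqs, if_true]
    exact cutoff_self z0 R
  · by_contra h
    exact hx (hB0 x h)
  · by_cases hw : (γ s).2 ∈ K
    · have hsrc : γ s ∈ (stChart (m := m) ((0, q) : ℝ × S)).source :=
        (mem_stChart_source _ _).2 (hKs hw)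
      obtain ⟨a, ha, h1, h2⟩ := hγ.deriv s hs _ hsrc
      have hsnd : ∀ t, (stChart (m := m) ((0, q) : ℝ × S) (γ t)).2 = e (γ t).2 := fun t => by
        rw [stChart_apply]
      have hfst : ∀ t, (stChart (m := m) ((0, q) : ℝ × S) (γ t)).1 = (γ t).1 := fun t => by
        rw [stChart_apply]
      have ha1 : HasDerivWithinAt (fun t => (γ t).1) a.1 (Ici s) s := by
        have h2 := (hasFDerivAt_fst (𝕜 := ℝ) (E := ℝ) (F := Eu m)
          (p := stChart (m := m) ((0, q) : ℝ × S) (γ s))).comp_hasDerivWithinAt s ha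
        exact h2.congr (fun t _ => (hfst t).symm) (hfst s).symm
      have ha2 : HasDerivWithinAt (fun t => e (γ t).2) a.2 (Ici s) s := by
        have h2 := (hasFDerivAt_snd (𝕜 := ℝ) (E := ℝ) (F := Eu m)
          (p := stChart (m := m) ((0, q) : ℝ × S) (γ s))).comp_hasDerivWithinAt s ha
        exact h2.congr (fun t _ => (hsnd t).symm) (hsnd s).symm
      have hcd := ((contDiff_cutoff z0 R).differentiable (by simp)
        (e (γ s).2)).hasFDerivAt.comp_hasDerivWithinAt s ha2
      refine ⟨fderiv ℝ (cutoff z0 R) (e (γ s).2) a.2, a.1, ?_, ha1, ?_⟩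
      · have hev : ∀ᶠ t in 𝓝[Ici s] s, (γ t).2 ∈ e.source := by
          have : ContinuousWithinAt (fun t => (γ t).2) (Ici s) s :=
            (hγ.cont.mono (Ici_subset_Ici.2 hs) s self_mem_Ici).snd
          exact this (hes.mem_nhds (hKs hw))
        refine hcd.congr_of_eventuallyEq ?_ ?_
        · filter_upwards [hev] with t ht
          simp only [hB, ht, if_true, Function.comp_apply]
        · simp only [hB, hKs hw, if_true, Function.comp_apply]
      · have hzK : e (γ s).2 ∈ Metric.closedBall z0 R := by
          obtain ⟨z, hz, hze⟩ := hw
          rw [← hze, e.right_inv (hRt hz)]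
          exact hz
        have h3 := hC (γ s).1 (hT s hs) (e (γ s).2) hzK a.2
        have h4 : stChart (m := m) ((0, q) : ℝ × S) (γ s) = ((γ s).1, e (γ s).2) := by
          rw [stChart_apply]
        rw [h4] at h2
        -- Since `κ² = 1` and `κ a.1 < 0`, the number `-(κ * a.1)` is `|a.1|`.
        have h5 : ‖a.2‖ ≤ √C * (-(κ * a.1)) := by
          refine le_of_sq_le_sq ?_ (mul_nonneg (Real.sqrt_nonneg _) (by linarith))
          rw [mul_pow, Real.sq_sqrt hC0, neg_sq, mul_pow, hκ, one_mul]
          exact h3.trans (mul_le_mul_of_nonneg_left h2 hC0)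
        have h6 := (le_abs_self _).trans
          ((fderiv ℝ (cutoff z0 R) (e (γ s).2)).le_opNorm a.2)
        have h7 := h6.trans (mul_le_mul (norm_fderiv_cutoff_le hR _) h5 (norm_nonneg _)
          (by positivity))
        nlinarith
    · obtain ⟨a, ha, h1⟩ := hγ.fst_deriv hs
      refine ⟨0, a, ?_, ha, ?_⟩
      · have hev : ∀ᶠ t in 𝓝[Ici s] s, (γ t).2 ∈ Kᶜ := by
          have : ContinuousWithinAt (fun t => (γ t).2) (Ici s) s :=
            (hγ.cont.mono (Ici_subset_Ici.2 hs) s self_mem_Ici).snd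
          exact this (hKc.isOpen_compl.mem_nhds hw)
        refine (hasDerivWithinAt_const s (Ici s) (0 : ℝ)).congr_of_eventuallyEq ?_ (hB0 _ hw)
        filter_upwards [hev] with t ht
        exact hB0 _ ht
      · have : 0 ≤ 4 / R * √C := by positivity
        nlinarith

/-- The time is monotone and bounded, so it converges. For a cluster point `q` and a bump function
`B` around it, `B + C κ τ` is monotone and bounded along the curve, so `B` converges too. Its limit
must be its value `1` at the cluster point; hence the curve eventually stays in the support of `B`,
which can be taken arbitrarily small. -/
theorem CausalCurve.exists_tendsto (hγ : CausalCurve 𝓜 κ γ) (hκ : κ ^ 2 = 1) {G : Set (ℝ × S)}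
    (hG : IsCompact G) (h : ∀ s, 0 ≤ s → γ s ∈ G) : ∃ q, Tendsto γ atTop (𝓝 q) := by
  obtain ⟨T, hT⟩ := hG.exists_bound_of_continuousOn (f := Prod.fst) continuousOn_fst
  have hT' : ∀ s, 0 ≤ s → |(γ s).1| ≤ T := fun s hs => hT _ (h s hs)
  have hκ1 : |κ| = 1 := by
    rw [← sq_abs] at hκ
    exact (pow_eq_one_iff_of_nonneg (abs_nonneg κ) two_ne_zero).1 hκ
  have hκT : ∀ s, 0 ≤ s → -T ≤ κ * (γ s).1 := fun s hs => by
    have h1 : |κ * (γ s).1| ≤ T := by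
      rw [abs_mul, hκ1, one_mul]
      exact hT' s hs
    exact (abs_le.1 h1).1
  have hc1 : ContinuousOn (fun s => (γ s).1) (Ici 0) := hγ.cont.fst
  obtain ⟨l, hl⟩ := exists_tendsto_of_antitoneOn (C := -T)
    (antitoneOn_of_right_deriv_nonpos (f := fun s => κ * (γ s).1) (continuousOn_const.mul hc1)
      fun s hs => by
        obtain ⟨a, ha, ha'⟩ := hγ.fst_deriv hs
        exact ⟨κ * a, ha.const_mul κ, ha'.le⟩) hκT
  have hl1 : Tendsto (fun s => (γ s).1) atTop (𝓝 (κ * l)) := by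
    refine (hl.const_mul κ).congr fun s => ?_
    rw [← mul_assoc, ← sq, hκ, one_mul]
  obtain ⟨q, -, hq⟩ := hG.exists_mapClusterPt_of_frequently (l := atTop) (f := γ)
    ((eventually_ge_atTop 0).mono h).frequently
  refine ⟨(κ * l, q.2), ?_⟩
  have key : Tendsto (fun s => (γ s).2) atTop (𝓝 q.2) := by
    refine tendsto_def.2 fun U hU => ?_
    have hz : ContinuousAt (extChartAt (𝓡 m) q.2).symm (extChartAt (𝓡 m) q.2 q.2) :=
      continuousAt_extChartAt_symm (I := 𝓡 m) q.2
    have hz' : (extChartAt (𝓡 m) q.2).symm ⁻¹' U ∈ 𝓝 (extChartAt (𝓡 m) q.2 q.2) := by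
      refine hz ?_
      rwa [extChartAt_to_inv (I := 𝓡 m)]
    obtain ⟨R, hR, hsub⟩ := Metric.nhds_basis_closedBall.mem_iff.1
      (inter_mem (extChartAt_target_mem_nhds (I := 𝓡 m) q.2) hz')
    obtain ⟨C, B, hB0, -, hBq, hBs, hBc, hBd⟩ :=
      hγ.bump_deriv hκ hT' hR (hsub.trans inter_subset_left)
    have hcB : ContinuousOn (fun s => B (γ s).2) (Ici 0) := hBc.comp_continuousOn hγ.cont.snd
    have hanti : AntitoneOn (fun s => B (γ s).2 + C * (κ * (γ s).1)) (Ici 0) :=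
      antitoneOn_of_right_deriv_nonpos
        (hcB.add (continuousOn_const.mul (continuousOn_const.mul hc1))) fun s hs => by
          obtain ⟨b, a, hb, ha, hab⟩ := hBd s hs
          exact ⟨b + C * (κ * a), hb.add ((ha.const_mul κ).const_mul C), hab⟩
    have hbdd : ∀ s, 0 ≤ s → -(|C| * T) ≤ B (γ s).2 + C * (κ * (γ s).1) := fun s hs => by
      have h1 : |C * (κ * (γ s).1)| ≤ |C| * T := by
        rw [abs_mul, abs_mul, hκ1, one_mul]
        exact mul_le_mul_of_nonneg_left (hT' s hs) (abs_nonneg C)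
      linarith [(abs_le.1 h1).1, hB0 (γ s).2]
    obtain ⟨l', hl'⟩ := exists_tendsto_of_antitoneOn hanti hbdd
    have hBl : Tendsto (fun s => B (γ s).2) atTop (𝓝 (l' - C * l)) := by
      refine (hl'.sub (hl.const_mul C)).congr fun s => ?_
      ring
    have hcl : MapClusterPt (1 : ℝ) atTop (fun s => B (γ s).2) := by
      have := hq.continuousAt_comp (f := fun x : ℝ × S => B x.2)
        (hBc.continuousAt.comp continuousAt_snd)
      rw [hBq] at this
      exact this
    -- A convergent function has no cluster value besides its limit, and `1` is a cluster value.
    have h1 : l' - C * l = 1 := by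
      by_contra hne
      obtain ⟨V, W, hV, hW, hVm, hWm, hVW⟩ := t2_separation hne
      have hf := hcl.frequently (hW.mem_nhds hWm)
      obtain ⟨s, hs1, hs2⟩ := (hf.and_eventually (hBl (hV.mem_nhds hVm))).exists
      exact Set.disjoint_left.1 hVW hs2 hs1
    rw [h1] at hBl
    filter_upwards [hBl.eventually (lt_mem_nhds (zero_lt_one))] with s hs
    obtain ⟨z, hz, hze⟩ := hBs _ hs.ne'
    rw [mem_preimage, ← hze]
    exact (hsub hz).2
  exact hl1.prodMk_nhds key

end CausalCurves

/-! ### Spacelike graphs as barriers for causal curves -/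

section Barrier

variable {m : ℕ} [NeZero m] {N : Type*} [TopologicalSpace N] [ChartedSpace (EuclideanHalfSpace m) N]
  [IsManifold (𝓡∂ m) ∞ N]
  {S : Type*} [TopologicalSpace S] [ChartedSpace (EuclideanSpace ℝ (Fin m)) S]
  [IsManifold (𝓡 m) ∞ S] {𝓜 : SplitMetric m S}
  {ι : N → ℝ × S} {u : N → ℝ} {γ : ℝ → ℝ × S} {κ : ℝ}

theorem eventually_lt_of_hasDerivWithinAt_neg {f : ℝ → ℝ} {f' s : ℝ}
    (h : HasDerivWithinAt f f' (Ici s) s) (hf : f' < 0) : ∀ᶠ t in 𝓝[>] s, f t < f s := by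
  have h1 := hasDerivWithinAt_iff_tendsto_slope.1 h
  rw [Ici_sdiff_left] at h1
  filter_upwards [h1.eventually (gt_mem_nhds hf), self_mem_nhdsWithin] with t ht hst
  rw [slope_def_field] at ht
  have hst' : 0 < t - s := sub_pos.2 hst
  have := (div_lt_iff₀ hst').1 ht
  linarith

theorem exists_localInverse {E : Type*} [NormedAddCommGroup E] [NormedSpace ℝ E]
    [FiniteDimensional ℝ E] {f : E → E} {y : E} (hf : ContDiffAt ℝ 1 f y)
    (h : ∀ v, v ≠ 0 → fderiv ℝ f y v ≠ 0) :
    ∃ (g : E → E) (A : E →L[ℝ] E), HasFDerivAt g A (f y) ∧ g (f y) = y ∧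
      (∀ᶠ z in 𝓝 (f y), f (g z) = z) ∧ ∀ v, fderiv ℝ f y (A v) = v := by
  have : CompleteSpace E := FiniteDimensional.complete ℝ E
  have hinj : Function.Injective (fderiv ℝ f y : E →ₗ[ℝ] E) := by
    refine (injective_iff_map_eq_zero _).2 fun v hv => ?_
    by_contra hne
    exact h v hne hv
  set e : E ≃L[ℝ] E :=
    (LinearEquiv.ofInjectiveEndo (fderiv ℝ f y : E →ₗ[ℝ] E) hinj).toContinuousLinearEquiv with he
  have hev : ∀ v, e v = fderiv ℝ f y v := fun v => rfl
  have hs : HasStrictFDerivAt f (e : E →L[ℝ] E) y := by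
    have h1 := hf.hasStrictFDerivAt one_ne_zero
    have h2 : (e : E →L[ℝ] E) = fderiv ℝ f y := by
      ext v
      exact hev v
    rwa [h2]
  refine ⟨hs.localInverse f e y, e.symm, hs.to_localInverse.hasFDerivAt,
    hs.localInverse_apply_image, hs.eventually_right_inverse, fun v => ?_⟩
  rw [← hev]
  exact e.apply_symm_apply v

/-- The curve is lifted to the hypersurface by a local inverse of the projection to `S`; the
projection need not be injective globally. Strict separation from the hypersurface persists by
continuity. On the graph itself, `|du| < 1` makes the curve move away from the graph, to the side of
the hypersurface. -/
theorem CausalCurve.eventually_mem (hγ : CausalCurve 𝓜 κ γ) (hκ : κ ^ 2 = 1)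
    (hι : 𝓜.IsCompactSpacelike ι) (hu : ContMDiff (𝓡∂ m) 𝓘(ℝ, ℝ) ∞ u) {x : N}
    (hx : x ∈ (𝓡∂ m).interior N) (hlt : 𝓜.gradNorm ι u x < 1) {s : ℝ} (hs : 0 ≤ s)
    (hxs : (ι x).2 = (γ s).2) (h1 : κ * (ι x).1 < κ * (γ s).1) (h2 : κ * (γ s).1 ≤ κ * u x) :
    ∀ᶠ t in 𝓝[>] s, ∃ x', (ι x').2 = (γ t).2 ∧ κ * (ι x').1 ≤ κ * (γ t).1 ∧
      κ * (γ t).1 ≤ κ * u x' := by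
  have hxS : x ∈ (nChart (m := m) x).source := mem_extChartAt_source (I := 𝓡∂ m) x
  set y := nChart (m := m) x x with hydef
  have hyt : y ∈ (nChart (m := m) x).target := (nChart (m := m) x).map_source hxS
  have hyx : (nChart (m := m) x).symm y = x := (nChart (m := m) x).left_inv hxS
  have hyi : y ∈ interior (range (𝓡∂ m)) := (mem_interior_iff hxS).1 hx
  have hyr : range (𝓡∂ m) ∈ 𝓝 y := mem_interior_iff_mem_nhds.1 hyi
  set p := ι x with hp
  have hyd : y ∈ nDom (m := m) x p ι := by
    have := SplitMetric.mem_nDom_self ι x hyt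
    rwa [hyx] at this
  have hγp : ∀ t, (γ t).2 ∈ (extChartAt (𝓡 m) p.2).source ↔ γ t ∈ (stChart (m := m) p).source :=
    fun t => (mem_stChart_source p (γ t)).symm
  have hsp : γ s ∈ (stChart (m := m) p).source := by
    rw [← hγp, ← hxs]
    exact mem_extChartAt_source (I := 𝓡 m) _
  obtain ⟨a, ha, ha1, ha2⟩ := hγ.deriv s hs p hsp
  have hh : ContDiffAt ℝ 1 (hRep ι x p) y :=
    ((contDiffWithinAt_hRep hι.smooth hyd).contDiffAt hyr).of_le (by simp)
  have hD : fderiv ℝ (hRep ι x p) y = hD ι x p y := (fderivWithin_of_mem_nhds hyr).symm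
  obtain ⟨g, A, hg, hgy, hgr, hgA⟩ := exists_localInverse hh fun v hv => by
    rw [hD]
    exact 𝓜.hD_injective hι hyd hv
  set ζ : ℝ → Eu m := fun t => (stChart (m := m) p (γ t)).2 with hζ
  have hhy : hRep ι x p y = ζ s := by
    have e1 : hRep ι x p y = extChartAt (𝓡 m) p.2 (ι x).2 := by
      simp only [hRep, nRep, stChart_apply, hyx]
    have e2 : ζ s = extChartAt (𝓡 m) p.2 (γ s).2 := by
      simp only [hζ, stChart_apply]
    rw [e1, e2]
    exact congrArg _ hxs
  have hζd : HasDerivWithinAt ζ a.2 (Ici s) s := ha.snd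
  have hτd : HasDerivWithinAt (fun t => (γ t).1) a.1 (Ici s) s := by
    have : HasDerivWithinAt (fun t => (stChart (m := m) p (γ t)).1) a.1 (Ici s) s := ha.fst
    simpa only [stChart_apply] using this
  rw [hhy] at hg hgr
  rw [hhy] at hgy
  have hYd : HasDerivWithinAt (fun t => g (ζ t)) (A a.2) (Ici s) s :=
    hg.comp_hasDerivWithinAt s hζd
  have hUd : HasFDerivAt (uRep (m := m) u x) (fderiv ℝ (uRep (m := m) u x) y) y :=
    (((contDiffWithinAt_uRep hu hyt).contDiffAt hyr).differentiableAt (by simp)).hasFDerivAt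
  have hUd' := hUd
  rw [← hgy] at hUd'
  have hVd : HasDerivWithinAt (fun t => uRep (m := m) u x (g (ζ t)))
      (fderiv ℝ (uRep (m := m) u x) y (A a.2)) (Ici s) s := by
    have := hUd'.comp_hasDerivWithinAt s hYd
    rwa [hgy] at this
  have hsub : 𝓝[>] s ≤ 𝓝[≥] s := nhdsWithin_mono s Ioi_subset_Ici_self
  have hYc : Tendsto (fun t => g (ζ t)) (𝓝[>] s) (𝓝 y) := by
    have := hYd.continuousWithinAt.tendsto.mono_left hsub
    rwa [hgy] at this
  have hdom : nDom (m := m) x p ι ∈ 𝓝 y := by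
    have := nDom_mem_nhdsWithin hι.smooth hyd
    rwa [nhdsWithin_eq_nhds.2 hyr] at this
  have hsrc : ∀ᶠ t in 𝓝[>] s, γ t ∈ (stChart (m := m) p).source := by
    have : ContinuousWithinAt γ (Ici s) s := hγ.cont.mono (Ici_subset_Ici.2 hs) s self_mem_Ici
    exact (this.tendsto.mono_left hsub).eventually ((isOpen_stChart_source p).mem_nhds hsp)
  have hτc : Tendsto (fun t => κ * (γ t).1) (𝓝[>] s) (𝓝 (κ * (γ s).1)) :=
    (hτd.continuousWithinAt.tendsto.mono_left hsub).const_mul κ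
  have hφc : Tendsto (fun t => κ * (ι ((nChart (m := m) x).symm (g (ζ t)))).1) (𝓝[>] s)
      (𝓝 (κ * (ι x).1)) := by
    have c1 : ContinuousAt (fun y' => (ι ((nChart (m := m) x).symm y')).1) y := by
      have : ContinuousAt (nChart (m := m) x).symm y :=
        (continuousOn_nChart_symm x).continuousAt (mem_of_superset hdom inter_subset_left)
      exact (hι.smooth.continuous.fst.continuousAt).comp this
    have c2 := c1.tendsto.comp hYc
    rw [hyx] at c2
    exact c2.const_mul κ
  -- Strictly between the two surfaces continuity suffices; on the graph the right derivatives of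
  -- the heights are compared.
  have hmain : ∀ᶠ t in 𝓝[>] s, κ * (γ t).1 - κ * uRep (m := m) u x (g (ζ t)) < 0 := by
    have hUs : uRep (m := m) u x (g (ζ s)) = u x := by
      rw [hgy, uRep, hyx]
    rcases h2.lt_or_eq with h2 | h2
    · have c3 : Tendsto (fun t => κ * (γ t).1 - κ * uRep (m := m) u x (g (ζ t))) (𝓝[>] s)
          (𝓝 (κ * (γ s).1 - κ * uRep (m := m) u x (g (ζ s)))) :=
        hτc.sub ((hVd.continuousWithinAt.tendsto.mono_left hsub).const_mul κ)
      refine c3.eventually (gt_mem_nhds ?_)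
      rw [hUs]
      linarith
    · have hd := (hτd.const_mul κ).sub (hVd.const_mul κ)
      have hτu : (γ s).1 = u x := by
        have : κ ≠ 0 := by
          rintro rfl
          norm_num at hκ
        exact mul_left_cancel₀ this h2
      -- Cauchy–Schwarz gives `d² ≤ |du|² s(a.2, a.2)`, and causality bounds this by `|du|² a.1² <
      -- a.1²`.
      have hneg : κ * a.1 - κ * (fderiv ℝ (uRep (m := m) u x) y (A a.2)) < 0 := by
        set d := fderiv ℝ (uRep (m := m) u x) y (A a.2) with hd
        have e1 : d = uSlope u x y ⬝ᵥ (A a.2).ofLp := by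
          rw [← apply_uSlope, fderivWithin_of_mem_nhds hyr]
        have e2 := dot_sq_le_sqn (𝓜.posDef_chartGram hι hu hyd) (uSlope u x y) (A a.2).ofLp
        rw [← e1] at e2
        have e3 := dot_gram_mulVec (𝓜.sigRep ι x p (uRep u x y) y) (A a.2) (A a.2)
        rw [← 𝓜.chartGram_sigU hι.smooth hu hyd] at e3
        rw [e3, SplitMetric.sigRep_apply, ← hD, hgA] at e2
        have e4 : (uRep (m := m) u x y, hRep ι x p y) = stChart (m := m) p (γ s) := by
          rw [hhy, uRep, hyx, ← hτu]
          refine Prod.ext ?_ rfl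
          rw [stChart_apply]
        rw [e4] at e2
        have e5 : 𝓜.gradSq ι u x y < 1 := by
          have := 𝓜.gradNorm_eq hι hu hyd
          rw [hyx] at this
          rw [this] at hlt
          by_contra hcon
          have := Real.one_le_sqrt.2 (not_lt.1 hcon)
          linarith
        have e6 := 𝓜.gradSq_nonneg hι hu hyd
        have e7 : d ^ 2 < a.1 ^ 2 := by
          have ha0 : a.1 ≠ 0 := by
            intro h0
            rw [h0] at ha1
            simp at ha1
          have ha3 : 0 < a.1 ^ 2 := by positivity
          have e8 : d ^ 2 ≤ 𝓜.gradSq ι u x y * a.1 ^ 2 :=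
            e2.trans (mul_le_mul_of_nonneg_left ha2 e6)
          nlinarith
        have e9 : (κ * d) ^ 2 < (-(κ * a.1)) ^ 2 := by
          rw [neg_sq, mul_pow, mul_pow, hκ]
          linarith
        have := abs_lt_of_sq_lt_sq e9 (by linarith)
        linarith [(abs_lt.1 this).1]
      have := eventually_lt_of_hasDerivWithinAt_neg hd hneg
      simp only [Pi.sub_apply, hUs, h2, sub_self] at this
      exact this
  filter_upwards [hmain, hYc.eventually hdom, hsrc, hφc.eventually_lt hτc h1,
    (hζd.continuousWithinAt.tendsto.mono_left hsub).eventually hgr] with t k1 k2 k3 k4 k5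
  refine ⟨(nChart (m := m) x).symm (g (ζ t)), ?_, k4.le, ?_⟩
  · have l1 : extChartAt (𝓡 m) p.2 (ι ((nChart (m := m) x).symm (g (ζ t)))).2
        = extChartAt (𝓡 m) p.2 (γ t).2 := by
      have := k5
      simpa only [hRep, nRep, hζ, stChart_apply] using this
    refine (extChartAt (𝓡 m) p.2).injOn ?_ ((hγp t).2 k3) l1
    exact (mem_stChart_source p _).1 k2.2
  · have : κ * (γ t).1 < κ * uRep (m := m) u x (g (ζ t)) := by linarith
    exact this.le

/-- If the curve never met the hypersurface, it would stay forever in the compact region between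
hypersurface and graph and would therefore converge, contrary to inextendibility. -/
theorem CausalCurve.meets [T2Space S] (hγ : CausalCurve 𝓜 κ γ) (hκ : κ ^ 2 = 1)
    (hι : 𝓜.IsCompactSpacelike ι) (hu : ContMDiff (𝓡∂ m) 𝓘(ℝ, ℝ) ∞ u)
    (hlt : ∀ x ∈ (𝓡∂ m).interior N, 𝓜.gradNorm ι u x < 1)
    (hb : ∀ x ∈ (𝓡∂ m).boundary N, u x = (ι x).1) {x : N} (hx : κ * (ι x).1 ≤ κ * u x)
    (hγ0 : γ 0 = graphMap ι u x) (hend : ¬ ∃ q, Tendsto γ atTop (𝓝 q)) :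
    ∃ t, 0 ≤ t ∧ γ t ∈ range ι := by
  by_contra hcon
  push Not at hcon
  have := hι.compact
  have hκ0 : κ ≠ 0 := by
    rintro rfl
    norm_num at hκ
  have hκκ : κ * κ = 1 := by rw [← sq, hκ]
  -- The region between hypersurface and graph, with the order reversed for `κ = -1`. It is the
  -- image of a compact subset of `N × ℝ`.
  set G : Set (ℝ × S) := {q | ∃ x', (ι x').2 = q.2 ∧ κ * (ι x').1 ≤ κ * q.1 ∧
    κ * q.1 ≤ κ * u x'} with hGdef
  have hφc : Continuous fun x => (ι x).1 := hι.smooth.continuous.fst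
  have huc : Continuous u := hu.continuous
  have hGc : IsCompact G := by
    set K : Set (N × ℝ) := {q | κ * (ι q.1).1 ≤ κ * q.2 ∧ κ * q.2 ≤ κ * u q.1} with hK
    have hKcl : IsClosed K :=
      (isClosed_le ((hφc.comp continuous_fst).const_mul κ) (continuous_snd.const_mul κ)).inter
        (isClosed_le (continuous_snd.const_mul κ) ((huc.comp continuous_fst).const_mul κ))
    obtain ⟨T1, hT1⟩ := isCompact_univ.exists_bound_of_continuousOn (hφc.const_mul κ).continuousOn
    obtain ⟨T2, hT2⟩ := isCompact_univ.exists_bound_of_continuousOn (huc.const_mul κ).continuousOn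
    have hκ1 : |κ| = 1 := by
      rw [← sq_abs] at hκ
      exact (pow_eq_one_iff_of_nonneg (abs_nonneg κ) two_ne_zero).1 hκ
    have hKc : IsCompact K := by
      refine (isCompact_univ.prod (isCompact_Icc (a := -(max T1 T2)) (b := max T1 T2))
        ).of_isClosed_subset hKcl fun q hq => ⟨mem_univ _, abs_le.1 ?_⟩
      have a1 := (abs_le.1 (hT1 q.1 (mem_univ _))).1
      have a2 := (abs_le.1 (hT2 q.1 (mem_univ _))).2
      have : |κ * q.2| ≤ max T1 T2 := abs_le.2
        ⟨by linarith [hq.1, le_max_left T1 T2], by linarith [hq.2, le_max_right T1 T2]⟩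
      rwa [abs_mul, hκ1, one_mul] at this
    have hGK : G = (fun q : N × ℝ => (q.2, (ι q.1).2)) '' K := by
      ext q
      constructor
      · rintro ⟨x', h1, h2, h3⟩
        exact ⟨(x', q.1), ⟨h2, h3⟩, Prod.ext rfl h1⟩
      · rintro ⟨q', hq', rfl⟩
        exact ⟨q'.1, rfl, hq'.1, hq'.2⟩
    rw [hGK]
    exact hKc.image (continuous_snd.prodMk (hι.smooth.continuous.snd.comp continuous_fst))
  refine hend (hγ.exists_tendsto hκ hGc fun b hb0 => ?_)
  have hcl : IsClosed (γ ⁻¹' G ∩ Icc 0 b) := by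
    rw [inter_comm]
    exact (hγ.cont.mono Icc_subset_Ici_self).preimage_isClosed_of_isClosed isClosed_Icc
      hGc.isClosed
  have h0 : (0 : ℝ) ∈ γ ⁻¹' G := by
    rw [mem_preimage, hγ0]
    exact ⟨x, rfl, hx, le_rfl⟩
  -- Continuous induction: a closed set of parameters which contains `0` and extends to the right of
  -- each of its points in `[0, b)` contains `[0, b]`.
  refine hcl.Icc_subset_of_forall_mem_nhdsWithin h0 ?_ (right_mem_Icc.2 hb0)
  rintro s ⟨⟨x', h1, h2, h3⟩, hs⟩
  have h2' : κ * (ι x').1 < κ * (γ s).1 := by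
    refine h2.lt_of_ne fun h => hcon s hs.1 ⟨x', Prod.ext (mul_left_cancel₀ hκ0 h) h1⟩
  -- Over the boundary `u` equals the height of the hypersurface, so the region consists there of
  -- points of the hypersurface, which the curve avoids.
  have hint : x' ∈ (𝓡∂ m).interior N := by
    by_contra hni
    have hbd : x' ∈ (𝓡∂ m).boundary N := by
      rw [← ModelWithCorners.compl_interior]
      exact hni
    rw [hb x' hbd] at h3
    linarith
  exact hγ.eventually_mem hκ hι hu hint (hlt x' hint) hs.1 h1 h2' h3

/-! ### The a priori height bound -/

theorem SplitMetric.graphMap_mem_cauchyDevelopment [T2Space S] (hι : 𝓜.IsCompactSpacelike ι)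
    (hu : ContMDiff (𝓡∂ m) 𝓘(ℝ, ℝ) ∞ u)
    (hlt : ∀ x ∈ (𝓡∂ m).interior N, 𝓜.gradNorm ι u x < 1)
    (hb : ∀ x ∈ (𝓡∂ m).boundary N, u x = (ι x).1) (x : N) :
    graphMap ι u x ∈ 𝓜.cauchyDevelopment (range ι) := by
  -- Points of the graph above the hypersurface lie in `D⁺`, those below in `D⁻`.
  rcases le_total (ι x).1 (u x) with h | h
  · exact Or.inl fun γ hγ => CausalCurve.meets (κ := 1) hγ.causalCurve (by norm_num) hι hu hlt hb
      (by linarith) hγ.2.1 hγ.2.2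
  · exact Or.inr fun γ hγ => CausalCurve.meets (κ := -1) hγ.causalCurve (by norm_num) hι hu hlt hb
      (by linarith) hγ.2.1 hγ.2.2

theorem SplitMetric.exists_height_bound [T2Space S] (hι : 𝓜.IsCompactSpacelike ι)
    (hC : IsCompact (closure (𝓜.cauchyDevelopment (range ι)))) :
    ∃ T : ℝ, ∀ u : N → ℝ, ContMDiff (𝓡∂ m) 𝓘(ℝ, ℝ) ∞ u →
      (∀ x ∈ (𝓡∂ m).interior N, 𝓜.gradNorm ι u x < 1) →
      (∀ x ∈ (𝓡∂ m).boundary N, u x = (ι x).1) → ∀ x, |u x| ≤ T := by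
  obtain ⟨T, hT⟩ := hC.exists_bound_of_continuousOn (f := Prod.fst) continuousOn_fst
  exact ⟨T, fun u hu hlt hb x =>
    hT _ (subset_closure (graphMap_mem_cauchyDevelopment hι hu hlt hb x))⟩

theorem SplitMetric.gradNorm_const (hι : 𝓜.IsCompactSpacelike ι) (a : ℝ) (x : N) :
    𝓜.gradNorm ι (fun _ => a) x = 0 := by
  have hxS : x ∈ (nChart (m := m) x).source := mem_extChartAt_source (I := 𝓡∂ m) x
  have hyt := (nChart (m := m) x).map_source hxS
  have h := 𝓜.gradNorm_eq hι (contMDiff_const (c := a)) (mem_nDom_self ι x hyt)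
  rw [(nChart (m := m) x).left_inv hxS] at h
  rw [h, gradSq]
  have : uSlope (m := m) (fun _ : N => a) x (nChart (m := m) x x) = 0 := by
    funext k
    have : uRep (m := m) (fun _ : N => a) x = fun _ => a := rfl
    rw [uSlope, this, fderivWithin_fun_const]
    rfl
  rw [this]
  simp [sqn]

/-- Without boundary every constant would be an admissible height, its gradient being zero, against
the uniform height bound. -/
theorem SplitMetric.boundary_nonempty [T2Space S] (hι : 𝓜.IsCompactSpacelike ι)
    (hC : IsCompact (closure (𝓜.cauchyDevelopment (range ι)))) :
    ((𝓡∂ m).boundary N).Nonempty := by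
  by_contra hne
  rw [not_nonempty_iff_eq_empty] at hne
  obtain ⟨T, hT⟩ := exists_height_bound hι hC
  have := hι.connected
  obtain ⟨x⟩ := (inferInstance : Nonempty N)
  have h := hT (fun _ => |T| + 1) contMDiff_const
    (fun x _ => by rw [gradNorm_const hι]; exact one_pos) (fun x hx => by simp [hne] at hx) x
  have h1 := le_abs_self T
  have h2 := le_abs_self (|T| + 1)
  linarith

end Barrier

/-! ### Balls of comparable metrics -/

section ChartBounds

variable {m : ℕ} [NeZero m] {N : Type*} [TopologicalSpace N] [ChartedSpace (EuclideanHalfSpace m) N]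
  {σ : ∀ x : N, TangentSpace (𝓡∂ m) x → TangentSpace (𝓡∂ m) x → ℝ} {c x z : N} {R L r : ℝ} {y : Eu m}

/-- In the chart around `c`, in the (half) ball of radius `R` around the point `x`, the metric `σ`
is comparable to the Euclidean metric. -/
structure ChartBound (σ : ∀ x : N, TangentSpace (𝓡∂ m) x → TangentSpace (𝓡∂ m) x → ℝ)
    (c x : N) (R L : ℝ) : Prop where
  mem : x ∈ (nChart (m := m) c).source
  pos : 0 < R
  one_le : 1 ≤ L
  subset : Metric.closedBall (nChart (m := m) c x) R ∩ range (𝓡∂ m) ⊆ (nChart c).target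
  lower : ∀ y ∈ Metric.closedBall (nChart (m := m) c x) R ∩ range (𝓡∂ m), ∀ v,
    ‖v‖ ≤ L * √(σ ((nChart c).symm y) (nD c y v) (nD c y v))
  upper : ∀ y ∈ Metric.closedBall (nChart (m := m) c x) R ∩ range (𝓡∂ m), ∀ v,
    √(σ ((nChart c).symm y) (nD c y v) (nD c y v)) ≤ L * ‖v‖

namespace ChartBound

theorem mono (h : ChartBound σ c x R L) {R' : ℝ} (hR : 0 < R') (hR' : R' ≤ R) :
    ChartBound σ c x R' L := by
  have hs : Metric.closedBall (nChart (m := m) c x) R' ∩ range (𝓡∂ m)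
      ⊆ Metric.closedBall (nChart (m := m) c x) R ∩ range (𝓡∂ m) :=
    inter_subset_inter_left _ (Metric.closedBall_subset_closedBall hR')
  exact ⟨h.mem, hR, h.one_le, hs.trans h.subset, fun y hy => h.lower y (hs hy),
    fun y hy => h.upper y (hs hy)⟩

theorem nChart_mem_range (h : ChartBound σ c x R L) : nChart (m := m) c x ∈ range (𝓡∂ m) :=
  nChart_target_subset_range c ((nChart c).map_source h.mem)

variable [IsManifold (𝓡∂ m) ∞ N]

theorem edist_le [IsManifold (𝓡∂ m) 1 N] (h : ChartBound σ c x R L) (hσ : IsHomogeneous σ)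
    (hy : y ∈ Metric.closedBall (nChart (m := m) c x) R ∩ range (𝓡∂ m)) :
    metricEDist (𝓡∂ m) σ x ((nChart c).symm y)
      ≤ ENNReal.ofReal (L * ‖y - nChart (m := m) c x‖) := by
  have hseg : segment ℝ (nChart (m := m) c x) y
      ⊆ Metric.closedBall (nChart (m := m) c x) R ∩ range (𝓡∂ m) :=
    ((convex_closedBall _ _).inter convex_range).segment_subset
      ⟨Metric.mem_closedBall_self h.pos.le, h.nChart_mem_range⟩ hy
  have := metricEDist_le_of_segment hσ (hseg.trans h.subset) fun z hz => h.upper z (hseg hz)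
  rwa [(nChart (m := m) c).left_inv h.mem] at this

theorem eventually_edist_lt [IsManifold (𝓡∂ m) 1 N] (h : ChartBound σ c x R L)
    (hσ : IsHomogeneous σ) (hr : 0 < r) :
    ∀ᶠ z in 𝓝 x, metricEDist (𝓡∂ m) σ x z < ENNReal.ofReal r := by
  have hL : 0 < L := by linarith [h.one_le]
  have h1 := (isOpen_nChart_source (m := m) c).mem_nhds h.mem
  have hδ : 0 < min R (r / (2 * L)) := lt_min h.pos (by positivity)
  have h2 := ((continuousOn_nChart c).continuousAt h1) (Metric.closedBall_mem_nhds _ hδ)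
  filter_upwards [h1, h2] with z hz hz2
  have hz3 : nChart (m := m) c z ∈ Metric.closedBall (nChart (m := m) c x) R ∩ range (𝓡∂ m) :=
    ⟨Metric.closedBall_subset_closedBall (min_le_left _ _) hz2,
      nChart_target_subset_range c ((nChart c).map_source hz)⟩
  have h3 := h.edist_le hσ hz3
  rw [(nChart (m := m) c).left_inv hz] at h3
  refine h3.trans_lt ((ENNReal.ofReal_lt_ofReal_iff hr).2 ?_)
  have h4 : ‖nChart (m := m) c z - nChart (m := m) c x‖ ≤ r / (2 * L) := by
    rw [← dist_eq_norm]
    exact (Metric.mem_closedBall.1 hz2).trans (min_le_right _ _)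
  calc L * ‖nChart (m := m) c z - nChart (m := m) c x‖ ≤ L * (r / (2 * L)) :=
        mul_le_mul_of_nonneg_left h4 hL.le
    _ = r / 2 := by field_simp
    _ < r := by linarith

/-- If the coordinate ball reached the face of the half-space, the orthogonal projection of the
centre to that face would be a boundary point at distance at most `L R ≤ r`. Coordinate `0` is the
one that defines the half-space. -/
theorem closedBall_subset_interior [IsManifold (𝓡∂ m) 1 N] (h : ChartBound σ c x R L)
    (hσ : IsHomogeneous σ) (hr : ENNReal.ofReal r < edistToBoundary (𝓡∂ m) σ x) (hLR : L * R ≤ r) :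
    Metric.closedBall (nChart (m := m) c x) R ⊆ interior (range (𝓡∂ m)) := by
  set y := nChart (m := m) c x with hy
  have hL : 0 < L := by linarith [h.one_le]
  have hyr : 0 ≤ y 0 := by
    have := h.nChart_mem_range
    rw [range_modelWithCornersEuclideanHalfSpace] at this
    exact this
  have hRy : R < y 0 := by
    by_contra hcon
    push Not at hcon
    set y' : Eu m := y - EuclideanSpace.single 0 (y 0) with hy'
    have hn : ‖y' - y‖ = y 0 := by
      rw [hy', sub_sub_cancel_left, norm_neg, EuclideanSpace.norm_single, Real.norm_eq_abs,
        abs_of_nonneg hyr]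
    have hy'0 : y' 0 = 0 := by simp [hy']
    have hmem : y' ∈ Metric.closedBall y R ∩ range (𝓡∂ m) := by
      refine ⟨?_, ?_⟩
      · rw [Metric.mem_closedBall, dist_eq_norm, hn]
        exact hcon
      · rw [range_modelWithCornersEuclideanHalfSpace]
        exact hy'0.ge
    have hb : (nChart (m := m) c).symm y' ∈ (𝓡∂ m).boundary N := by
      rw [← ModelWithCorners.compl_interior]
      intro hi
      rw [mem_interior_iff ((nChart (m := m) c).map_target (h.subset hmem)),
        (nChart (m := m) c).right_inv (h.subset hmem),
        interior_range_modelWithCornersEuclideanHalfSpace] at hi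
      exact (lt_irrefl _ (hi.trans_eq hy'0))
    have h1 := h.edist_le hσ hmem
    rw [← hy, hn] at h1
    have h2 : edistToBoundary (𝓡∂ m) σ x ≤ metricEDist (𝓡∂ m) σ x ((nChart c).symm y') :=
      iInf₂_le _ hb
    have h3 : ENNReal.ofReal (L * y 0) ≤ ENNReal.ofReal r :=
      ENNReal.ofReal_le_ofReal ((mul_le_mul_of_nonneg_left hcon hL.le).trans hLR)
    exact absurd (h2.trans (h1.trans h3)) (not_le.2 hr)
  intro z hz
  rw [interior_range_modelWithCornersEuclideanHalfSpace]
  have h1 : |z 0 - y 0| ≤ R := by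
    have := PiLp.norm_apply_le (z - y) 0
    rw [← dist_eq_norm] at this
    exact this.trans hz
  have h2 := (abs_le.1 h1).1
  show 0 < z 0
  linarith

theorem metricBall_subset [IsManifold (𝓡∂ m) 1 N] [T2Space N] (h : ChartBound σ c x R L)
    (hσ : IsHomogeneous σ) (hr : r ≤ R / (4 * L)) :
    metricBall (𝓡∂ m) σ x r ⊆
      (nChart (m := m) c).symm '' Metric.closedBall (nChart (m := m) c x) R := by
  intro z hz
  have hL : 0 < L := by linarith [h.one_le]
  obtain ⟨h1, h2⟩ := mem_ball_of_metricEDist_lt hσ h.mem h.pos hL h.subset h.lower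
    (hz.trans_le (ENNReal.ofReal_le_ofReal hr))
  refine ⟨nChart c z, ?_, (nChart c).left_inv h1⟩
  rw [Metric.mem_closedBall, dist_eq_norm]
  exact h2.le

theorem image_subset_metricBall [IsManifold (𝓡∂ m) 1 N] (h : ChartBound σ c x R L)
    (hσ : IsHomogeneous σ) (hR : Metric.closedBall (nChart (m := m) c x) R ⊆ range (𝓡∂ m))
    (hr : L * R < r) :
    (nChart (m := m) c).symm '' Metric.closedBall (nChart (m := m) c x) R ⊆
      metricBall (𝓡∂ m) σ x r := by
  rintro _ ⟨y, hy, rfl⟩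
  have hL : 0 < L := by linarith [h.one_le]
  have h0 : 0 < r := lt_of_le_of_lt (mul_nonneg hL.le h.pos.le) hr
  refine (h.edist_le hσ ⟨hy, hR hy⟩).trans_lt ((ENNReal.ofReal_lt_ofReal_iff h0).2 ?_)
  rw [Metric.mem_closedBall, dist_eq_norm] at hy
  exact (mul_le_mul_of_nonneg_left hy hL.le).trans_lt hr

end ChartBound

/-- Neighbourhoods in the manifold topology contain points at arbitrarily small distance, so a
boundary point in the closure would be at distance at most `r + d` from `x`, for a `d` that still
fits below the distance to the boundary. -/
theorem closure_metricBall_subset_interior [IsManifold (𝓡∂ m) ∞ N] [IsManifold (𝓡∂ m) 1 N]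
    (hσ : IsHomogeneous σ) (h : ∀ x : N, ∃ c R L, ChartBound σ c x R L)
    (hr : ENNReal.ofReal r < edistToBoundary (𝓡∂ m) σ x) :
    closure (metricBall (𝓡∂ m) σ x r) ⊆ (𝓡∂ m).interior N := by
  intro z hz
  by_contra hni
  have hb : z ∈ (𝓡∂ m).boundary N := by
    rw [← ModelWithCorners.compl_interior]
    exact hni
  have h1 : edistToBoundary (𝓡∂ m) σ x ≤ metricEDist (𝓡∂ m) σ x z := iInf₂_le _ hb
  obtain ⟨d, hd1, hd2⟩ := ENNReal.lt_iff_exists_add_pos_lt.1 hr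
  obtain ⟨c, R, L, hcb⟩ := h z
  have h2 := hcb.eventually_edist_lt hσ (r := d) (by exact_mod_cast hd1)
  obtain ⟨w, hw1, hw2⟩ := mem_closure_iff_nhds.1 hz _ h2
  have h3 := metricEDist_triangle hσ x w z
  rw [metricEDist_comm hσ w z] at h3
  have h4 : metricEDist (𝓡∂ m) σ z w < ENNReal.ofReal d := hw1
  rw [ENNReal.ofReal_coe_nnreal] at h4
  have h5 : metricEDist (𝓡∂ m) σ x w < ENNReal.ofReal r := hw2
  exact absurd (h1.trans (h3.trans (add_le_add h5.le h4.le))) (not_le.2 hd2)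

end ChartBounds

/-! ### Bounds uniform in the height function -/

section Uniform

variable {m : ℕ} [NeZero m] {N : Type*} [TopologicalSpace N] [ChartedSpace (EuclideanHalfSpace m) N]
  [IsManifold (𝓡∂ m) ∞ N]
  {S : Type*} [TopologicalSpace S] [ChartedSpace (EuclideanSpace ℝ (Fin m)) S]
  [IsManifold (𝓡 m) ∞ S] {𝓜 : SplitMetric m S} {ι : N → ℝ × S}
  {X : ∀ p : ℝ × S, TangentSpace (stModel m) p} {T : ℝ} {c x : N} {ε L R : ℝ} {u ρ : N → ℝ}

theorem GoodChart.mono (h : GoodChart 𝓜 ι X T c ε L) {L' : ℝ} (hL : L ≤ L') :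
    GoodChart 𝓜 ι X T c ε L' := by
  have h0 : 0 < L := by linarith [h.one_le]
  refine ⟨h.pos, h.one_le.trans hL, h.subset, fun t ht y hy v => ?_, fun t ht y hy v => ?_,
    fun t ht y hy => ?_, fun t ht y hy => ?_, fun t ht y hy a b => ?_, fun y hy v => ?_,
    fun t ht y hy b => ?_⟩
  · have h1 := h.lower t ht y hy v
    have h2 : 0 ≤ 𝓜.sigRep ι c (ctr ι c) t y v v := by
      by_contra hc
      push Not at hc
      nlinarith [sq_nonneg ‖v‖]
    exact h1.trans (mul_le_mul_of_nonneg_right hL h2)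
  · exact (h.upper t ht y hy v).trans (by gcongr)
  · exact le_trans (by gcongr) (h.lapse_lower t ht y hy)
  · exact (h.lapse_upper t ht y hy).trans hL
  · exact (h.deriv_le t ht y hy a b).trans (by gcongr)
  · exact (h.hD_le y hy v).trans (by gcongr)
  · exact (h.vec_le t ht y hy b).trans (by gcongr)

/-- The bounds only weaken when `L` grows or the ball shrinks, so the constants of finitely many
charts covering `N` can be merged. Half the radius of a chart serves as `δ` for the points in the
inner half ball. -/
theorem exists_uniform_goodChart (hι : 𝓜.IsCompactSpacelike ι)
    (hX : ContMDiff (stModel m) (stModel m).tangent ∞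
      (fun p => (⟨p, X p⟩ : TangentBundle (stModel m) (ℝ × S)))) (T : ℝ) :
    ∃ δ L, 0 < δ ∧ 1 ≤ L ∧ ∀ x : N, ∃ c ε, GoodChart 𝓜 ι X T c ε L ∧
      x ∈ (nChart (m := m) c).source ∧
      Metric.closedBall (nChart (m := m) c x) δ ∩ range (𝓡∂ m) ⊆ halfBall c ε := by
  have := hι.compact
  suffices h : ∃ δ L, 0 < δ ∧ 1 ≤ L ∧ ∀ x ∈ (univ : Set N), ∃ c ε, GoodChart 𝓜 ι X T c ε L ∧
      x ∈ (nChart (m := m) c).source ∧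
      Metric.closedBall (nChart (m := m) c x) δ ∩ range (𝓡∂ m) ⊆ halfBall c ε by
    obtain ⟨δ, L, h1, h2, h3⟩ := h
    exact ⟨δ, L, h1, h2, fun x => h3 x (mem_univ x)⟩
  refine isCompact_univ.induction_on (p := fun s : Set N => ∃ δ L, 0 < δ ∧ 1 ≤ L ∧
    ∀ x ∈ s, ∃ c ε, GoodChart 𝓜 ι X T c ε L ∧ x ∈ (nChart (m := m) c).source ∧
      Metric.closedBall (nChart (m := m) c x) δ ∩ range (𝓡∂ m) ⊆ halfBall c ε) ?_ ?_ ?_ ?_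
  · exact ⟨1, 1, one_pos, le_rfl, fun x hx => absurd hx (notMem_empty x)⟩
  · rintro s t hst ⟨δ, L, h1, h2, h3⟩
    exact ⟨δ, L, h1, h2, fun x hx => h3 x (hst hx)⟩
  · rintro s t ⟨δ, L, h1, h2, h3⟩ ⟨δ', L', h1', h2', h3'⟩
    refine ⟨min δ δ', max L L', lt_min h1 h1', h2.trans (le_max_left _ _), ?_⟩
    rintro x (hx | hx)
    · obtain ⟨c, ε, k1, k2, k3⟩ := h3 x hx
      exact ⟨c, ε, k1.mono (le_max_left _ _), k2, (inter_subset_inter_left _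
        (Metric.closedBall_subset_closedBall (min_le_left _ _))).trans k3⟩
    · obtain ⟨c, ε, k1, k2, k3⟩ := h3' x hx
      exact ⟨c, ε, k1.mono (le_max_right _ _), k2, (inter_subset_inter_left _
        (Metric.closedBall_subset_closedBall (min_le_right _ _))).trans k3⟩
  · intro c _
    obtain ⟨ε, L, hG⟩ := exists_goodChart 𝓜 hι hX T c
    have hc : c ∈ (nChart (m := m) c).source := mem_extChartAt_source (I := 𝓡∂ m) c
    have h1 := (isOpen_nChart_source (m := m) c).mem_nhds hc
    have h2 := ((continuousOn_nChart c).continuousAt h1)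
      (Metric.closedBall_mem_nhds _ (half_pos hG.pos))
    refine ⟨_, mem_nhdsWithin_of_mem_nhds (inter_mem h1 h2), ε / 2, L, half_pos hG.pos,
      hG.one_le, fun x hx => ⟨c, ε, hG, hx.1, inter_subset_inter_left _ ?_⟩⟩
    refine Metric.closedBall_subset_closedBall' ?_
    have : dist (nChart (m := m) c x) (nChart (m := m) c c) ≤ ε / 2 := hx.2
    linarith

theorem GoodChart.chartBound (hG : GoodChart 𝓜 ι X T c ε L) (hι : 𝓜.IsCompactSpacelike ι)
    (hu : ContMDiff (𝓡∂ m) 𝓘(ℝ, ℝ) ∞ u) (hT : ∀ x, |u x| ≤ T)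
    (hx : x ∈ (nChart (m := m) c).source) (hR : 0 < R)
    (hs : Metric.closedBall (nChart (m := m) c x) R ∩ range (𝓡∂ m) ⊆ halfBall c ε) :
    ChartBound (𝓜.sigU ι u) c x R L := by
  have hL1 := hG.one_le
  have hL : 0 < L := by linarith
  refine ⟨hx, hR, hL1, fun y hy => (hG.subset (hs hy)).1, fun y hy v => ?_, fun y hy v => ?_⟩
  · have h1 := hG.lower (uRep u c y) (hT _) y (hs hy) v
    rw [𝓜.sigU_nD hι.smooth hu (hG.subset (hs hy))]
    set q := 𝓜.sigRep ι c (ctr ι c) (uRep u c y) y v v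
    have hq : 0 ≤ q := by
      by_contra hc
      push Not at hc
      nlinarith [sq_nonneg ‖v‖]
    refine le_of_sq_le_sq ?_ (by positivity)
    rw [mul_pow, Real.sq_sqrt hq]
    nlinarith
  · have h1 := hG.upper (uRep u c y) (hT _) y (hs hy) v
    rw [𝓜.sigU_nD hι.smooth hu (hG.subset (hs hy))]
    refine Real.sqrt_le_iff.2 ⟨by positivity, h1.trans ?_⟩
    rw [mul_pow]
    exact mul_le_mul_of_nonneg_right (by nlinarith) (sq_nonneg _)

theorem SplitMetric.continuousAt_tilt (hι : 𝓜.IsCompactSpacelike ι)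
    (hu : ContMDiff (𝓡∂ m) 𝓘(ℝ, ℝ) ∞ u) (hx : 𝓜.gradNorm ι u x < 1) :
    ContinuousAt (𝓜.tilt ι u) x := by
  have hxS : x ∈ (nChart (m := m) x).source := mem_extChartAt_source (I := 𝓡∂ m) x
  have hyt := (nChart (m := m) x).map_source hxS
  have hyx : (nChart (m := m) x).symm (nChart (m := m) x x) = x := (nChart (m := m) x).left_inv hxS
  have hyd : nChart (m := m) x x ∈ nDom (m := m) x (ι x) ι := by
    have := SplitMetric.mem_nDom_self ι x hyt
    rwa [hyx] at this
  have hn := (isOpen_nChart_source (m := m) x).mem_nhds hxS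
  have h1 : Tendsto (nChart (m := m) x) (𝓝 x) (𝓝[range (𝓡∂ m)] (nChart (m := m) x x)) := by
    refine tendsto_nhdsWithin_iff.2 ⟨(continuousOn_nChart x).continuousAt hn, ?_⟩
    filter_upwards [hn] with z hz
    exact nChart_target_subset_range x ((nChart x).map_source hz)
  have h2 : Tendsto (fun z => 𝓜.gradSq ι u x (nChart (m := m) x z)) (𝓝 x)
      (𝓝 (𝓜.gradSq ι u x (nChart (m := m) x x))) :=
    (𝓜.continuousWithinAt_gradSq hι hu hyd).tendsto.comp h1
  have h3 : 𝓜.gradSq ι u x (nChart (m := m) x x) < 1 := by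
    have := 𝓜.gradNorm_eq hι hu hyd
    rw [hyx] at this
    rw [this] at hx
    by_contra hcon
    have := Real.one_le_sqrt.2 (not_lt.1 hcon)
    linarith
  have h4 : ContinuousAt (fun z => 1 / √(1 - 𝓜.gradSq ι u x (nChart (m := m) x z))) x :=
    ContinuousAt.div continuousAt_const
      (ContinuousAt.sqrt (f := fun z => 1 - 𝓜.gradSq ι u x (nChart (m := m) x z))
        (ContinuousAt.sub (f := fun _ => (1 : ℝ)) continuousAt_const h2))
      (Real.sqrt_pos.2 (by linarith)).ne'
  refine h4.congr ?_
  filter_upwards [hn, h1.eventually (nDom_mem_nhdsWithin hι.smooth hyd)] with z hz hz2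
  have := 𝓜.tilt_eq hι hu hz2
  rw [(nChart (m := m) x).left_inv hz] at this
  exact this.symm

/-- The distances of the points of the hypersurface from its boundary are bounded, uniformly in
the height function. -/
theorem exists_edistToBoundary_le (hι : 𝓜.IsCompactSpacelike ι)
    (hX : ContMDiff (stModel m) (stModel m).tangent ∞
      (fun p => (⟨p, X p⟩ : TangentBundle (stModel m) (ℝ × S)))) (T : ℝ)
    (hb : ((𝓡∂ m).boundary N).Nonempty) :
    ∃ D : ℝ, 0 ≤ D ∧ ∀ u : N → ℝ, ContMDiff (𝓡∂ m) 𝓘(ℝ, ℝ) ∞ u → (∀ x, |u x| ≤ T) → ∀ x,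
      edistToBoundary (𝓡∂ m) (𝓜.sigU ι u) x ≤ ENNReal.ofReal D := by
  have := hι.compact
  have := hι.connected
  have : IsManifold (𝓡∂ m) 1 N := IsManifold.of_le (n := ∞) (by simp)
  obtain ⟨δ, L, hδ, hL, hch⟩ := exists_uniform_goodChart hι hX T
  obtain ⟨b, hb⟩ := hb
  have hloc : ∀ x : N, ∀ᶠ z in 𝓝 x, ∀ u : N → ℝ, ContMDiff (𝓡∂ m) 𝓘(ℝ, ℝ) ∞ u →
      (∀ x, |u x| ≤ T) → metricEDist (𝓡∂ m) (𝓜.sigU ι u) x z ≤ ENNReal.ofReal (L * δ) := by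
    intro x
    obtain ⟨c, ε, hG, hx, hs⟩ := hch x
    have h1 := (isOpen_nChart_source (m := m) c).mem_nhds hx
    have h2 := ((continuousOn_nChart c).continuousAt h1) (Metric.closedBall_mem_nhds _ hδ)
    filter_upwards [h1, h2] with z hz hz2 u hu hT
    have h3 := (hG.chartBound hι hu hT hx hδ hs).edist_le
      (𝓜.isContMetric_sigU hι.smooth hu).isHomogeneous
      ⟨hz2, nChart_target_subset_range c ((nChart c).map_source hz)⟩
    rw [(nChart (m := m) c).left_inv hz] at h3
    refine h3.trans (ENNReal.ofReal_le_ofReal ?_)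
    rw [← dist_eq_norm]
    exact mul_le_mul_of_nonneg_left hz2 (by linarith)
  -- Being at a distance bounded uniformly in `u` is symmetric, transitive and holds locally. On a
  -- connected space it therefore holds for every pair of points.
  set P : N → N → Prop := fun x z => ∃ D : ℝ, 0 ≤ D ∧ ∀ u : N → ℝ,
    ContMDiff (𝓡∂ m) 𝓘(ℝ, ℝ) ∞ u → (∀ x, |u x| ≤ T) →
      metricEDist (𝓡∂ m) (𝓜.sigU ι u) x z ≤ ENNReal.ofReal D with hP
  have hLδ : 0 ≤ L * δ := by positivity
  have hPx : ∀ x, P x b := fun x => by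
    refine @PreconnectedSpace.induction₂ N _ _ P ⟨fun x y hxy => ?_⟩ (fun x => ?_)
      ⟨fun x y z hxy hyz => ?_⟩ x b
    · obtain ⟨D, h0, h⟩ := hxy
      refine ⟨D, h0, fun u hu hT => ?_⟩
      rw [metricEDist_comm (𝓜.isContMetric_sigU hι.smooth hu).isHomogeneous]
      exact h u hu hT
    · filter_upwards [hloc x] with z hz
      exact ⟨L * δ, hLδ, hz⟩
    · obtain ⟨D, h0, h⟩ := hxy
      obtain ⟨D', h0', h'⟩ := hyz
      refine ⟨D + D', add_nonneg h0 h0', fun u hu hT => ?_⟩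
      rw [ENNReal.ofReal_add h0 h0']
      exact (metricEDist_triangle (𝓜.isContMetric_sigU hι.smooth hu).isHomogeneous x y z).trans
        (add_le_add (h u hu hT) (h' u hu hT))
  -- Compactness makes the bound uniform in `x` as well.
  have huni : ∃ D : ℝ, 0 ≤ D ∧ ∀ x ∈ (univ : Set N), ∀ u : N → ℝ,
      ContMDiff (𝓡∂ m) 𝓘(ℝ, ℝ) ∞ u → (∀ x, |u x| ≤ T) →
        metricEDist (𝓡∂ m) (𝓜.sigU ι u) x b ≤ ENNReal.ofReal D := by
    refine isCompact_univ.induction_on (p := fun s : Set N => ∃ D : ℝ, 0 ≤ D ∧ ∀ x ∈ s,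
      ∀ u : N → ℝ, ContMDiff (𝓡∂ m) 𝓘(ℝ, ℝ) ∞ u → (∀ x, |u x| ≤ T) →
        metricEDist (𝓡∂ m) (𝓜.sigU ι u) x b ≤ ENNReal.ofReal D) ?_ ?_ ?_ ?_
    · exact ⟨0, le_rfl, fun x hx => absurd hx (notMem_empty x)⟩
    · rintro s t hst ⟨D, h1, h2⟩
      exact ⟨D, h1, fun x hx => h2 x (hst hx)⟩
    · rintro s t ⟨D, h1, h2⟩ ⟨D', h1', h2'⟩
      refine ⟨max D D', h1.trans (le_max_left _ _), ?_⟩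
      rintro x (hx | hx) u hu hT
      · exact (h2 x hx u hu hT).trans (ENNReal.ofReal_le_ofReal (le_max_left _ _))
      · exact (h2' x hx u hu hT).trans (ENNReal.ofReal_le_ofReal (le_max_right _ _))
    · intro x _
      obtain ⟨D, h0, h⟩ := hPx x
      refine ⟨_, mem_nhdsWithin_of_mem_nhds (hloc x), L * δ + D, add_nonneg hLδ h0,
        fun z hz u hu hT => ?_⟩
      have hσ := (𝓜.isContMetric_sigU hι.smooth hu).isHomogeneous
      rw [ENNReal.ofReal_add hLδ h0]
      refine (metricEDist_triangle hσ z x b).trans (add_le_add ?_ (h u hu hT))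
      rw [metricEDist_comm hσ]
      exact hz u hu hT
  obtain ⟨D, h0, h⟩ := huni
  exact ⟨D, h0, fun u hu hT x => (iInf₂_le b hb).trans (h x (mem_univ x) u hu hT)⟩

end Uniform

/-! ### The estimate on balls -/

section Growth

variable {m : ℕ} [NeZero m] {N : Type*} [TopologicalSpace N] [ChartedSpace (EuclideanHalfSpace m) N]
  [IsManifold (𝓡∂ m) ∞ N] [MeasurableSpace N] [BorelSpace N]
  {S : Type*} [TopologicalSpace S] [ChartedSpace (EuclideanSpace ℝ (Fin m)) S]
  [IsManifold (𝓡 m) ∞ S] {𝓜 : SplitMetric m S} {ι : N → ℝ × S}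
  {X : ∀ p : ℝ × S, TangentSpace (stModel m) p} {T : ℝ} {c x : N} {ε L δ D s r : ℝ} {u ρ : N → ℝ}

/-- The constant in the estimate on balls. -/
def growthConst (m : ℕ) (L δ D : ℝ) : ℝ :=
  16 * L ^ 2 * (1 + D / δ) +
    L ^ m * (128 * L ^ 2 * GoodChart.energyConst m L) * ((D + 2 * L) * (1 + D / δ) + 1) +
    (1 + m.factorial * (2 * L) ^ m) * ((4 * L) ^ m * (volume (Metric.closedBall (0 : Eu m) 1)).toReal)

theorem GoodChart.energyConst_nonneg (hL : 0 ≤ L) : 0 ≤ GoodChart.energyConst m L := by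
  rw [GoodChart.energyConst]
  positivity

theorem growthConst_pos (hL : 1 ≤ L) (hδ : 0 < δ) (hD : 0 ≤ D) : 0 < growthConst m L δ D := by
  have hL0 : 0 < L := by linarith
  have := GoodChart.energyConst_nonneg (m := m) hL0.le
  rw [growthConst]
  positivity

/-- The tilt is continuous only where the graph is spacelike. The closure of the ball is compact and
contained in the interior, and the volume is finite. -/
theorem integrableOn_metricBall [T2Space N] [CompactSpace N] (hι : 𝓜.IsCompactSpacelike ι)
    (hu : ContMDiff (𝓡∂ m) 𝓘(ℝ, ℝ) ∞ u) (hlt : ∀ x ∈ (𝓡∂ m).interior N, 𝓜.gradNorm ι u x < 1)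
    (hcb : ∀ x : N, ∃ c R L, ChartBound (𝓜.sigU ι u) c x R L)
    (hr : ENNReal.ofReal r < edistToBoundary (𝓡∂ m) (𝓜.sigU ι u) x) :
    IntegrableOn (𝓜.tilt ι u) (metricBall (𝓡∂ m) (𝓜.sigU ι u) x r)
      (riemannianVolume (𝓡∂ m) (𝓜.sigU ι u)) := by
  have : IsManifold (𝓡∂ m) 1 N := IsManifold.of_le (n := ∞) (by simp)
  have hσ := 𝓜.isContMetric_sigU hι.smooth hu
  have := isFiniteMeasure_riemannianVolume hσ
  have hcl := closure_metricBall_subset_interior hσ.isHomogeneous hcb hr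
  refine IntegrableOn.mono_set ?_ subset_closure
  exact ContinuousOn.integrableOn_compact isClosed_closure.isCompact fun z hz =>
    (𝓜.continuousAt_tilt hι hu (hlt z (hcl hz))).continuousWithinAt

theorem setIntegral_tilt_mono {A B : Set N}
    (hB : IntegrableOn (𝓜.tilt ι u) B (riemannianVolume (𝓡∂ m) (𝓜.sigU ι u))) (hAB : A ⊆ B) :
    ∫ y in A, 𝓜.tilt ι u y ∂(riemannianVolume (𝓡∂ m) (𝓜.sigU ι u))
      ≤ ∫ y in B, 𝓜.tilt ι u y ∂(riemannianVolume (𝓡∂ m) (𝓜.sigU ι u)) :=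
  setIntegral_mono_set hB
    (Eventually.of_forall fun y => div_nonneg zero_le_one (Real.sqrt_nonneg _))
    (HasSubset.Subset.eventuallyLE hAB)

-- Relates `GoodChart.local_estimate` to metric balls through the inclusions of the `s`-ball, the
-- coordinate balls of radii `t` and `R`, and the `r`-ball. When `s` is too large for this, `s / r`
-- is bounded below and the monotonicity of the integral suffices.
set_option maxHeartbeats 1000000 in
theorem GoodChart.ball_estimate [T2Space N] [CompactSpace N] (hG : GoodChart 𝓜 ι X T c ε L)
    (hι : 𝓜.IsCompactSpacelike ι) (hu : 𝓜.IsSmoothSolution ι X ρ u)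
    (hρ : ContMDiff (𝓡∂ m) 𝓘(ℝ, ℝ) ∞ ρ) (hT : ∀ x, |u x| ≤ T)
    (hx : x ∈ (nChart (m := m) c).source) (hδ : 0 < δ)
    (hs : Metric.closedBall (nChart (m := m) c x) δ ∩ range (𝓡∂ m) ⊆ halfBall c ε)
    (hs0 : 0 < s) (hsr : s < r) (hrD : r ≤ D)
    (hr : ENNReal.ofReal r < edistToBoundary (𝓡∂ m) (𝓜.sigU ι u) x)
    (hint : IntegrableOn (𝓜.tilt ι u) (metricBall (𝓡∂ m) (𝓜.sigU ι u) x r)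
      (riemannianVolume (𝓡∂ m) (𝓜.sigU ι u)))
    (hintρ : IntegrableOn ρ (metricBall (𝓡∂ m) (𝓜.sigU ι u) x r)
      (riemannianVolume (𝓡∂ m) (𝓜.sigU ι u))) :
    ∫ y in metricBall (𝓡∂ m) (𝓜.sigU ι u) x s, 𝓜.tilt ι u y
        ∂(riemannianVolume (𝓡∂ m) (𝓜.sigU ι u)) ≤
      growthConst m L δ D * s *
        ((∫ y in metricBall (𝓡∂ m) (𝓜.sigU ι u) x r, 𝓜.tilt ι u y
            ∂(riemannianVolume (𝓡∂ m) (𝓜.sigU ι u))) / r +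
          (∫ y in metricBall (𝓡∂ m) (𝓜.sigU ι u) x r, |ρ y|
            ∂(riemannianVolume (𝓡∂ m) (𝓜.sigU ι u))) + r ^ (m - 1)) := by
  have : IsManifold (𝓡∂ m) 1 N := IsManifold.of_le (n := ∞) (by simp)
  have hL1 := hG.one_le
  have hL : 0 < L := by linarith
  have hr0 : 0 < r := hs0.trans hsr
  have hD : 0 < D := hr0.trans_le hrD
  have hσ := 𝓜.isContMetric_sigU hι.smooth hu.smooth
  set σ := 𝓜.sigU ι u with hσdef
  set V := riemannianVolume (𝓡∂ m) σ with hV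
  set Br := metricBall (𝓡∂ m) σ x r with hBr
  set I := ∫ y in Br, 𝓜.tilt ι u y ∂V with hI
  set J := ∫ y in Br, |ρ y| ∂V with hJ
  have hw0 : ∀ y, 0 ≤ 𝓜.tilt ι u y := fun y => div_nonneg zero_le_one (Real.sqrt_nonneg _)
  have hI0 : 0 ≤ I := integral_nonneg hw0
  have hJ0 : 0 ≤ J := integral_nonneg fun y => abs_nonneg _
  have hE := GoodChart.energyConst_nonneg (m := m) hL.le
  set E := GoodChart.energyConst m L with hEdef
  set vol := (volume (Metric.closedBall (0 : Eu m) 1)).toReal with hvol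
  have hvol0 : 0 ≤ vol := ENNReal.toReal_nonneg
  have hcb := hG.chartBound hι hu.smooth hT hx hδ hs
  rw [← hσdef] at hcb
  -- The estimate is available only up to the chart radius `δ`. Because `r ≤ D`, replacing `r` by
  -- `r1` costs at most the factor `1 + D / δ`.
  set r1 := min r δ with hr1
  have hr10 : 0 < r1 := lt_min hr0 hδ
  have hr1r : 1 / r1 ≤ (1 + D / δ) * (1 / r) := by
    rw [one_add_mul, ← sub_nonneg]
    rcases le_total r δ with h | h
    · rw [hr1, min_eq_left h]
      have : 0 ≤ D / δ * (1 / r) := by positivity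
      linarith
    · rw [hr1, min_eq_right h]
      have h1 : 1 / δ ≤ D / δ * (1 / r) := by
        rw [div_mul_div_comm, mul_one, div_le_div_iff₀ hδ (by positivity)]
        nlinarith
      have : 0 < 1 / r := by positivity
      linarith
  set a1 := 16 * L ^ 2 * (1 + D / δ) with ha1
  set k2 := L ^ m * (128 * L ^ 2 * E) with hk2
  set k3 := (1 + m.factorial * (2 * L) ^ m) * ((4 * L) ^ m * vol) with hk3
  have hC : growthConst m L δ D = a1 + k2 * ((D + 2 * L) * (1 + D / δ) + 1) + k3 := rfl
  have ha10 : 0 ≤ a1 := by positivity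
  have hk20 : 0 ≤ k2 := by positivity
  have hk30 : 0 ≤ k3 := by positivity
  have hq0 : 0 ≤ (D + 2 * L) * (1 + D / δ) := by positivity
  -- Lets each of the three terms be estimated with its own constant.
  have hfin : ∀ b1 b2 b3 : ℝ, b1 ≤ growthConst m L δ D → b2 ≤ growthConst m L δ D →
      b3 ≤ growthConst m L δ D → s * (b1 * (I / r) + b2 * J + b3 * r ^ (m - 1)) ≤
      growthConst m L δ D * s * (I / r + J + r ^ (m - 1)) := by
    intro b1 b2 b3 h1 h2 h3
    have e1 := mul_le_mul_of_nonneg_right h1 (div_nonneg hI0 hr0.le)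
    have e2 := mul_le_mul_of_nonneg_right h2 hJ0
    have e3 := mul_le_mul_of_nonneg_right h3 (pow_nonneg hr0.le (m - 1))
    have := mul_le_mul_of_nonneg_left (add_le_add (add_le_add e1 e2) e3) hs0.le
    refine this.trans_eq ?_
    ring
  -- The threshold is the condition `t ≤ R / 2` for the radii chosen in the second case.
  rcases lt_or_ge (r1 / (16 * L ^ 2)) s with hcase | hcase
  · have h1 := setIntegral_tilt_mono hint (show metricBall (𝓡∂ m) σ x s ⊆ Br from fun z hz =>
      hz.trans_le (ENNReal.ofReal_le_ofReal hsr.le))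
    refine (h1.trans ?_).trans (hfin a1 0 0 ?_ ?_ ?_)
    · have h2 : 1 ≤ s * (16 * L ^ 2) * (1 / r1) := by
        rw [div_lt_iff₀ (by positivity)] at hcase
        rw [mul_one_div, one_le_div hr10]
        exact hcase.le
      have h3 : 1 ≤ s * a1 * (1 / r) := by
        refine h2.trans ?_
        have := mul_le_mul_of_nonneg_left hr1r (show 0 ≤ s * (16 * L ^ 2) by positivity)
        refine this.trans_eq ?_
        rw [ha1]
        ring
      have h4 := mul_le_mul_of_nonneg_right h3 hI0
      rw [one_mul] at h4
      refine h4.trans_eq ?_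
      ring
    · rw [hC]
      have : 0 ≤ k2 * ((D + 2 * L) * (1 + D / δ) + 1) := by positivity
      linarith
    · exact (growthConst_pos hL1 hδ hD.le).le
    · exact (growthConst_pos hL1 hδ hD.le).le
  · set R := r1 / (2 * L) with hR
    set t := 4 * L * s with ht
    have hR0 : 0 < R := by positivity
    have ht0 : 0 < t := by positivity
    have htR : t ≤ R / 2 := by
      rw [le_div_iff₀ (by positivity)] at hcase
      rw [ht, hR, div_div, le_div_iff₀ (by positivity)]
      linarith
    have hRδ : R ≤ δ := by
      rw [hR, div_le_iff₀ (by positivity)]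
      have : r1 ≤ δ := min_le_right _ _
      nlinarith
    have hLR : L * R < r := by
      have e : L * R = r1 / 2 := by
        rw [hR]
        field_simp
      have : r1 ≤ r := min_le_left _ _
      linarith
    have hbR := hcb.mono hR0 hRδ
    have hbt := hcb.mono ht0 (by linarith : t ≤ δ)
    have hiR := hbR.closedBall_subset_interior hσ.isHomogeneous hr hLR.le
    have hrR := hiR.trans interior_subset
    set y := nChart (m := m) c x with hy
    have htsub : Metric.closedBall y t ⊆ Metric.closedBall y R :=
      Metric.closedBall_subset_closedBall (by linarith)
    have hRhb : Metric.closedBall y R ⊆ halfBall c ε := fun z hz =>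
      hs ⟨Metric.closedBall_subset_closedBall hRδ hz, hrR hz⟩
    have hRt : Metric.closedBall y R ⊆ (nChart (m := m) c).target := fun z hz =>
      (hG.subset (hRhb hz)).1
    have himg : (nChart (m := m) c).symm '' Metric.closedBall y R ⊆ Br :=
      hbR.image_subset_metricBall hσ.isHomogeneous hrR hLR
    have hball : metricBall (𝓡∂ m) σ x s ⊆ (nChart (m := m) c).symm '' Metric.closedBall y t :=
      hbt.metricBall_subset hσ.isHomogeneous (by rw [ht]; field_simp; rfl)
    have hwc : ContinuousOn (𝓜.tilt ι u) ((nChart (m := m) c).symm '' Metric.closedBall y R) := by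
      rintro _ ⟨z, hz, rfl⟩
      exact (𝓜.continuousAt_tilt hι hu.smooth (hu.spacelike _
        (symm_mem_interior (hRt hz) (hiR hz)))).continuousWithinAt
    have hcRc := isCompact_closedBall y R
    have hctc := isCompact_closedBall y t
    have f1 : ∀ τ, Metric.closedBall y τ ⊆ Metric.closedBall y R →
        ∫ z in (nChart (m := m) c).symm '' Metric.closedBall y τ, 𝓜.tilt ι u z ∂V
          = ∫ z in Metric.closedBall y τ, volDensity σ c z * 𝓜.tiltRep ι u c z := fun τ hτ => by
      rw [setIntegral_image hσ (hτ.trans hRt) (isCompact_closedBall y τ)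
        (hwc.mono (image_mono hτ))]
      refine setIntegral_congr_fun (isCompact_closedBall y τ).measurableSet fun z hz => ?_
      rw [← hG.tiltRep_eq hι hu.smooth (hRhb (hτ hz))]
    have f2 : ∫ z in (nChart (m := m) c).symm '' Metric.closedBall y R, |ρ z| ∂V
        = ∫ z in Metric.closedBall y R, volDensity σ c z * |ρ ((nChart c).symm z)| :=
      setIntegral_image hσ hRt hcRc hρ.continuous.abs.continuousOn
    have hloc := hG.local_estimate hι hu hρ hT ht0 htR hRhb hiR
    rw [← hσdef, ← f1 t htsub, ← f1 R Subset.rfl, ← f2] at hloc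
    have g1 := setIntegral_tilt_mono (hint.mono_set (himg.trans' (image_mono htsub))) hball
    have g2 := setIntegral_tilt_mono hint himg
    have g3 : ∫ z in (nChart (m := m) c).symm '' Metric.closedBall y R, |ρ z| ∂V ≤ J :=
      setIntegral_mono_set hintρ.abs (Eventually.of_forall fun y => abs_nonneg _)
        (HasSubset.Subset.eventuallyLE himg)
    rw [← hσdef, ← hV] at g1 g2
    -- The summand `1` is absorbed through `r1 ≤ D`, and `1/R` equals `2L / r1`.
    have hR1 : 1 + 1 / R ≤ (D + 2 * L) * (1 + D / δ) * (1 / r) := by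
      have e1 : 1 / R = 2 * L * (1 / r1) := by
        rw [hR]
        field_simp
      have e2 : 1 ≤ D * (1 / r1) := by
        rw [mul_one_div, one_le_div hr10]
        exact (min_le_left _ _).trans hrD
      have e3 := mul_le_mul_of_nonneg_left hr1r (show 0 ≤ D + 2 * L by positivity)
      rw [e1]
      nlinarith
    -- The volume term of order `s^m` becomes `s r^(m-1)`; this uses `m ≥ 1`.
    have hsm : s ^ m ≤ s * r ^ (m - 1) := by
      have hm : m = (m - 1) + 1 := by
        have := NeZero.pos m
        omega
      calc s ^ m = s * s ^ (m - 1) := by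
            conv_lhs => rw [hm, pow_succ]
            ring
        _ ≤ s * r ^ (m - 1) := by gcongr
    have hIR0 : 0 ≤ ∫ z in (nChart (m := m) c).symm '' Metric.closedBall y R, 𝓜.tilt ι u z ∂V :=
      integral_nonneg hw0
    have g4 : (1 + 1 / R) *
        (∫ z in (nChart (m := m) c).symm '' Metric.closedBall y R, 𝓜.tilt ι u z ∂V)
        ≤ (D + 2 * L) * (1 + D / δ) * (1 / r) * I :=
      mul_le_mul hR1 g2 hIR0 (by positivity)
    have g5 := mul_le_mul_of_nonneg_left (add_le_add g4 g3) (show 0 ≤ k2 * s by positivity)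
    have g6 := mul_le_mul_of_nonneg_left hsm hk30
    refine (g1.trans hloc).trans (le_trans ?_ (hfin (k2 * ((D + 2 * L) * (1 + D / δ))) k2 k3
      ?_ ?_ ?_))
    · have e1 : (1 + m.factorial * (2 * L) ^ m) * (t ^ m * vol) = k3 * s ^ m := by
        rw [hk3, ht, mul_pow _ s]
        ring
      rw [e1]
      refine (add_le_add (le_trans (le_of_eq ?_) g5) g6).trans_eq ?_
      · rw [hk2, ht]
        ring
      · ring
    · rw [hC]
      nlinarith
    · rw [hC]
      nlinarith [mul_nonneg hk20 hq0]
    · rw [hC]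
      nlinarith [mul_nonneg hk20 hq0]

end Growth

end PMC

end

/-! ### The integral estimate for the tilt -/

theorem mainTheorem8 {m : ℕ} [NeZero m]
    {S : Type*} [TopologicalSpace S] [ChartedSpace (EuclideanSpace ℝ (Fin m)) S]
    [IsManifold (𝓡 m) ∞ S] [T2Space S] [SecondCountableTopology S] [ConnectedSpace S]
    (𝓜 : PMC.SplitMetric m S) (hsplit : 𝓜.IsSplitting)
    {N : Type*} [TopologicalSpace N] [ChartedSpace (EuclideanHalfSpace m) N]
    [IsManifold (𝓡∂ m) ∞ N] [MeasurableSpace N] [BorelSpace N]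
    (ι : N → ℝ × S) (hι : 𝓜.IsCompactSpacelike ι)
    (hC : IsCompact (closure (𝓜.cauchyDevelopment (range ι))))
    (X : ∀ p : ℝ × S, TangentSpace (PMC.stModel m) p)
    (hX : ContMDiff (PMC.stModel m) (PMC.stModel m).tangent ∞
      (fun p => (⟨p, X p⟩ : TangentBundle (PMC.stModel m) (ℝ × S)))) :
    ∃ C : ℝ, 0 < C ∧
      ∀ ρ : N → ℝ, ContMDiff (𝓡∂ m) 𝓘(ℝ, ℝ) ∞ ρ →
      ∀ u : N → ℝ, 𝓜.IsSmoothSolution ι X ρ u →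
      ∀ (x : N) (s r : ℝ), 0 < s → s < r →
        ENNReal.ofReal r < PMC.edistToBoundary (𝓡∂ m) (𝓜.sigU ι u) x →
        let V := PMC.riemannianVolume (𝓡∂ m) (𝓜.sigU ι u)
        let B := PMC.metricBall (𝓡∂ m) (𝓜.sigU ι u) x
        IntegrableOn (𝓜.tilt ι u) (B r) V ∧
        IntegrableOn ρ (B r) V ∧
        ∫ y in B s, 𝓜.tilt ι u y ∂V ≤
          C * s * ((∫ y in B r, 𝓜.tilt ι u y ∂V) / r + (∫ y in B r, |ρ y| ∂V) + r ^ (m - 1)) := by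
  have := hι.compact
  -- The Hausdorff property is inherited from `ℝ × S` through the injective continuous map `ι`.
  have : T2Space N := T2Space.of_injective_continuous hι.injective hι.smooth.continuous
  obtain ⟨T, hT⟩ := PMC.SplitMetric.exists_height_bound hι hC
  obtain ⟨δ, L, hδ, hL, hch⟩ := PMC.exists_uniform_goodChart hι hX T
  obtain ⟨D, hD, hDb⟩ := PMC.exists_edistToBoundary_le hι hX T
    (PMC.SplitMetric.boundary_nonempty hι hC)
  -- The numbers `T`, `δ`, `L` and `D` are fixed before `ρ` and `u` are introduced, so the constant
  -- is independent of both.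
  refine ⟨PMC.growthConst m L δ D, PMC.growthConst_pos hL hδ hD, fun ρ hρ u hu x s r hs hsr hr => ?_⟩
  have huT := hT u hu.smooth hu.spacelike hu.boundary
  have hcb : ∀ x : N, ∃ c R L, PMC.ChartBound (𝓜.sigU ι u) c x R L := fun x => by
    obtain ⟨c, ε, hG, hx, hs⟩ := hch x
    exact ⟨c, δ, L, hG.chartBound hι hu.smooth huT hx hδ hs⟩
  have h1 := PMC.integrableOn_metricBall hι hu.smooth hu.spacelike hcb hr
  have := PMC.isFiniteMeasure_riemannianVolume (𝓜.isContMetric_sigU hι.smooth hu.smooth)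
  have h2 : Integrable ρ (PMC.riemannianVolume (𝓡∂ m) (𝓜.sigU ι u)) :=
    hρ.continuous.integrable_of_hasCompactSupport (HasCompactSupport.of_compactSpace ρ)
  obtain ⟨c, ε, hG, hx, hsub⟩ := hch x
  have hrD : r ≤ D := by
    have := (hr.trans_le (hDb u hu.smooth huT x)).le
    exact (ENNReal.ofReal_le_ofReal_iff hD).1 this
  exact ⟨h1, h2.integrableOn, hG.ball_estimate hι hu hρ huT hx hδ hsub hs hsr hrD hr h1
    h2.integrableOn⟩
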